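/- Let $n\ge 1$, $s\in(0,1)$, $a=1-2s$ and $\epsilon=(1-a)/4=s/2$. Points of $\mathbb R^n\times\mathbb R\times\mathbb R$ are written $(X,t)$ with $X=(x,y)$, and $\nabla$, $\operatorname{div}$ act in $X$; put $\mathbb B_R=\{X=(x,y): y>0,\ |X|<R\}$ and $\partial_y^aW=\lim_{y\to0^+}y^a\partial_yW$. For $V\in C^1(\mathbb R^n\times\mathbb R)$ let $\|V\|_{C^1}=\sup|V|+\sup|\nabla_xV|+\sup|V_t|$, assumed finite. There exist constants $C>0$ and $R_0>0$, depending only on $n$ and $s$, such that the following holds for every $0<R<R_0$ and every such $V$. Let $g$ be locally integrable up to $\{y=0\}$ and let $\tilde W$ be a weak solution of $$\operatorname{div}(y^a\nabla\tilde W)+y^a\tilde W_t=g\ \text{ in }\{y>0\},\qquad \partial_y^a\tilde W=V\tilde W\ \text{ on }\{y=0\},$$ i.e. $\tilde W$ and its weak gradient $\nabla\tilde W$ belong to $L^2(\{y>0\},\,y^a\,dX\,dt)$, the trace of $\tilde W$ on $\{y=0\}$ is in $L^2(\mathbb R^n\times\mathbb R)$, and $$\int_{\{y>0\}}y^a\big(\langle\nabla\tilde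 W,\nabla\eta\rangle+\tilde W\,\eta_t\big)\,dX\,dt+\int_{\{y>0\}}g\,\eta\,dX\,dt=-\int_{\{y=0\}}V\tilde W\,\eta\,dx\,dt$$ for all $\eta\in C_0^\infty(\mathbb R^n\times\mathbb R\times\mathbb R)$. Suppose that $\tilde W$ is compactly supported in $(\overline{\mathbb B_R}\setminus\{0\})\times(0,1)$. Then for every $\alpha>C\big(1+\|V\|_{C^1}^{1/(2s)}\big)$, $$\alpha^3\int_{\{y>0\}}|X|^{-2\alpha-4+\epsilon}e^{2\alpha|X|^\epsilon}\,\tilde W^2\,y^a\,dX\,dt\ \le\ C\int_{\{y>0\}}|X|^{-2\alpha}e^{2\alpha|X|^\epsilon}\,g^2\,y^{-a}\,dX\,dt,$$ where the right-hand side may be $+\infty$. -/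

import Mathlib

open MeasureTheory Set
open scoped ContDiff ENNReal

namespace ParabolicExtension

noncomputable section

/-- The space `ℝⁿ × ℝ × ℝ` of points `(x, y, t)`; we write `X = (x, y)`. -/
abbrev Pt (n : ℕ) : Type := EuclideanSpace ℝ (Fin n) × ℝ × ℝ

/-- The thin space `ℝⁿ × ℝ` of points `(x, t)`, identified with `{y = 0}`. -/
abbrev ThinPt (n : ℕ) : Type := EuclideanSpace ℝ (Fin n) × ℝ

/-- The point `(x, 0, t)` of the thin set. -/
def onThin {n : ℕ} (q : ThinPt n) : Pt n := (q.1, 0, q.2)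

/-- The open region `{y > 0}`. -/
def upper (n : ℕ) : Set (Pt n) := {p | 0 < p.2.1}

/-- The Euclidean length `|X|` of `X = (x, y)`. -/
def rad {n : ℕ} (p : Pt n) : ℝ := Real.sqrt (‖p.1‖ ^ 2 + p.2.1 ^ 2)

/-- The measure `y ^ a dX dt` on `{y > 0}`. -/
def weighted (n : ℕ) (a : ℝ) : Measure (Pt n) :=
  (volume.restrict (upper n)).withDensity fun p => ENNReal.ofReal (p.2.1 ^ a)

/-- Test functions: smooth and compactly supported in the whole space (they need not vanish on the
thin set). -/
structure IsTest {n : ℕ} (η : Pt n → ℝ) : Prop where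
  smooth : ContDiff ℝ ∞ η
  compact : HasCompactSupport η

/-- `(Gx, Gy)` is the weak gradient of `u` in the variable `X = (x, y)` on `{y > 0}`: integration by
parts in each direction `(h, k)` against test functions with compact support in `{y > 0}`. -/
def HasWeakGradient {n : ℕ} (u : Pt n → ℝ) (Gx : Pt n → EuclideanSpace ℝ (Fin n))
    (Gy : Pt n → ℝ) : Prop :=
  ∀ η : Pt n → ℝ, IsTest η → tsupport η ⊆ upper n →
    ∀ (h : EuclideanSpace ℝ (Fin n)) (k : ℝ),
      ∫ p in upper n, u p * fderiv ℝ η p (h, k, 0) =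
        - ∫ p in upper n, (inner ℝ (Gx p) h + Gy p * k) * η p

/-- `b` is the trace on `{y = 0}` of the function `u` whose weak `y`-derivative is `Gy`:
Green's formula `∫_{y>0} (u ∂_y η + Gy η) = - ∫_{y=0} b η`. -/
def HasTrace {n : ℕ} (u Gy : Pt n → ℝ) (b : ThinPt n → ℝ) : Prop :=
  ∀ η : Pt n → ℝ, IsTest η →
    ∫ p in upper n, (u p * fderiv ℝ η p (0, 1, 0) + Gy p * η p) =
      - ∫ q : ThinPt n, b q * η (onThin q)

/-- `u` is a weak solution, in the energy class of the weight `y ^ a`, of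
`div (y ^ a ∇ u) + y ^ a u_t = g` in `{y > 0}` with `lim_{y → 0+} y ^ a ∂_y u = V u` on `{y = 0}`:
`u` and its weak gradient in `X` are square integrable for `y ^ a dX dt`, and
`∫_{y>0} y ^ a (⟨∇ u, ∇ η⟩ + u η_t) + ∫_{y>0} g η = - ∫_{y=0} V u η` for all test functions `η`.
Here `fderiv ℝ η p (Gx p, Gy p, 0)` is `⟨∇ u, ∇ η⟩` and `fderiv ℝ η p (0, 0, 1)` is `η_t`. -/
def IsWeakSolution {n : ℕ} (a : ℝ) (V : ThinPt n → ℝ) (g u : Pt n → ℝ) : Prop :=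
  MemLp u 2 (weighted n a) ∧ LocallyIntegrable g (volume.restrict (upper n)) ∧
  ∃ (Gx : Pt n → EuclideanSpace ℝ (Fin n)) (Gy : Pt n → ℝ) (b : ThinPt n → ℝ),
    MemLp Gx 2 (weighted n a) ∧ MemLp Gy 2 (weighted n a) ∧ MemLp b 2 volume ∧
    HasWeakGradient u Gx Gy ∧ HasTrace u Gy b ∧
    ∀ η : Pt n → ℝ, IsTest η →
      (∫ p in upper n, p.2.1 ^ a *
          (fderiv ℝ η p (Gx p, Gy p, 0) + u p * fderiv ℝ η p (0, 0, 1))) +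
        ∫ p in upper n, g p * η p =
      - ∫ q : ThinPt n, V q * b q * η (onThin q)

/-- `u` is compactly supported in `(closure 𝔹_R \ {0}) × (0, 1)`, where `𝔹_R` is the half-ball
`{y > 0, |X| < R}`: it vanishes almost everywhere in `{y > 0}` off a compact subset of that set. -/
def SupportedInHalfBall {n : ℕ} (R : ℝ) (u : Pt n → ℝ) : Prop :=
  ∃ K : Set (Pt n), IsCompact K ∧
    K ⊆ {p | 0 ≤ p.2.1 ∧ 0 < rad p ∧ rad p ≤ R ∧ 0 < p.2.2 ∧ p.2.2 < 1} ∧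
    ∀ᵐ p ∂(volume.restrict (upper n)), p ∉ K → u p = 0

/-- The norm `‖V‖_{C¹} = sup |V| + sup |∇_x V| + sup |V_t|` over `ℝⁿ × ℝ` (possibly infinite). -/
def c1Norm {n : ℕ} (V : ThinPt n → ℝ) : ℝ≥0∞ :=
  (⨆ q, ‖V q‖ₑ) + (⨆ q : ThinPt n, ‖fderiv ℝ (fun x => V (x, q.2)) q.1‖ₑ) +
    ⨆ q : ThinPt n, ‖deriv (fun t => V (q.1, t)) q.2‖ₑ

end

end ParabolicExtension

/-! Write `L u = div (y^a ∇u) + y^a u_t`, `D = n + 1 + a`, `ρ = ε|X|^ε`, and let `K = |X|^(-2α-2)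
e^(2α|X|^ε)`. The interior estimate comes from integrating `L u` against the multiplier `K (X·∇u + β
u) + κ u_t`. The choice `β = -α - 2 + D/2 + αρ` cancels the coefficient of `|∇u|²` in the resulting
Rellich identity. Adding the exact divergences of `y^a c X u²` and `y^a d u²` (in `X` and in `t`)
and taking `κ = K|X|²/(2α(1-ρ))` completes the squares: up to the factor `y^a K/|X|²` the integrand
becomes a quadratic form in `z = X·∇u + βu`, `τ = κ u_t / K` and `u`, led by `-2α(1-ρ)(z+τ)²`. The
factor `e^(2α|X|^ε)` makes the weight strictly convex: it leaves a negative multiple of `u²` of size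
`α²ερ`. Hence the integral of the `z²` density plus `α²ε²/2` times the mass is at most `1/(2α)`
times the source term plus a boundary term (`carleman_pointwise`,
`Profile.integral_energyIntegrand`). Multiplied by `α`, this is the claim, apart from the boundary
term.

On `{y = 0}` the conormal derivative is `V u`. After tangential integrations by parts the large
coefficient `β` cancels, and the boundary term is at most `2‖V‖ ∫ K u²` (`thin_pointwise`). A trace
inequality on the vertical segment of height `|x|/α` bounds `∫ K u²` by `α^(1+a)` times the mass
plus `α^(a-1)` times a weighted energy (`SupportedIn.traceMass_le`). The energy is controlled by
`α²` times the mass, the `z²` term, `1/α` times the source and the same boundary term, by testing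
the equation with the weighted solution itself (`gradient_pointwise`). Since `‖V‖ ≤ l α^(1-a)` with
`1 - a = 2s` and `l` small, everything is absorbed (`Profile.SupportedIn.carleman_le`). This balance
is the origin of the exponent `1/(2s)`.

A weak solution is not regular enough for these computations, so it is mollified in `(x, t)` only.
For each kernel the equation becomes an ordinary differential equation in `y` for `u` and `P = y^a
∂_y u`, which supplies the regularity in `y` up to the boundary. The price is that the mollified
trace of `P` is `(V b) * κ`, not `V (b * κ)`. The difference and its first derivatives are
Friedrichs commutators, bounded by `‖V‖` times the convolution of `|b|` with a kernel of mass
independent of the scale. This contribution need not tend to zero: it is at most a constant times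
`‖V‖ ∫ K u²` at small scales, so it is absorbed with the boundary term
(`SlabSolution.commDensity_le`, `SlabSolution.eventually_commDensity_le`). Jensen's inequality
bounds the mollified source, and Fatou's lemma removes the mollification. -/

namespace ParabolicExtension

/-! ### Absolutely continuous functions of the height, and the one-dimensional trace inequality -/

noncomputable section

/-- `A` is locally absolutely continuous on `[0, ∞)` with almost everywhere derivative `A'`. -/
def IsPrimitive (A A' : ℝ → ℝ) : Prop :=
  (∀ Y, 0 ≤ Y → AbsolutelyContinuousOnInterval A 0 Y) ∧
    ∀ᵐ y ∂(volume.restrict (Ioi (0 : ℝ))), HasDerivAt A (A' y) y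

namespace IsPrimitive

variable {A A' B B' : ℝ → ℝ}

theorem mul (hA : IsPrimitive A A') (hB : IsPrimitive B B') :
    IsPrimitive (fun y => A y * B y) (fun y => A' y * B y + A y * B' y) :=
  ⟨fun Y hY => (hA.1 Y hY).fun_mul (hB.1 Y hY), by
    filter_upwards [hA.2, hB.2] with y h1 h2 using h1.mul h2⟩

theorem add (hA : IsPrimitive A A') (hB : IsPrimitive B B') :
    IsPrimitive (fun y => A y + B y) (fun y => A' y + B' y) :=
  ⟨fun Y hY => (hA.1 Y hY).fun_add (hB.1 Y hY), by
    filter_upwards [hA.2, hB.2] with y h1 h2 using h1.add h2⟩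

theorem congr (hA : IsPrimitive A A') (h : ∀ y, 0 < y → A' y = B' y) : IsPrimitive A B' :=
  ⟨hA.1, by
    filter_upwards [hA.2, ae_restrict_mem measurableSet_Ioi] with y h1 h2
    rw [← h y h2]; exact h1⟩

theorem of_contDiff (hA : ContDiff ℝ 1 A) (h : ∀ y, HasDerivAt A (A' y) y) : IsPrimitive A A' :=
  ⟨fun _ _ => hA.contDiffOn.absolutelyContinuousOnInterval, Filter.Eventually.of_forall h⟩

theorem const (c : ℝ) : IsPrimitive (fun _ => c) (fun _ => 0) :=
  of_contDiff contDiff_const fun y => hasDerivAt_const y c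

theorem const_mul (c : ℝ) (hA : IsPrimitive A A') :
    IsPrimitive (fun y => c * A y) (fun y => c * A' y) :=
  ((const c).mul hA).congr fun y _ => by ring

theorem sum {ι : Type*} (s : Finset ι) {A A' : ι → ℝ → ℝ} (h : ∀ i, IsPrimitive (A i) (A' i)) :
    IsPrimitive (fun y => ∑ i ∈ s, A i y) (fun y => ∑ i ∈ s, A' i y) := by
  classical
  induction s using Finset.induction_on with
  | empty => simpa using const 0
  | insert i s hi ih =>
    simp only [Finset.sum_insert hi]
    exact (h i).add ih

theorem continuousOn (hA : IsPrimitive A A') : ContinuousOn A (Ici 0) := by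
  intro y hy
  have h := (hA.1 (y + 1) (by have : (0 : ℝ) ≤ y := hy; linarith)).continuousOn
  rw [uIcc_of_le (by have : (0 : ℝ) ≤ y := hy; linarith)] at h
  refine (h y ⟨hy, by linarith⟩).mono_of_mem_nhdsWithin ?_
  rw [← Ici_inter_Iic]
  exact Filter.inter_mem self_mem_nhdsWithin
    (mem_nhdsWithin_of_mem_nhds (Iic_mem_nhds (by linarith)))

theorem deriv_ae (hA : IsPrimitive A A') (Y : ℝ) (hY : 0 ≤ Y) :
    ∀ᵐ y, y ∈ uIoc 0 Y → deriv A y = A' y := by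
  have h := hA.2
  rw [ae_restrict_iff' measurableSet_Ioi] at h
  filter_upwards [h] with y hy h2
  rw [uIoc_of_le hY] at h2
  exact (hy h2.1).deriv

theorem integral_eq (hA : IsPrimitive A A') {Y : ℝ} (hY : 0 ≤ Y) :
    ∫ y in (0 : ℝ)..Y, A' y = A Y - A 0 := by
  rw [← (hA.1 Y hY).integral_deriv_eq_sub]
  refine (intervalIntegral.integral_congr_ae ?_).symm
  exact hA.deriv_ae Y hY

theorem of_integral (hi : ∀ Y, 0 ≤ Y → IntervalIntegrable A' volume 0 Y)
    (h : ∀ y, 0 ≤ y → A y = A 0 + ∫ t in (0 : ℝ)..y, A' t) : IsPrimitive A A' := by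
  constructor
  · intro Y hY
    have h1 : AbsolutelyContinuousOnInterval (fun y => A 0 + ∫ t in (0 : ℝ)..y, A' t) 0 Y :=
      AbsolutelyContinuousOnInterval.fun_add
        (contDiff_const (n := 1)).contDiffOn.absolutelyContinuousOnInterval
        ((hi Y hY).absolutelyContinuousOnInterval_intervalIntegral (by simp))
    -- `A` equals its integral formula only on `[0, ∞)`, so absolute continuity is transferred
    -- through the definition, which sees only points of `[0, Y]`.
    rw [absolutelyContinuousOnInterval_iff] at h1 ⊢
    intro η hη
    obtain ⟨δ, hδ, H⟩ := h1 η hη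
    refine ⟨δ, hδ, fun E hE hE' => ?_⟩
    refine lt_of_eq_of_lt (Finset.sum_congr rfl fun i hi' => ?_) (H E hE hE')
    have h2 := hE.1 i hi'
    rw [uIcc_of_le hY] at h2
    rw [h _ h2.1.1, h _ h2.2.1]
  · have h1 : ∀ᵐ y, ∀ N : ℕ, y ∈ uIcc 0 (N : ℝ) →
        HasDerivAt (fun x => ∫ t in (0 : ℝ)..x, A' t) (A' y) y := by
      rw [ae_all_iff]
      intro N
      filter_upwards [(hi N N.cast_nonneg).ae_hasDerivAt_integral] with y hy h2
      exact hy h2 0 (by simp)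
    rw [ae_restrict_iff' measurableSet_Ioi]
    filter_upwards [h1] with y hy hy0
    have hy0 : 0 < y := hy0
    obtain ⟨N, hN⟩ := exists_nat_ge y
    have h2 := hy N (by rw [uIcc_of_le N.cast_nonneg]; exact ⟨hy0.le, hN⟩)
    refine (h2.const_add (A 0)).congr_of_eventuallyEq ?_
    filter_upwards [Ioi_mem_nhds hy0] with x hx
    exact h x (le_of_lt hx)

/-- For `p < 1` the derivative blows up at the origin but stays integrable. This covers the factors
`y^(1-a)` and `y^(1+a)`, which are not differentiable at `0` in general. -/
theorem rpow {p : ℝ} (hp : 0 < p) : IsPrimitive (fun y => y ^ p) (fun y => p * y ^ (p - 1)) := by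
  refine of_integral (fun Y hY => ?_) fun y hy => ?_
  · exact (intervalIntegral.intervalIntegrable_rpow' (by linarith)).const_mul p
  · rw [intervalIntegral.integral_const_mul, integral_rpow (Or.inl (by linarith))]
    simp only [sub_add_cancel, Real.zero_rpow hp.ne']
    field_simp
    ring

/-- The integral of the derivative of a function vanishing at the right end point. -/
theorem setIntegral_eq_neg (hA : IsPrimitive A A') {Y : ℝ} (hY : 0 ≤ Y) (h0 : A Y = 0) :
    ∫ y in Ioc 0 Y, A' y = -A 0 := by
  rw [← intervalIntegral.integral_of_le hY, hA.integral_eq hY, h0]; ring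

end IsPrimitive

/-- A function whose weak derivative on the half line, tested up to the boundary, is `f`, is the
primitive of `f` with the boundary value prescribed by the weak formulation. -/
theorem ae_eq_add_integral_of_weak {p f : ℝ → ℝ} {B : ℝ}
    (hp : ∀ Y, 0 ≤ Y → IntervalIntegrable p volume 0 Y)
    (hf : ∀ Y, 0 ≤ Y → IntervalIntegrable f volume 0 Y)
    (h : ∀ χ : ℝ → ℝ, ContDiff ℝ ∞ χ → HasCompactSupport χ →
      ∫ y in Ioi (0 : ℝ), (p y * deriv χ y + f y * χ y) = -(B * χ 0)) :
    ∀ᵐ y ∂(volume.restrict (Ioi (0 : ℝ))), p y = B + ∫ t in (0 : ℝ)..y, f t := by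
  set F : ℝ → ℝ := fun y => B + ∫ t in (0 : ℝ)..y, f t with hF
  have hF0 : F 0 = B := by simp [hF]
  have hFp : IsPrimitive F f := IsPrimitive.of_integral hf fun y _ => by rw [hF0]
  have hFc := hFp.continuousOn
  have hloc : ∀ q : ℝ → ℝ, (∀ Y, 0 ≤ Y → IntervalIntegrable q volume 0 Y) →
      LocallyIntegrableOn q (Ioi 0) := by
    intro q hq
    rw [locallyIntegrableOn_iff isOpen_Ioi.isLocallyClosed]
    intro K hK hKc
    obtain ⟨M, hM⟩ := hKc.isBounded.bddAbove
    have := (intervalIntegrable_iff_integrableOn_Ioc_of_le (le_max_left 0 M)).1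
      (hq (max 0 M) (le_max_left 0 M))
    exact this.mono_set fun y hy => ⟨hK hy, (hM hy).trans (le_max_right _ _)⟩
  have hFi : ∀ Y, 0 ≤ Y → IntervalIntegrable F volume 0 Y := fun Y hY => by
    refine ContinuousOn.intervalIntegrable (hFc.mono ?_)
    rw [uIcc_of_le hY]; exact Icc_subset_Ici_self
  have key : ∀ᵐ y, y ∈ Ioi (0 : ℝ) → p y - F y = 0 := by
    refine isOpen_Ioi.ae_eq_zero_of_integral_contDiff_smul_eq_zero
      ((hloc p hp).sub (hloc F hFi)) ?_
    intro ψ hψ hψc hψs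
    obtain ⟨M, hM⟩ := hψc.isCompact.isBounded.bddAbove
    set Y : ℝ := max 1 M + 1 with hYdef
    have hY : 0 < Y := by positivity
    have hψY : ∀ y, Y ≤ y → ψ y = 0 := fun y hy => by
      by_contra hne
      have := hM (subset_tsupport ψ hne)
      have := le_max_right 1 M
      linarith
    have hψ0 : ∀ y, y ≤ 0 → ψ y = 0 := fun y hy => by
      by_contra hne
      have : (0 : ℝ) < y := hψs (subset_tsupport ψ hne)
      linarith
    -- Based at `Y`, the antiderivative of `ψ` vanishes beyond `Y` but need not vanish at `0`, which
    -- brings in the boundary value `B`. The factor `θ` below makes the support compact on the left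
    -- without changing anything on `[0, ∞)`.
    set χ0 : ℝ → ℝ := fun y => ∫ t in Y..y, ψ t with hχ0
    have hχd : ∀ y, HasDerivAt χ0 (ψ y) y := fun y =>
      intervalIntegral.integral_hasDerivAt_right (hψ.continuous.intervalIntegrable _ _)
        hψ.continuous.aestronglyMeasurable.stronglyMeasurableAtFilter hψ.continuous.continuousAt
    have hderiv : deriv χ0 = ψ := funext fun y => (hχd y).deriv
    have hχs : ContDiff ℝ ∞ χ0 := by
      rw [contDiff_infty_iff_deriv, hderiv]
      exact ⟨fun y => (hχd y).differentiableAt, hψ⟩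
    have hχY : ∀ y, Y ≤ y → χ0 y = 0 := fun y hy => by
      simp only [hχ0]
      rw [intervalIntegral.integral_congr (g := fun _ => (0 : ℝ)), intervalIntegral.integral_zero]
      intro t ht
      rw [uIcc_of_le hy] at ht
      exact hψY t ht.1
    set θ : ℝ → ℝ := fun y => Real.smoothTransition (y + 2) with hθ
    have hθs : ContDiff ℝ ∞ θ := Real.smoothTransition.contDiff.comp (contDiff_id.add contDiff_const)
    have hθ1 : ∀ y, -1 ≤ y → θ y = 1 := fun y hy =>
      Real.smoothTransition.one_of_one_le (by linarith)
    have hθ0 : ∀ y, y ≤ -2 → θ y = 0 := fun y hy =>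
      Real.smoothTransition.zero_of_nonpos (by linarith)
    have hw := h (fun y => θ y * χ0 y) (hθs.mul hχs) (by
      refine HasCompactSupport.intro (K := Icc (-2) Y) isCompact_Icc fun y hy => ?_
      rw [mem_Icc, not_and_or, not_le, not_le] at hy
      rcases hy with hy | hy
      · simp [hθ0 y hy.le]
      · simp [hχY y hy.le])
    have hd : ∀ y, 0 < y → deriv (fun y => θ y * χ0 y) y = ψ y := fun y hy => by
      refine HasDerivAt.deriv ((hχd y).congr_of_eventuallyEq ?_)
      filter_upwards [Ioi_mem_nhds hy] with x hx
      have hx : (0 : ℝ) < x := hx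
      simp [hθ1 x (by linarith)]
    have hsub : ∀ G : ℝ → ℝ, (∀ y, Y < y → G y = 0) →
        ∫ y in Ioi (0 : ℝ), G y = ∫ y in (0 : ℝ)..Y, G y := fun G hG => by
      rw [intervalIntegral.integral_of_le hY.le]
      refine (setIntegral_eq_of_subset_of_forall_sdiff_eq_zero measurableSet_Ioi
        Ioc_subset_Ioi_self fun y hy => hG y ?_)
      by_contra hle
      exact hy.2 ⟨hy.1, not_lt.1 hle⟩
    have e1 : ∫ y in (0 : ℝ)..Y, (p y * ψ y + f y * χ0 y) = -(B * χ0 0) := by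
      rw [← hsub _ fun y hy => by simp [hψY y hy.le, hχY y hy.le]]
      have : θ 0 = 1 := hθ1 0 (by norm_num)
      simp only [this, one_mul] at hw
      rw [← hw]
      refine setIntegral_congr_fun measurableSet_Ioi fun y hy => ?_
      have hy : (0 : ℝ) < y := hy
      simp only [hd y hy, hθ1 y (by linarith), one_mul]
    have hχp : IsPrimitive χ0 ψ := IsPrimitive.of_contDiff (hχs.of_le (by simp)) hχd
    have e2 := (hFp.mul hχp).integral_eq hY.le
    simp only [hχY Y le_rfl, mul_zero, hF0, zero_sub] at e2
    have hpψ : IntervalIntegrable (fun y => p y * ψ y) volume 0 Y :=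
      (hp Y hY.le).mul_continuousOn hψ.continuous.continuousOn
    have hFψ : IntervalIntegrable (fun y => F y * ψ y) volume 0 Y :=
      (hFi Y hY.le).mul_continuousOn hψ.continuous.continuousOn
    have hfχ : IntervalIntegrable (fun y => f y * χ0 y) volume 0 Y :=
      (hf Y hY.le).mul_continuousOn hχs.continuous.continuousOn
    rw [intervalIntegral.integral_add hpψ hfχ] at e1
    rw [intervalIntegral.integral_add hfχ hFψ] at e2
    have e3 : ∫ y in (0 : ℝ)..Y, (p y * ψ y - F y * ψ y) = 0 := by
      rw [intervalIntegral.integral_sub hpψ hFψ]; linarith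
    have e4 : ∫ y, ψ y • (p y - F y) = ∫ y in Ioi (0 : ℝ), ψ y • (p y - F y) := by
      refine (setIntegral_eq_integral_of_forall_compl_eq_zero (μ := volume) (s := Ioi (0 : ℝ))
        (f := fun y => ψ y • (p y - F y)) fun y hy => ?_).symm
      simp [hψ0 y (not_lt.1 hy)]
    change ∫ y, ψ y • (p y - F y) = 0
    rw [e4, hsub (fun y => ψ y • (p y - F y)) fun y hy => by simp [hψY y hy.le]]
    refine Eq.trans ?_ e3
    exact intervalIntegral.integral_congr fun y _ => by simp only [smul_eq_mul]; ring
  rw [ae_restrict_iff' measurableSet_Ioi]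
  filter_upwards [key] with y hy h1
  have := hy h1
  linarith

/-- The trace inequality on an interval of length `h`, with the weight `y ^ a`. -/
theorem sq_trace_le {a h : ℝ} (ha : -1 < a) (ha1 : a < 1) (hh : 0 < h) {u P : ℝ → ℝ}
    (hu : IsPrimitive u (fun y => y ^ (-a) * P y)) (hP : ContinuousOn P (Ici 0)) :
    u 0 ^ 2 ≤ (1 + a) * (2 * h ^ (-1 - a) * (∫ y in Ioc 0 h, y ^ a * u y ^ 2) +
      1 / (1 - a) * h ^ (1 - a) * ∫ y in Ioc 0 h, y ^ (-a) * P y ^ 2) := by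
  have hsub : ∀ y, 0 ≤ y → uIcc 0 y ⊆ Ici (0 : ℝ) := fun y hy => by
    rw [uIcc_of_le hy]; exact Icc_subset_Ici_self
  have hi0 : ∀ y, IntervalIntegrable (fun t : ℝ => t ^ (-a)) volume 0 y := fun y =>
    intervalIntegral.intervalIntegrable_rpow' (by linarith)
  have hi1 : ∀ y, 0 ≤ y → IntervalIntegrable (fun t : ℝ => t ^ (-a) * P t) volume 0 y :=
    fun y hy => (hi0 y).mul_continuousOn (hP.mono (hsub y hy))
  have hi2 : ∀ y, 0 ≤ y → IntervalIntegrable (fun t : ℝ => t ^ (-a) * P t ^ 2) volume 0 y :=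
    fun y hy => (hi0 y).mul_continuousOn ((hP.mono (hsub y hy)).pow 2)
  rw [← intervalIntegral.integral_of_le hh.le, ← intervalIntegral.integral_of_le hh.le]
  set D := ∫ y in (0 : ℝ)..h, y ^ (-a) * P y ^ 2 with hD
  have hI : ∀ y : ℝ, ∫ t in (0 : ℝ)..y, t ^ (-a) = y ^ (1 - a) / (1 - a) := fun y => by
    rw [integral_rpow (Or.inl (by linarith)), show -a + 1 = 1 - a by ring,
      Real.zero_rpow (by linarith), sub_zero]
  have ha1' : 0 < 1 - a := by linarith
  have ha' : 0 < 1 + a := by linarith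
  -- From `u 0 = u y - ∫ t^(-a) P` and Cauchy–Schwarz with weight `t^(-a)`. The factor `y^a` makes
  -- both terms integrable over `(0, h)`, and integration then gives the claim.
  have pt : ∀ y ∈ Ioc 0 h, y ^ a * u 0 ^ 2 ≤ 2 * (y ^ a * u y ^ 2) + 2 * y / (1 - a) * D := by
    intro y hy
    have hy0 := hy.1
    have hJ := hu.integral_eq hy0.le
    set J := ∫ t in (0 : ℝ)..y, t ^ (-a) * P t with hJd
    have hDy : ∫ t in (0 : ℝ)..y, t ^ (-a) * P t ^ 2 ≤ D := by
      refine intervalIntegral.integral_mono_interval le_rfl hy0.le hy.2 ?_ (hi2 h hh.le)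
      filter_upwards [ae_restrict_mem measurableSet_Ioc] with t ht
      have := ht.1
      simp only [Pi.zero_apply]; positivity
    set I := y ^ (1 - a) / (1 - a) with hId
    have hIpos : 0 < I := by positivity
    have hcs : J ^ 2 ≤ I * D := by
      -- This `c` minimises `∫ t^(-a) (P - c)²`; nonnegativity of the minimum is the Cauchy–Schwarz
      -- inequality.
      set c := J / I with hc
      have h0 : 0 ≤ ∫ t in (0 : ℝ)..y, t ^ (-a) * (P t - c) ^ 2 :=
        intervalIntegral.integral_nonneg hy0.le fun t ht => by
          have := ht.1
          positivity
      have h1 : ∫ t in (0 : ℝ)..y, t ^ (-a) * (P t - c) ^ 2 =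
          (∫ t in (0 : ℝ)..y, t ^ (-a) * P t ^ 2) - 2 * c * J + c ^ 2 * I := by
        rw [hId, ← hI y, hJd, ← intervalIntegral.integral_const_mul,
          ← intervalIntegral.integral_const_mul,
          ← intervalIntegral.integral_sub (hi2 y hy0.le) ((hi1 y hy0.le).const_mul _),
          ← intervalIntegral.integral_add ((hi2 y hy0.le).sub ((hi1 y hy0.le).const_mul _))
            ((hi0 y).const_mul _)]
        refine intervalIntegral.integral_congr fun t _ => ?_
        ring
      have hcI : c * I = J := by rw [hc]; field_simp
      have h2 : c * J ≤ D := by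
        have : c ^ 2 * I = c * J := by rw [← hcI]; ring
        linarith
      calc J ^ 2 = I * (c * J) := by rw [← hcI]; ring
        _ ≤ I * D := by gcongr
    have h3 : u 0 ^ 2 ≤ 2 * u y ^ 2 + 2 * (I * D) := by
      have : u 0 = u y - J := by rw [hJ]; ring
      rw [this]
      linarith [sq_nonneg (u y + J), hcs, (by ring : (u y - J) ^ 2 + (u y + J) ^ 2 =
        2 * u y ^ 2 + 2 * J ^ 2)]
    have h4 : y ^ a * I = y / (1 - a) := by
      rw [hId, mul_div_assoc', ← Real.rpow_add hy0]; simp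
    calc y ^ a * u 0 ^ 2 ≤ y ^ a * (2 * u y ^ 2 + 2 * (I * D)) := by gcongr
      _ = 2 * (y ^ a * u y ^ 2) + 2 * (y ^ a * I) * D := by ring
      _ = _ := by rw [h4]; ring
  have hi3 : IntervalIntegrable (fun y : ℝ => y ^ a) volume 0 h :=
    intervalIntegral.intervalIntegrable_rpow' ha
  have hi4 : IntervalIntegrable (fun y : ℝ => y ^ a * u y ^ 2) volume 0 h :=
    hi3.mul_continuousOn ((hu.continuousOn.mono (hsub h hh.le)).pow 2)
  have hi5 : IntervalIntegrable (fun y : ℝ => 2 * y / (1 - a) * D) volume 0 h :=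
    Continuous.intervalIntegrable (by fun_prop) _ _
  have hint := intervalIntegral.integral_mono_on_of_le_Ioo hh.le (hi3.mul_const (u 0 ^ 2))
    ((hi4.const_mul 2).add hi5) fun y hy => pt y ⟨hy.1, hy.2.le⟩
  rw [intervalIntegral.integral_mul_const, intervalIntegral.integral_add (hi4.const_mul 2) hi5,
    intervalIntegral.integral_const_mul, intervalIntegral.integral_mul_const,
    integral_rpow (Or.inl ha), Real.zero_rpow (by linarith), sub_zero,
    show (fun y : ℝ => 2 * y / (1 - a)) = fun y => (2 / (1 - a)) * y from funext fun y => by ring,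
    intervalIntegral.integral_const_mul, integral_id, show a + 1 = 1 + a by ring] at hint
  have hhp : h ^ (-1 - a) * h ^ (1 + a) = 1 := by
    rw [← Real.rpow_add hh]; simp
  have hhp2 : h ^ (-1 - a) * h ^ 2 = h ^ (1 - a) := by
    rw [← Real.rpow_natCast h 2, ← Real.rpow_add hh]; congr 1; push_cast; ring
  have hpos : 0 < h ^ (-1 - a) := by positivity
  set E := ∫ y in (0 : ℝ)..h, y ^ a * u y ^ 2 with hE
  have h5 := mul_le_mul_of_nonneg_left hint (mul_pos ha' hpos).le
  calc u 0 ^ 2 = (1 + a) * h ^ (-1 - a) * (h ^ (1 + a) / (1 + a) * u 0 ^ 2) := by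
        rw [show (1 + a) * h ^ (-1 - a) * (h ^ (1 + a) / (1 + a) * u 0 ^ 2) =
          ((1 + a) / (1 + a)) * (h ^ (-1 - a) * h ^ (1 + a)) * u 0 ^ 2 by ring, hhp,
          div_self ha'.ne']; ring
    _ ≤ _ := h5
    _ = _ := by rw [← hhp2]; ring

end
end ParabolicExtension

/-! ### Tangential derivatives, radial weights and integration by parts on boxes -/

namespace ParabolicExtension

noncomputable section

/-- The `i`-th spatial direction in the thin space. -/
def dirX {n : ℕ} (i : Fin n) : ThinPt n := (EuclideanSpace.single i 1, 0)

/-- The time direction in the thin space. -/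
def dirT (n : ℕ) : ThinPt n := (0, 1)

/-- `A'` is the derivative of `A` in the tangential direction `e`, at every height `y ≥ 0`. -/
def HasTangential {n : ℕ} (e : ThinPt n) (A A' : ThinPt n → ℝ → ℝ) : Prop :=
  ∀ q y, 0 ≤ y → HasLineDerivAt ℝ (fun q => A q y) (A' q y) q e

namespace HasTangential

variable {n : ℕ} {e : ThinPt n} {A A' B B' : ThinPt n → ℝ → ℝ}

theorem mul (hA : HasTangential e A A') (hB : HasTangential e B B') :
    HasTangential e (fun q y => A q y * B q y)
      (fun q y => A' q y * B q y + A q y * B' q y) := fun q y hy => by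
  have h := HasDerivAt.mul (hA q y hy) (hB q y hy)
  simp only [zero_smul, add_zero] at h
  exact h

theorem add (hA : HasTangential e A A') (hB : HasTangential e B B') :
    HasTangential e (fun q y => A q y + B q y) (fun q y => A' q y + B' q y) :=
  fun q y hy => HasDerivAt.add (hA q y hy) (hB q y hy)

theorem congr (hA : HasTangential e A A') (h : ∀ q y, 0 ≤ y → A' q y = B' q y) :
    HasTangential e A B' := fun q y hy => h q y hy ▸ hA q y hy

theorem height (φ : ℝ → ℝ) : HasTangential e (fun _ y => φ y) (fun _ _ => 0) :=
  fun _ y _ => hasDerivAt_const _ (φ y)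

theorem const_mul (φ : ℝ → ℝ) (hA : HasTangential e A A') :
    HasTangential e (fun q y => φ y * A q y) (fun q y => φ y * A' q y) :=
  ((height φ).mul hA).congr fun q y _ => by ring

theorem sum {ι : Type*} (s : Finset ι) {A A' : ι → ThinPt n → ℝ → ℝ}
    (h : ∀ i, HasTangential e (A i) (A' i)) :
    HasTangential e (fun q y => ∑ i ∈ s, A i q y) (fun q y => ∑ i ∈ s, A' i q y) := by
  classical
  induction s using Finset.induction_on with
  | empty => simpa using height (e := e) (fun _ => 0)
  | insert i s hi ih =>
    simp only [Finset.sum_insert hi]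
    exact (h i).add ih

theorem of_hasFDerivAt {D : ThinPt n → ℝ → ThinPt n →L[ℝ] ℝ}
    (h : ∀ q y, 0 ≤ y → HasFDerivAt (fun q => A q y) (D q y) q) (e : ThinPt n) :
    HasTangential e A (fun q y => D q y e) := fun q y hy => (h q y hy).hasLineDerivAt e

end HasTangential

/-- A continuously differentiable function of `|X|²` together with twice its derivative. -/
structure RadialWeight where
  /-- the function of `|X|²` -/
  fn : ℝ → ℝ
  /-- twice its derivative -/
  dfn : ℝ → ℝ
  hasDerivAt : ∀ s, HasDerivAt fn (dfn s / 2) s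
  continuous_dfn : Continuous dfn

/-- The square of `|X|`. -/
def radSq {n : ℕ} (q : ThinPt n) (y : ℝ) : ℝ := ‖q.1‖ ^ 2 + y ^ 2

theorem radSq_eq_sum {n : ℕ} (q : ThinPt n) (y : ℝ) : radSq q y = ∑ i, q.1 i ^ 2 + y ^ 2 := by
  simp [radSq, EuclideanSpace.norm_sq_eq]

theorem continuous_radSq {n : ℕ} : Continuous fun p : ThinPt n × ℝ => radSq p.1 p.2 := by
  unfold radSq; fun_prop

theorem hasTangential_radSq {n : ℕ} (i : Fin n) :
    HasTangential (dirX i) (fun q : ThinPt n => radSq q) (fun q _ => 2 * q.1 i) := by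
  intro q y _
  have h1 : HasFDerivAt (fun q : ThinPt n => ‖q.1‖ ^ 2)
      (2 • (innerSL ℝ q.1).comp (ContinuousLinearMap.fst ℝ _ _)) q :=
    hasFDerivAt_fst.norm_sq
  have h2 := (h1.add_const (y ^ 2)).hasLineDerivAt (dirX i)
  simpa [dirX, radSq, EuclideanSpace.inner_single_right] using h2

theorem hasTangential_time_radSq {n : ℕ} :
    HasTangential (dirT n) (fun q : ThinPt n => radSq q) (fun _ _ => 0) := by
  intro q y _
  have : (fun s : ℝ => radSq (q + s • dirT n) y) = fun _ => radSq q y := by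
    funext s; simp [radSq, dirT]
  unfold HasLineDerivAt
  simp only [this]
  exact hasDerivAt_const _ _

namespace RadialWeight

variable {n : ℕ} (k : RadialWeight)

theorem continuous_fn : Continuous k.fn :=
  continuous_iff_continuousAt.2 fun s => (k.hasDerivAt s).continuousAt

theorem contDiff_fn : ContDiff ℝ 1 k.fn := by
  rw [contDiff_one_iff_deriv]
  refine ⟨fun s => (k.hasDerivAt s).differentiableAt, ?_⟩
  have : deriv k.fn = fun s => k.dfn s / 2 := funext fun s => (k.hasDerivAt s).deriv
  rw [this]
  exact k.continuous_dfn.div_const 2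

/-- The normalisation of `dfn` as twice the derivative pays off here and in `isPrimitive`: the
gradient of `k(|X|²)` in `X` is `dfn (|X|²) X`, without numerical factors. -/
theorem hasTangential (i : Fin n) : HasTangential (dirX i)
    (fun q y => k.fn (radSq q y)) (fun q y => k.dfn (radSq q y) * q.1 i) := by
  intro q y hy
  have h := hasTangential_radSq i q y hy
  unfold HasLineDerivAt at h ⊢
  have h2 := HasDerivAt.comp (h₂ := k.fn) 0 (by simpa using k.hasDerivAt (radSq q y)) h
  refine h2.congr_deriv ?_
  ring

theorem hasTangential_time : HasTangential (dirT n)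
    (fun q y => k.fn (radSq q y)) (fun _ _ => 0) := by
  intro q y hy
  have h := hasTangential_time_radSq q y hy
  unfold HasLineDerivAt at h ⊢
  have h2 := HasDerivAt.comp (h₂ := k.fn) 0 (by simpa using k.hasDerivAt (radSq q y)) h
  refine h2.congr_deriv ?_
  ring

theorem isPrimitive (q : ThinPt n) :
    IsPrimitive (fun y => k.fn (radSq q y)) (fun y => k.dfn (radSq q y) * y) := by
  refine IsPrimitive.of_contDiff (k.contDiff_fn.comp ?_) fun y => ?_
  · unfold radSq; fun_prop
  · have h1 : HasDerivAt (fun y => radSq q y) (2 * y) y := by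
      unfold radSq; simpa using ((hasDerivAt_id y).pow 2).const_add (‖q.1‖ ^ 2)
    refine ((k.hasDerivAt (radSq q y)).comp y h1).congr_deriv ?_
    ring

end RadialWeight

theorem hasTangential_coord {n : ℕ} (i j : Fin n) : HasTangential (dirX i)
    (fun (q : ThinPt n) _ => q.1 j) (fun _ _ => if i = j then 1 else 0) := by
  intro q y _
  unfold HasLineDerivAt
  have : (fun s : ℝ => (q + s • dirX i).1 j) = fun s => q.1 j + s * (if i = j then 1 else 0) := by
    funext s; simp [dirX, eq_comm]
  rw [this]
  simpa using ((hasDerivAt_id (0 : ℝ)).mul_const (if i = j then (1 : ℝ) else 0)).const_add (q.1 j)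

/-- The measure `dq dy` on the box `{‖q‖ ≤ ρ, 0 < y ≤ Y}`. -/
def boxMeasure (n : ℕ) (ρ Y : ℝ) : Measure (ThinPt n × ℝ) :=
  (volume.restrict (Metric.closedBall 0 ρ)).prod (volume.restrict (Ioc 0 Y))

theorem ae_boxMeasure {n : ℕ} {ρ Y : ℝ} :
    ∀ᵐ p ∂(boxMeasure n ρ Y), p.1 ∈ Metric.closedBall (0 : ThinPt n) ρ ∧ p.2 ∈ Ioc 0 Y := by
  rw [boxMeasure, Measure.prod_restrict]
  exact ae_restrict_mem (Metric.isClosed_closedBall.measurableSet.prod measurableSet_Ioc)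

instance {n : ℕ} {ρ : ℝ} :
    IsFiniteMeasure ((volume : Measure (ThinPt n)).restrict (Metric.closedBall 0 ρ)) :=
  ⟨by simpa using (isCompact_closedBall (0 : ThinPt n) ρ).measure_lt_top⟩

instance {Y : ℝ} : IsFiniteMeasure ((volume : Measure ℝ).restrict (Ioc 0 Y)) :=
  ⟨by simp⟩

instance {n : ℕ} {ρ Y : ℝ} : IsFiniteMeasure (boxMeasure n ρ Y) := by
  unfold boxMeasure; infer_instance

/-- Jointly measurable and bounded on the box `{‖q‖ ≤ ρ, 0 ≤ y ≤ Y}`. -/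
def BoxBounded {n : ℕ} (ρ Y : ℝ) (A : ThinPt n → ℝ → ℝ) : Prop :=
  Measurable (fun p : ThinPt n × ℝ => A p.1 p.2) ∧
    ∃ C, ∀ q ∈ Metric.closedBall (0 : ThinPt n) ρ, ∀ y ∈ Icc 0 Y, |A q y| ≤ C

namespace BoxBounded

variable {n : ℕ} {ρ Y : ℝ} {A B : ThinPt n → ℝ → ℝ}

theorem mul (hA : BoxBounded ρ Y A) (hB : BoxBounded ρ Y B) :
    BoxBounded ρ Y (fun q y => A q y * B q y) := by
  obtain ⟨mA, C, hC⟩ := hA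
  obtain ⟨mB, D, hD⟩ := hB
  refine ⟨mA.mul mB, C * D, fun q hq y hy => ?_⟩
  rw [abs_mul]
  exact mul_le_mul (hC q hq y hy) (hD q hq y hy) (abs_nonneg _)
    ((abs_nonneg _).trans (hC q hq y hy))

theorem add (hA : BoxBounded ρ Y A) (hB : BoxBounded ρ Y B) :
    BoxBounded ρ Y (fun q y => A q y + B q y) := by
  obtain ⟨mA, C, hC⟩ := hA
  obtain ⟨mB, D, hD⟩ := hB
  exact ⟨mA.add mB, C + D, fun q hq y hy =>
    (abs_add_le _ _).trans (add_le_add (hC q hq y hy) (hD q hq y hy))⟩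

theorem of_continuous (h : Continuous fun p : ThinPt n × ℝ => A p.1 p.2) : BoxBounded ρ Y A := by
  refine ⟨h.measurable, ?_⟩
  obtain ⟨C, hC⟩ := ((isCompact_closedBall (0 : ThinPt n) ρ).prod
    (isCompact_Icc (a := (0 : ℝ)) (b := Y))).exists_bound_of_continuousOn h.continuousOn
  exact ⟨C, fun q hq y hy => hC (q, y) ⟨hq, hy⟩⟩

theorem const (c : ℝ) : BoxBounded ρ Y (fun (_ : ThinPt n) _ => c) :=
  of_continuous continuous_const

theorem sum {ι : Type*} (s : Finset ι) {A : ι → ThinPt n → ℝ → ℝ}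
    (h : ∀ i, BoxBounded ρ Y (A i)) : BoxBounded ρ Y (fun q y => ∑ i ∈ s, A i q y) := by
  classical
  induction s using Finset.induction_on with
  | empty => simpa using const (n := n) (ρ := ρ) (Y := Y) 0
  | insert i s hi ih =>
    simp only [Finset.sum_insert hi]
    exact (h i).add ih

theorem sub (hA : BoxBounded ρ Y A) (hB : BoxBounded ρ Y B) :
    BoxBounded ρ Y (fun q y => A q y - B q y) := by
  simpa [sub_eq_add_neg] using hA.add ((const (-1)).mul hB)

theorem pow (hA : BoxBounded ρ Y A) (m : ℕ) : BoxBounded ρ Y (fun q y => A q y ^ m) := by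
  induction m with
  | zero => simpa using const (n := n) (ρ := ρ) (Y := Y) 1
  | succ m ih => simpa [pow_succ] using ih.mul hA

theorem rpow {p : ℝ} (hp : 0 ≤ p) : BoxBounded ρ Y (fun (_ : ThinPt n) y => y ^ p) :=
  of_continuous ((Real.continuous_rpow_const hp).comp continuous_snd)

theorem height : BoxBounded ρ Y (fun (_ : ThinPt n) y => y) := of_continuous continuous_snd

theorem coord (i : Fin n) : BoxBounded ρ Y (fun (q : ThinPt n) _ => q.1 i) :=
  of_continuous (by fun_prop)

theorem radial {k : ℝ → ℝ} (hk : Continuous k) :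
    BoxBounded ρ Y (fun (q : ThinPt n) y => k (radSq q y)) :=
  of_continuous (hk.comp continuous_radSq)

/-- The product with an integrable function is integrable on the box. -/
theorem integrable_mul (hA : BoxBounded ρ Y A) {F : ThinPt n × ℝ → ℝ}
    (hF : Integrable F (boxMeasure n ρ Y)) :
    Integrable (fun p => F p * A p.1 p.2) (boxMeasure n ρ Y) := by
  obtain ⟨mA, C, hC⟩ := hA
  refine hF.mul_bdd (c := C) mA.aestronglyMeasurable ?_
  filter_upwards [ae_boxMeasure] with p hp
  exact hC p.1 hp.1 p.2 (Ioc_subset_Icc_self hp.2)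

end BoxBounded

theorem integrable_height {n : ℕ} {ρ Y : ℝ} {c : ℝ → ℝ} (hc : IntegrableOn c (Ioc 0 Y)) :
    Integrable (fun p : ThinPt n × ℝ => c p.2) (boxMeasure n ρ Y) :=
  hc.integrable.comp_snd _

theorem integrable_rpow_height {n : ℕ} {ρ Y : ℝ} {p : ℝ} (hp : -1 < p) :
    Integrable (fun z : ThinPt n × ℝ => z.2 ^ p) (boxMeasure n ρ Y) := by
  refine integrable_height (c := fun y => y ^ p) ?_
  rcases le_total 0 Y with hY | hY
  · exact (intervalIntegrable_iff_integrableOn_Ioc_of_le hY).1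
      (intervalIntegral.intervalIntegrable_rpow' hp)
  · simp [Ioc_eq_empty (not_lt.2 hY)]

theorem integral_box_of_isPrimitive {n : ℕ} {ρ Y : ℝ} (hY : 0 ≤ Y) {A A' : ThinPt n → ℝ → ℝ}
    (h : ∀ q, IsPrimitive (A q) (A' q)) (h0 : ∀ q, A q Y = 0)
    (hi : Integrable (fun p : ThinPt n × ℝ => A' p.1 p.2) (boxMeasure n ρ Y)) :
    ∫ p, A' p.1 p.2 ∂(boxMeasure n ρ Y) = -∫ q in Metric.closedBall 0 ρ, A q 0 := by
  rw [boxMeasure, integral_prod _ hi, ← integral_neg]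
  exact integral_congr_ae (Filter.Eventually.of_forall fun q =>
    (h q).setIntegral_eq_neg hY (h0 q))

instance {n : ℕ} : (volume : Measure (ThinPt n)).IsAddHaarMeasure :=
  inferInstanceAs ((volume.prod volume : Measure (EuclideanSpace ℝ (Fin n) × ℝ)).IsAddHaarMeasure)

theorem integral_eq_zero_of_hasLineDerivAt {n : ℕ} {e : ThinPt n} {F F' : ThinPt n → ℝ}
    (h : ∀ q, HasLineDerivAt ℝ F (F' q) q e) (hF : Integrable F) (hF' : Integrable F') :
    ∫ q, F' q = 0 := by
  have := integral_bilinear_hasLineDerivAt_right_eq_neg_left_of_integrable (μ := volume)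
    (f := F) (f' := F') (g := fun _ => (1 : ℝ)) (g' := fun _ => (0 : ℝ)) (v := e)
    (B := ContinuousLinearMap.mul ℝ ℝ) (by simpa using hF') (by simp) (by simpa using hF)
    (fun q _ => h q) (fun q _ => hasDerivAt_const _ _)
  simpa using this

theorem setIntegral_eq_zero_of_hasLineDerivAt {n : ℕ} {ρ ρ₀ : ℝ} (hρ : ρ₀ < ρ) {e : ThinPt n}
    {F F' : ThinPt n → ℝ} (h : ∀ q, HasLineDerivAt ℝ F (F' q) q e)
    (h0 : ∀ q, ρ₀ ≤ ‖q‖ → F q = 0)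
    (hF : IntegrableOn F (Metric.closedBall 0 ρ)) (hF' : IntegrableOn F' (Metric.closedBall 0 ρ)) :
    ∫ q in Metric.closedBall 0 ρ, F' q = 0 := by
  have h0' : ∀ q, q ∉ Metric.closedBall (0 : ThinPt n) ρ → F q = 0 := fun q hq =>
    h0 q (by simp only [Metric.mem_closedBall, dist_zero_right, not_le] at hq; linarith)
  -- `F` vanishes on the open complement of the ball, hence so does its line derivative; the
  -- integral over the ball is then the one over the whole space.
  have h1 : ∀ q, q ∉ Metric.closedBall (0 : ThinPt n) ρ → F' q = 0 := fun q hq => by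
    have hev : F =ᶠ[nhds q] fun _ => 0 := by
      filter_upwards [Metric.isClosed_closedBall.isOpen_compl.mem_nhds hq] with z hz using h0' z hz
    have h2 : HasLineDerivAt ℝ (fun _ : ThinPt n => (0 : ℝ)) (F' q) q e :=
      (h q).congr_of_eventuallyEq hev.symm
    exact HasDerivAt.unique h2 (hasDerivAt_const _ _)
  rw [setIntegral_eq_integral_of_forall_compl_eq_zero h1]
  exact integral_eq_zero_of_hasLineDerivAt h
    ((integrableOn_iff_integrable_of_support_subset fun q hq => by
      by_contra hne; exact hq (h0' q hne)).1 hF)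
    ((integrableOn_iff_integrable_of_support_subset fun q hq => by
      by_contra hne; exact hq (h1 q hne)).1 hF')

theorem integral_box_of_hasTangential {n : ℕ} {ρ ρ₀ Y : ℝ} (hρ : ρ₀ < ρ) {e : ThinPt n}
    {A A' : ThinPt n → ℝ → ℝ} (h : HasTangential e A A')
    (h0 : ∀ q y, 0 ≤ y → ρ₀ ≤ ‖q‖ → A q y = 0)
    (hA : Integrable (fun p : ThinPt n × ℝ => A p.1 p.2) (boxMeasure n ρ Y))
    (hi : Integrable (fun p : ThinPt n × ℝ => A' p.1 p.2) (boxMeasure n ρ Y)) :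
    ∫ p, A' p.1 p.2 ∂(boxMeasure n ρ Y) = 0 := by
  rw [boxMeasure] at hA hi ⊢
  rw [integral_prod_symm _ hi]
  refine integral_eq_zero_of_ae ?_
  filter_upwards [hA.prod_left_ae, hi.prod_left_ae, ae_restrict_mem measurableSet_Ioc]
    with y h1 h2 hy
  exact setIntegral_eq_zero_of_hasLineDerivAt hρ (fun q => h q y hy.1.le)
    (fun q hq => h0 q y hy.1.le hq) h1 h2

end
end ParabolicExtension

/-! ### The Rellich-type energy identity for regular profiles -/

namespace ParabolicExtension

noncomputable section

theorem IsPrimitive.congr_both {A A' B B' : ℝ → ℝ} (hA : IsPrimitive A A') (h : ∀ y, A y = B y)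
    (h' : ∀ y, 0 < y → A' y = B' y) : IsPrimitive B B' :=
  (funext h : A = B) ▸ hA.congr h'

theorem HasTangential.congr_both {n : ℕ} {e : ThinPt n} {A A' B B' : ThinPt n → ℝ → ℝ}
    (hA : HasTangential e A A') (h : ∀ q y, A q y = B q y)
    (h' : ∀ q y, 0 ≤ y → A' q y = B' q y) : HasTangential e B B' :=
  (funext fun q => funext (h q) : A = B) ▸ hA.congr h'

/-- A function `u` on `{y ≥ 0}` which is smooth in the tangential variables, with `P = y ^ a ∂_y u`
absolutely continuous in `y`, together with the derivatives that occur in the energy identity. It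
vanishes off a compact subset of `{‖q‖ < ρ, 0 ≤ y < Y}`. -/
structure Profile (n : ℕ) (a ρ Y : ℝ) where
  /-- the function -/
  u : ThinPt n → ℝ → ℝ
  /-- the weighted normal derivative `y ^ a ∂_y u` -/
  P : ThinPt n → ℝ → ℝ
  /-- the normal derivative of `P` -/
  f : ThinPt n → ℝ → ℝ
  /-- the time derivative of `u` -/
  ut : ThinPt n → ℝ → ℝ
  /-- the time derivative of `P` -/
  Pt : ThinPt n → ℝ → ℝ
  /-- the spatial derivatives of `u` -/
  ui : Fin n → ThinPt n → ℝ → ℝ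
  /-- the spatial derivatives of `P` -/
  Pi : Fin n → ThinPt n → ℝ → ℝ
  /-- the mixed derivatives of `u` in time and space -/
  uit : Fin n → ThinPt n → ℝ → ℝ
  /-- the second spatial derivatives of `u` -/
  uij : Fin n → Fin n → ThinPt n → ℝ → ℝ
  prim_u : ∀ q, IsPrimitive (u q) (fun y => y ^ (-a) * P q y)
  prim_ui : ∀ i q, IsPrimitive (ui i q) (fun y => y ^ (-a) * Pi i q y)
  prim_ut : ∀ q, IsPrimitive (ut q) (fun y => y ^ (-a) * Pt q y)
  prim_P : ∀ q, IsPrimitive (P q) (f q)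
  tan_u : ∀ i, HasTangential (dirX i) u (ui i)
  tan_ui : ∀ i j, HasTangential (dirX j) (ui i) (uij i j)
  tan_ut : ∀ i, HasTangential (dirX i) ut (uit i)
  tan_P : ∀ i, HasTangential (dirX i) P (Pi i)
  time_u : HasTangential (dirT n) u ut
  time_ui : ∀ i, HasTangential (dirT n) (ui i) (uit i)
  time_P : HasTangential (dirT n) P Pt
  symm : ∀ i j, uij i j = uij j i
  bdd_u : BoxBounded ρ Y u
  bdd_P : BoxBounded ρ Y P
  bdd_ut : BoxBounded ρ Y ut
  bdd_Pt : BoxBounded ρ Y Pt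
  bdd_ui : ∀ i, BoxBounded ρ Y (ui i)
  bdd_Pi : ∀ i, BoxBounded ρ Y (Pi i)
  bdd_uit : ∀ i, BoxBounded ρ Y (uit i)
  bdd_uij : ∀ i j, BoxBounded ρ Y (uij i j)
  int_f : Integrable (fun p : ThinPt n × ℝ => f p.1 p.2) (boxMeasure n ρ Y)
  /-- the radius off which the function vanishes -/
  ρ₀ : ℝ
  lt_ρ : ρ₀ < ρ
  pos_Y : 0 < Y
  zero_u : ∀ q y, 0 ≤ y → ρ₀ ≤ ‖q‖ ∨ Y ≤ y → u q y = 0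
  zero_P : ∀ q y, 0 ≤ y → ρ₀ ≤ ‖q‖ ∨ Y ≤ y → P q y = 0
  zero_ui : ∀ i q y, 0 ≤ y → ρ₀ ≤ ‖q‖ ∨ Y ≤ y → ui i q y = 0

namespace Profile

variable {n : ℕ} {a ρ Y : ℝ} (p : Profile n a ρ Y)

/-- The radial derivative `X · ∇ u`. -/
def euler (q : ThinPt n) (y : ℝ) : ℝ := ∑ i, q.1 i * p.ui i q y + y ^ (1 - a) * p.P q y

/-- The squared length of the tangential gradient. -/
def gradSq (q : ThinPt n) (y : ℝ) : ℝ := ∑ i, p.ui i q y ^ 2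

/-- The tangential Laplacian. -/
def lap (q : ThinPt n) (y : ℝ) : ℝ := ∑ i, p.uij i i q y

/-- The energy density `y ^ a |∇ u| ^ 2`. -/
def density (q : ThinPt n) (y : ℝ) : ℝ := y ^ (-a) * p.P q y ^ 2 + y ^ a * p.gradSq q y

/-- The multiplier `K X·∇u + m u + κ u_t`. -/
def multiplier (K m κ : RadialWeight) (q : ThinPt n) (y : ℝ) : ℝ :=
  K.fn (radSq q y) * p.euler q y + m.fn (radSq q y) * p.u q y + κ.fn (radSq q y) * p.ut q y

/-- Tangential derivative of the multiplier in the direction `i`. -/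
def multiplierX (K m κ : RadialWeight) (i : Fin n) (q : ThinPt n) (y : ℝ) : ℝ :=
  K.dfn (radSq q y) * q.1 i * p.euler q y +
    K.fn (radSq q y) * (p.ui i q y + ∑ j, q.1 j * p.uij j i q y + y ^ (1 - a) * p.Pi i q y) +
    m.dfn (radSq q y) * q.1 i * p.u q y + m.fn (radSq q y) * p.ui i q y +
    κ.dfn (radSq q y) * q.1 i * p.ut q y + κ.fn (radSq q y) * p.uit i q y

theorem bdd_euler (ha1 : a < 1) : BoxBounded ρ Y p.euler :=
  (BoxBounded.sum _ fun i => (BoxBounded.coord i).mul (p.bdd_ui i)).add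
    ((BoxBounded.rpow (by linarith)).mul p.bdd_P)

theorem bdd_gradSq : BoxBounded ρ Y p.gradSq := BoxBounded.sum _ fun i => (p.bdd_ui i).pow 2

theorem bdd_lap : BoxBounded ρ Y p.lap := BoxBounded.sum _ fun i => p.bdd_uij i i

theorem bdd_multiplier (ha1 : a < 1) (K m κ : RadialWeight) :
    BoxBounded ρ Y (p.multiplier K m κ) :=
  (((BoxBounded.radial K.continuous_fn).mul (p.bdd_euler ha1)).add
    ((BoxBounded.radial m.continuous_fn).mul p.bdd_u)).add
    ((BoxBounded.radial κ.continuous_fn).mul p.bdd_ut)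

theorem bdd_multiplierX (ha1 : a < 1) (K m κ : RadialWeight) (i : Fin n) :
    BoxBounded ρ Y (p.multiplierX K m κ i) :=
  (((((((BoxBounded.radial K.continuous_dfn).mul (BoxBounded.coord i)).mul (p.bdd_euler ha1)).add
    ((BoxBounded.radial K.continuous_fn).mul (((p.bdd_ui i).add
      (BoxBounded.sum _ fun j => (BoxBounded.coord j).mul (p.bdd_uij j i))).add
      ((BoxBounded.rpow (by linarith)).mul (p.bdd_Pi i))))).add
    (((BoxBounded.radial m.continuous_dfn).mul (BoxBounded.coord i)).mul p.bdd_u)).add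
    ((BoxBounded.radial m.continuous_fn).mul (p.bdd_ui i))).add
    (((BoxBounded.radial κ.continuous_dfn).mul (BoxBounded.coord i)).mul p.bdd_ut)).add
    ((BoxBounded.radial κ.continuous_fn).mul (p.bdd_uit i))

theorem tan_euler (i : Fin n) : HasTangential (dirX i) p.euler
    (fun q y => p.ui i q y + ∑ j, q.1 j * p.uij j i q y + y ^ (1 - a) * p.Pi i q y) := by
  refine ((HasTangential.sum Finset.univ fun j =>
    (hasTangential_coord i j).mul (p.tan_ui j i)).add ((p.tan_P i).const_mul _)).congr
    fun q y _ => ?_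
  simp [Finset.sum_add_distrib]

theorem tan_multiplier (K m κ : RadialWeight) (i : Fin n) :
    HasTangential (dirX i) (p.multiplier K m κ) (p.multiplierX K m κ i) :=
  ((((K.hasTangential i).mul (p.tan_euler i)).add ((m.hasTangential i).mul (p.tan_u i))).add
    ((κ.hasTangential i).mul (p.tan_ut i))).congr fun q y _ => by
      simp only [multiplierX]; ring

theorem tan_gradSq (i : Fin n) : HasTangential (dirX i) p.gradSq
    (fun q y => 2 * ∑ j, p.ui j q y * p.uij j i q y) :=
  (HasTangential.sum Finset.univ fun j => ((p.tan_ui j i).mul (p.tan_ui j i))).congr_both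
    (fun q y => Finset.sum_congr rfl fun j _ => by ring)
    (fun q y _ => by rw [Finset.mul_sum]; exact Finset.sum_congr rfl fun j _ => by ring)

theorem time_gradSq : HasTangential (dirT n) p.gradSq
    (fun q y => 2 * ∑ j, p.ui j q y * p.uit j q y) :=
  (HasTangential.sum Finset.univ fun j => ((p.time_ui j).mul (p.time_ui j))).congr_both
    (fun q y => Finset.sum_congr rfl fun j _ => by ring)
    (fun q y _ => by rw [Finset.mul_sum]; exact Finset.sum_congr rfl fun j _ => by ring)

theorem tan_density (i : Fin n) : HasTangential (dirX i) p.density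
    (fun q y => y ^ (-a) * (2 * p.P q y * p.Pi i q y) +
      y ^ a * (2 * ∑ j, p.ui j q y * p.uij j i q y)) :=
  ((((p.tan_P i).mul (p.tan_P i)).const_mul fun y => y ^ (-a)).add
    ((p.tan_gradSq i).const_mul fun y => y ^ a)).congr_both
    (fun q y => by simp only [density]; ring) (fun q y _ => by ring)

theorem time_density : HasTangential (dirT n) p.density
    (fun q y => y ^ (-a) * (2 * p.P q y * p.Pt q y) +
      y ^ a * (2 * ∑ j, p.ui j q y * p.uit j q y)) :=
  (((p.time_P.mul p.time_P).const_mul fun y => y ^ (-a)).add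
    (p.time_gradSq.const_mul fun y => y ^ a)).congr_both
    (fun q y => by simp only [density]; ring) (fun q y _ => by ring)

/-- The spatial flux of the energy identity. -/
def fluxX (K m κ c : RadialWeight) (i : Fin n) (q : ThinPt n) (y : ℝ) : ℝ :=
  y ^ a * (p.multiplier K m κ q y * p.ui i q y) -
    1 / 2 * (K.fn (radSq q y) * q.1 i * p.density q y) +
    y ^ a * (c.fn (radSq q y) * q.1 i * p.u q y ^ 2)

/-- The derivative of the spatial flux. -/
def divX (K m κ c : RadialWeight) (i : Fin n) (q : ThinPt n) (y : ℝ) : ℝ :=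
  y ^ a * (p.multiplierX K m κ i q y * p.ui i q y + p.multiplier K m κ q y * p.uij i i q y -
      K.fn (radSq q y) * q.1 i * ∑ j, p.ui j q y * p.uij j i q y -
      1 / 2 * (K.dfn (radSq q y) * q.1 i * q.1 i + K.fn (radSq q y)) * p.gradSq q y +
      (c.dfn (radSq q y) * q.1 i * q.1 i + c.fn (radSq q y)) * p.u q y ^ 2 +
      2 * c.fn (radSq q y) * q.1 i * p.u q y * p.ui i q y) -
    y ^ (-a) * (1 / 2 * (K.dfn (radSq q y) * q.1 i * q.1 i + K.fn (radSq q y)) * p.P q y ^ 2 +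
      K.fn (radSq q y) * q.1 i * p.P q y * p.Pi i q y)

theorem tan_fluxX (K m κ c : RadialWeight) (i : Fin n) :
    HasTangential (dirX i) (p.fluxX K m κ c i) (p.divX K m κ c i) := by
  have h1 := ((p.tan_multiplier K m κ i).mul (p.tan_ui i i)).const_mul fun y => y ^ a
  have h2 := (((K.hasTangential i).mul (hasTangential_coord i i)).mul
    (p.tan_density i)).const_mul fun _ => -(1 / 2)
  have h3 := (((c.hasTangential i).mul (hasTangential_coord i i)).mul
    ((p.tan_u i).mul (p.tan_u i))).const_mul fun y => y ^ a
  refine ((h1.add h2).add h3).congr_both (fun q y => ?_) fun q y _ => ?_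
  · simp only [fluxX]; ring
  · simp only [divX, density, if_true]; ring

/-- The time flux of the energy identity. -/
def fluxT (κ d : RadialWeight) (q : ThinPt n) (y : ℝ) : ℝ :=
  y ^ a * (d.fn (radSq q y) * p.u q y ^ 2) - 1 / 2 * (κ.fn (radSq q y) * p.density q y)

/-- The derivative of the time flux. -/
def divT (κ d : RadialWeight) (q : ThinPt n) (y : ℝ) : ℝ :=
  y ^ a * (2 * d.fn (radSq q y) * p.u q y * p.ut q y -
      κ.fn (radSq q y) * ∑ j, p.ui j q y * p.uit j q y) -
    y ^ (-a) * (κ.fn (radSq q y) * p.P q y * p.Pt q y)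

theorem time_fluxT (κ d : RadialWeight) :
    HasTangential (dirT n) (p.fluxT κ d) (p.divT κ d) := by
  have h1 := (κ.hasTangential_time.mul p.time_density).const_mul fun _ => -(1 / 2)
  have h2 := (d.hasTangential_time.mul (p.time_u.mul p.time_u)).const_mul fun y => y ^ a
  refine (h1.add h2).congr_both (fun q y => ?_) fun q y _ => ?_
  · simp only [fluxT]; ring
  · simp only [divT]; ring

/-- The normal flux of the energy identity. -/
def fluxY (K m κ c : RadialWeight) (q : ThinPt n) (y : ℝ) : ℝ :=
  p.multiplier K m κ q y * p.P q y -
    1 / 2 * (K.fn (radSq q y) * (y ^ (1 - a) * p.P q y ^ 2 + y ^ (1 + a) * p.gradSq q y)) +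
    y ^ (1 + a) * (c.fn (radSq q y) * p.u q y ^ 2)

/-- The derivative of the normal flux. -/
def divY (K m κ c : RadialWeight) (q : ThinPt n) (y : ℝ) : ℝ :=
  p.f q y * p.multiplier K m κ q y +
  (p.P q y * y * (K.dfn (radSq q y) * p.euler q y + m.dfn (radSq q y) * p.u q y +
      κ.dfn (radSq q y) * p.ut q y) -
    1 / 2 * K.dfn (radSq q y) * y *
      (y ^ (1 - a) * p.P q y ^ 2 + y ^ (1 + a) * p.gradSq q y) -
    K.fn (radSq q y) * y * ∑ j, p.ui j q y * p.Pi j q y +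
    y ^ (1 + a) * (c.dfn (radSq q y) * y * p.u q y ^ 2) +
    2 * y * c.fn (radSq q y) * p.u q y * p.P q y) +
  y ^ (-a) * (p.P q y * (K.fn (radSq q y) * (∑ j, q.1 j * p.Pi j q y + (1 - a) * p.P q y) +
      m.fn (radSq q y) * p.P q y + κ.fn (radSq q y) * p.Pt q y) -
    1 / 2 * K.fn (radSq q y) * (1 - a) * p.P q y ^ 2) +
  y ^ a * ((1 + a) * c.fn (radSq q y) * p.u q y ^ 2 -
    1 / 2 * K.fn (radSq q y) * (1 + a) * p.gradSq q y)

theorem rpow_height_relations {y : ℝ} (hy : 0 < y) (a : ℝ) :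
    y ^ (1 - a) = y * y ^ (-a) ∧ y ^ (1 + a) = y * y ^ a ∧ y ^ a * y ^ (-a) = 1 := by
  refine ⟨?_, ?_, ?_⟩
  · rw [sub_eq_add_neg, Real.rpow_add hy, Real.rpow_one]
  · rw [Real.rpow_add hy, Real.rpow_one]
  · rw [← Real.rpow_add hy]; simp

/-- Product rule in `y`. The normal derivatives enter through `∂_y u = y^(-a) P`, and the powers
`y^(1±a)` multiplying the quadratic terms are primitives because `1 ± a > 0`. The only nonlinear
relation among the powers is `y^a y^(-a) = 1`. -/
theorem prim_fluxY (ha : -1 < a) (ha1 : a < 1) (K m κ c : RadialWeight) (q : ThinPt n) :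
    IsPrimitive (p.fluxY K m κ c q) (p.divY K m κ c q) := by
  have hv : IsPrimitive (fun y => y ^ (1 - a)) (fun y => (1 - a) * y ^ (1 - a - 1)) :=
    IsPrimitive.rpow (by linarith)
  have hw : IsPrimitive (fun y => y ^ (1 + a)) (fun y => (1 + a) * y ^ (1 + a - 1)) :=
    IsPrimitive.rpow (by linarith)
  have hZ : IsPrimitive (p.euler q) _ := (IsPrimitive.sum Finset.univ fun j =>
    (p.prim_ui j q).const_mul (q.1 j)).add (hv.mul (p.prim_P q))
  have hM : IsPrimitive (p.multiplier K m κ q) _ := (((K.isPrimitive q).mul hZ).add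
    ((m.isPrimitive q).mul (p.prim_u q))).add ((κ.isPrimitive q).mul (p.prim_ut q))
  have hP2 := (p.prim_P q).mul (p.prim_P q)
  have he := IsPrimitive.sum Finset.univ fun j => (p.prim_ui j q).mul (p.prim_ui j q)
  have h1 := hM.mul (p.prim_P q)
  have h2 := ((K.isPrimitive q).mul ((hv.mul hP2).add (hw.mul he))).const_mul (-(1 / 2))
  have h3 := hw.mul ((c.isPrimitive q).mul ((p.prim_u q).mul (p.prim_u q)))
  refine ((h1.add h2).add h3).congr_both (fun y => ?_) fun y hy => ?_
  · simp only [fluxY, gradSq, sq]; ring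
  · obtain ⟨e1, e2, e3⟩ := rpow_height_relations hy a
    have s1 : ∑ j, q.1 j * (y ^ (-a) * p.Pi j q y) = y ^ (-a) * ∑ j, q.1 j * p.Pi j q y := by
      rw [Finset.mul_sum]; exact Finset.sum_congr rfl fun j _ => by ring
    have s2 : ∑ j, (y ^ (-a) * p.Pi j q y * p.ui j q y + p.ui j q y * (y ^ (-a) * p.Pi j q y)) =
        2 * y ^ (-a) * ∑ j, p.ui j q y * p.Pi j q y := by
      rw [Finset.mul_sum]; exact Finset.sum_congr rfl fun j _ => by ring
    have s3 : ∑ j, p.ui j q y * p.ui j q y = p.gradSq q y :=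
      Finset.sum_congr rfl fun j _ => by ring
    simp only [divY, s1, s2, s3, show 1 - a - 1 = -a by ring, show 1 + a - 1 = a by ring, e1, e2,
      multiplier]
    linear_combination (2 * y * c.fn (radSq q y) * p.u q y * p.P q y -
      K.fn (radSq q y) * y * ∑ j, p.ui j q y * p.Pi j q y) * e3

/-- The integrand of the energy identity. -/
def energyIntegrand (K m κ c d : RadialWeight) (q : ThinPt n) (y : ℝ) : ℝ :=
  p.multiplier K m κ q y * (p.f q y + y ^ a * p.lap q y) +
  y ^ a * (K.dfn (radSq q y) * p.euler q y ^ 2) -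
  p.density q y * ((n - 1 + a) / 2 * K.fn (radSq q y) + radSq q y / 2 * K.dfn (radSq q y) -
    m.fn (radSq q y)) +
  y ^ a * (m.dfn (radSq q y) * p.u q y * p.euler q y +
    κ.dfn (radSq q y) * p.ut q y * p.euler q y +
    2 * c.fn (radSq q y) * p.u q y * p.euler q y +
    ((n + 1 + a) * c.fn (radSq q y) + radSq q y * c.dfn (radSq q y)) * p.u q y ^ 2 +
    2 * d.fn (radSq q y) * p.u q y * p.ut q y)

/-- All second derivatives in the three divergences cancel, except those collected in `f + y^a lap`:
the fluxes contain `-½ K X` and `-½ κ` times the energy density precisely to remove them. The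
weights `c` and `d` add exact divergences, which are free to be chosen later. -/
theorem energyIntegrand_eq (K m κ c d : RadialWeight) (q : ThinPt n) {y : ℝ} (hy : 0 < y) :
    p.energyIntegrand K m κ c d q y =
      p.divY K m κ c q y + ∑ i, p.divX K m κ c i q y + p.divT κ d q y := by
  obtain ⟨e1, e2, e3⟩ := rpow_height_relations hy a
  -- Symmetry of the Hessian identifies the second-order terms coming from the multiplier with those
  -- coming from the energy density.
  have hswap : ∑ i, p.ui i q y * ∑ j, q.1 j * p.uij j i q y =
      ∑ i, q.1 i * ∑ j, p.ui j q y * p.uij j i q y := by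
    simp only [Finset.mul_sum]
    rw [Finset.sum_comm]
    refine Finset.sum_congr rfl fun i _ => Finset.sum_congr rfl fun j _ => ?_
    rw [p.symm j i]; ring
  set w := y ^ a with hw
  set v := y ^ (-a) with hv
  set s := ∑ i, q.1 i * p.ui i q y with hs
  have hX : ∑ i, p.divX K m κ c i q y =
      w * ((K.dfn (radSq q y) * p.euler q y + m.dfn (radSq q y) * p.u q y +
        κ.dfn (radSq q y) * p.ut q y + 2 * c.fn (radSq q y) * p.u q y) * s +
        (K.fn (radSq q y) + m.fn (radSq q y)) * p.gradSq q y +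
        K.fn (radSq q y) * y * v * ∑ i, p.ui i q y * p.Pi i q y +
        κ.fn (radSq q y) * ∑ i, p.ui i q y * p.uit i q y +
        p.multiplier K m κ q y * p.lap q y +
        (c.dfn (radSq q y) * p.u q y ^ 2 - 1 / 2 * K.dfn (radSq q y) * p.gradSq q y) *
          (radSq q y - y ^ 2) +
        n * (c.fn (radSq q y) * p.u q y ^ 2 - 1 / 2 * K.fn (radSq q y) * p.gradSq q y)) -
      v * (1 / 2 * (K.dfn (radSq q y) * (radSq q y - y ^ 2) + n * K.fn (radSq q y)) *
          p.P q y ^ 2 +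
        K.fn (radSq q y) * p.P q y * ∑ i, q.1 i * p.Pi i q y) := by
    have hi : ∀ i, p.divX K m κ c i q y =
      w * ((K.dfn (radSq q y) * p.euler q y + m.dfn (radSq q y) * p.u q y +
        κ.dfn (radSq q y) * p.ut q y + 2 * c.fn (radSq q y) * p.u q y)) * (q.1 i * p.ui i q y) +
        w * (K.fn (radSq q y) + m.fn (radSq q y)) * p.ui i q y ^ 2 +
        w * (K.fn (radSq q y) * y * v) * (p.ui i q y * p.Pi i q y) +
        w * κ.fn (radSq q y) * (p.ui i q y * p.uit i q y) +
        w * p.multiplier K m κ q y * p.uij i i q y +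
        (w * (c.dfn (radSq q y) * p.u q y ^ 2 - 1 / 2 * K.dfn (radSq q y) * p.gradSq q y) -
          v * (1 / 2 * K.dfn (radSq q y) * p.P q y ^ 2)) * q.1 i ^ 2 +
        (w * (c.fn (radSq q y) * p.u q y ^ 2 - 1 / 2 * K.fn (radSq q y) * p.gradSq q y) -
          v * (1 / 2 * K.fn (radSq q y) * p.P q y ^ 2)) -
        v * (K.fn (radSq q y) * p.P q y) * (q.1 i * p.Pi i q y) +
        w * K.fn (radSq q y) * (p.ui i q y * ∑ j, q.1 j * p.uij j i q y) -
        w * K.fn (radSq q y) * (q.1 i * ∑ j, p.ui j q y * p.uij j i q y) := by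
      intro i
      simp only [divX, multiplierX, ← hw, ← hv, e1]
      ring
    simp only [hi, Finset.sum_add_distrib, Finset.sum_sub_distrib, ← Finset.mul_sum, hswap]
    simp only [radSq_eq_sum, lap, gradSq, Finset.sum_const, Finset.card_univ, Fintype.card_fin,
      nsmul_eq_mul, ← hs]
    ring
  have hZ : p.euler q y = s + y * v * p.P q y := by simp only [euler, e1, ← hs]
  rw [hX]
  simp only [energyIntegrand, divY, divT, density, e1, e2, ← hw, ← hv]
  rw [hZ]
  linear_combination (p.P q y * y * (K.dfn (radSq q y) * (s + y * v * p.P q y) +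
    m.dfn (radSq q y) * p.u q y + κ.dfn (radSq q y) * p.ut q y +
    2 * c.fn (radSq q y) * p.u q y) - K.fn (radSq q y) * y * ∑ i, p.ui i q y * p.Pi i q y) * e3

/-- Functions of the form `f A + B + y ^ (-a) C + y ^ a D` with bounded coefficients are integrable
on the box. -/
theorem integrable_of_bounded (ha : -1 < a) (ha1 : a < 1) {A B C D : ThinPt n → ℝ → ℝ}
    (hA : BoxBounded ρ Y A) (hB : BoxBounded ρ Y B) (hC : BoxBounded ρ Y C)
    (hD : BoxBounded ρ Y D) :
    Integrable (fun z : ThinPt n × ℝ => p.f z.1 z.2 * A z.1 z.2 + B z.1 z.2 +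
      z.2 ^ (-a) * C z.1 z.2 + z.2 ^ a * D z.1 z.2) (boxMeasure n ρ Y) := by
  have h0 := hB.integrable_mul (integrable_const (1 : ℝ))
  simp only [one_mul] at h0
  exact (((hA.integrable_mul p.int_f).add h0).add
    (hC.integrable_mul (integrable_rpow_height (by linarith)))).add
    (hD.integrable_mul (integrable_rpow_height ha))

theorem integrable_height_mul (ha : -1 < a) (ha1 : a < 1) {C D : ThinPt n → ℝ → ℝ}
    (hC : BoxBounded ρ Y C) (hD : BoxBounded ρ Y D) :
    Integrable (fun z : ThinPt n × ℝ => z.2 ^ (-a) * C z.1 z.2 + z.2 ^ a * D z.1 z.2)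
      (boxMeasure n ρ Y) := by
  exact (hC.integrable_mul (integrable_rpow_height (by linarith))).add
    (hD.integrable_mul (integrable_rpow_height ha))

theorem integrable_fluxX (ha : -1 < a) (ha1 : a < 1) (K m κ c : RadialWeight) (i : Fin n) :
    Integrable (fun z : ThinPt n × ℝ => p.fluxX K m κ c i z.1 z.2) (boxMeasure n ρ Y) := by
  have bK := BoxBounded.radial (n := n) (ρ := ρ) (Y := Y) K.continuous_fn
  have bc := BoxBounded.radial (n := n) (ρ := ρ) (Y := Y) c.continuous_fn
  have bx := BoxBounded.coord (n := n) (ρ := ρ) (Y := Y) i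
  have bM := p.bdd_multiplier ha1 K m κ
  refine (integrable_height_mul ha ha1
    ((BoxBounded.const (-(1 / 2))).mul ((bK.mul bx).mul (p.bdd_P.pow 2)))
    (((bM.mul (p.bdd_ui i)).sub ((BoxBounded.const (1 / 2)).mul
      ((bK.mul bx).mul p.bdd_gradSq))).add ((bc.mul bx).mul (p.bdd_u.pow 2)))).congr
    (Filter.Eventually.of_forall fun z => ?_)
  simp only [fluxX, density]; ring

theorem integrable_divX (ha : -1 < a) (ha1 : a < 1) (K m κ c : RadialWeight) (i : Fin n) :
    Integrable (fun z : ThinPt n × ℝ => p.divX K m κ c i z.1 z.2) (boxMeasure n ρ Y) := by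
  have bK := BoxBounded.radial (n := n) (ρ := ρ) (Y := Y) K.continuous_fn
  have bK' := BoxBounded.radial (n := n) (ρ := ρ) (Y := Y) K.continuous_dfn
  have bc := BoxBounded.radial (n := n) (ρ := ρ) (Y := Y) c.continuous_fn
  have bc' := BoxBounded.radial (n := n) (ρ := ρ) (Y := Y) c.continuous_dfn
  have bx := BoxBounded.coord (n := n) (ρ := ρ) (Y := Y) i
  have bM := p.bdd_multiplier ha1 K m κ
  have bh := BoxBounded.const (n := n) (ρ := ρ) (Y := Y) (1 / 2)
  have b2 := BoxBounded.const (n := n) (ρ := ρ) (Y := Y) 2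
  have bS := BoxBounded.sum Finset.univ fun j => (p.bdd_ui j).mul (p.bdd_uij j i)
  refine (integrable_height_mul ha ha1
    ((BoxBounded.const (-1)).mul (((bh.mul (((bK'.mul bx).mul bx).add bK)).mul (p.bdd_P.pow 2)).add
      (((bK.mul bx).mul p.bdd_P).mul (p.bdd_Pi i))))
    (((((((p.bdd_multiplierX ha1 K m κ i).mul (p.bdd_ui i)).add (bM.mul (p.bdd_uij i i))).sub
      ((bK.mul bx).mul bS)).sub ((bh.mul (((bK'.mul bx).mul bx).add bK)).mul p.bdd_gradSq)).add
      ((((bc'.mul bx).mul bx).add bc).mul (p.bdd_u.pow 2))).add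
      ((((b2.mul bc).mul bx).mul p.bdd_u).mul (p.bdd_ui i)))).congr
    (Filter.Eventually.of_forall fun z => ?_)
  simp only [divX]; ring

theorem integrable_fluxT (ha : -1 < a) (ha1 : a < 1) (κ d : RadialWeight) :
    Integrable (fun z : ThinPt n × ℝ => p.fluxT κ d z.1 z.2) (boxMeasure n ρ Y) := by
  have bκ := BoxBounded.radial (n := n) (ρ := ρ) (Y := Y) κ.continuous_fn
  have bd := BoxBounded.radial (n := n) (ρ := ρ) (Y := Y) d.continuous_fn
  refine (integrable_height_mul ha ha1
    ((BoxBounded.const (-(1 / 2))).mul (bκ.mul (p.bdd_P.pow 2)))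
    ((bd.mul (p.bdd_u.pow 2)).sub ((BoxBounded.const (1 / 2)).mul (bκ.mul p.bdd_gradSq)))).congr
    (Filter.Eventually.of_forall fun z => ?_)
  simp only [fluxT, density]; ring

theorem integrable_divT (ha : -1 < a) (ha1 : a < 1) (κ d : RadialWeight) :
    Integrable (fun z : ThinPt n × ℝ => p.divT κ d z.1 z.2) (boxMeasure n ρ Y) := by
  have bκ := BoxBounded.radial (n := n) (ρ := ρ) (Y := Y) κ.continuous_fn
  have bd := BoxBounded.radial (n := n) (ρ := ρ) (Y := Y) d.continuous_fn
  have bS := BoxBounded.sum Finset.univ fun j => (p.bdd_ui j).mul (p.bdd_uit j)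
  refine (integrable_height_mul ha ha1
    ((BoxBounded.const (-1)).mul ((bκ.mul p.bdd_P).mul p.bdd_Pt))
    (((((BoxBounded.const 2).mul bd).mul p.bdd_u).mul p.bdd_ut).sub (bκ.mul bS))).congr
    (Filter.Eventually.of_forall fun z => ?_)
  simp only [divT]; ring

theorem integrable_divY (ha : -1 < a) (ha1 : a < 1) (K m κ c : RadialWeight) :
    Integrable (fun z : ThinPt n × ℝ => p.divY K m κ c z.1 z.2) (boxMeasure n ρ Y) := by
  have bK := BoxBounded.radial (n := n) (ρ := ρ) (Y := Y) K.continuous_fn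
  have bK' := BoxBounded.radial (n := n) (ρ := ρ) (Y := Y) K.continuous_dfn
  have bm := BoxBounded.radial (n := n) (ρ := ρ) (Y := Y) m.continuous_fn
  have bm' := BoxBounded.radial (n := n) (ρ := ρ) (Y := Y) m.continuous_dfn
  have bκ := BoxBounded.radial (n := n) (ρ := ρ) (Y := Y) κ.continuous_fn
  have bκ' := BoxBounded.radial (n := n) (ρ := ρ) (Y := Y) κ.continuous_dfn
  have bc := BoxBounded.radial (n := n) (ρ := ρ) (Y := Y) c.continuous_fn
  have bc' := BoxBounded.radial (n := n) (ρ := ρ) (Y := Y) c.continuous_dfn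
  have by' := BoxBounded.height (n := n) (ρ := ρ) (Y := Y)
  have bh := BoxBounded.const (n := n) (ρ := ρ) (Y := Y) (1 / 2)
  have b2 := BoxBounded.const (n := n) (ρ := ρ) (Y := Y) 2
  have bm1 := BoxBounded.const (n := n) (ρ := ρ) (Y := Y) (1 - a)
  have bp1 := BoxBounded.const (n := n) (ρ := ρ) (Y := Y) (1 + a)
  have rm : BoxBounded ρ Y (fun (_ : ThinPt n) y => y ^ (1 - a)) := BoxBounded.rpow (by linarith)
  have rp : BoxBounded ρ Y (fun (_ : ThinPt n) y => y ^ (1 + a)) := BoxBounded.rpow (by linarith)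
  have bσ := BoxBounded.sum Finset.univ fun j =>
    (BoxBounded.coord (n := n) (ρ := ρ) (Y := Y) j).mul (p.bdd_Pi j)
  have bδ := BoxBounded.sum Finset.univ fun j => (p.bdd_ui j).mul (p.bdd_Pi j)
  exact p.integrable_of_bounded ha ha1 (p.bdd_multiplier ha1 K m κ)
    ((((((p.bdd_P.mul by').mul (((bK'.mul (p.bdd_euler ha1)).add (bm'.mul p.bdd_u)).add
      (bκ'.mul p.bdd_ut))).sub
      (((bh.mul bK').mul by').mul ((rm.mul (p.bdd_P.pow 2)).add (rp.mul p.bdd_gradSq)))).sub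
      ((bK.mul by').mul bδ)).add (rp.mul ((bc'.mul by').mul (p.bdd_u.pow 2)))).add
      ((((b2.mul by').mul bc).mul p.bdd_u).mul p.bdd_P))
    ((p.bdd_P.mul (((bK.mul (bσ.add (bm1.mul p.bdd_P))).add (bm.mul p.bdd_P)).add
      (bκ.mul p.bdd_Pt))).sub (((bh.mul bK).mul bm1).mul (p.bdd_P.pow 2)))
    (((bp1.mul bc).mul (p.bdd_u.pow 2)).sub (((bh.mul bK).mul bp1).mul p.bdd_gradSq))

theorem gradSq_eq_zero {q : ThinPt n} {y : ℝ} (hy : 0 ≤ y) (h : p.ρ₀ ≤ ‖q‖ ∨ Y ≤ y) :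
    p.gradSq q y = 0 := by
  simp [gradSq, p.zero_ui _ q y hy h]

theorem integrable_energyIntegrand (ha : -1 < a) (ha1 : a < 1) (K m κ c d : RadialWeight) :
    Integrable (fun z : ThinPt n × ℝ => p.energyIntegrand K m κ c d z.1 z.2)
      (boxMeasure n ρ Y) := by
  refine (((p.integrable_divY ha ha1 K m κ c).add (integrable_finsetSum Finset.univ fun i _ =>
    p.integrable_divX ha ha1 K m κ c i)).add (p.integrable_divT ha ha1 κ d)).congr ?_
  filter_upwards [ae_boxMeasure] with z hz
  exact (p.energyIntegrand_eq K m κ c d z.1 hz.2.1).symm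

/-- The energy identity. -/
theorem integral_energyIntegrand (ha : -1 < a) (ha1 : a < 1) (K m κ c d : RadialWeight) :
    ∫ z, p.energyIntegrand K m κ c d z.1 z.2 ∂(boxMeasure n ρ Y) =
      -∫ q in Metric.closedBall 0 ρ, p.multiplier K m κ q 0 * p.P q 0 := by
  have hY := integral_box_of_isPrimitive p.pos_Y.le (p.prim_fluxY ha ha1 K m κ c)
    (fun q => by simp [fluxY, p.zero_P q Y p.pos_Y.le (Or.inr le_rfl),
      p.zero_u q Y p.pos_Y.le (Or.inr le_rfl), p.gradSq_eq_zero p.pos_Y.le (Or.inr le_rfl)])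
    (p.integrable_divY ha ha1 K m κ c)
  have hX : ∀ i, ∫ z, p.divX K m κ c i z.1 z.2 ∂(boxMeasure n ρ Y) = 0 := fun i =>
    integral_box_of_hasTangential p.lt_ρ (p.tan_fluxX K m κ c i)
      (fun q y hy hq => by simp [fluxX, density, p.zero_P q y hy (Or.inl hq),
        p.zero_u q y hy (Or.inl hq), p.zero_ui i q y hy (Or.inl hq),
        p.gradSq_eq_zero hy (Or.inl hq)])
      (p.integrable_fluxX ha ha1 K m κ c i) (p.integrable_divX ha ha1 K m κ c i)
  have hT := integral_box_of_hasTangential p.lt_ρ (p.time_fluxT κ d)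
      (fun q y hy hq => by simp [fluxT, density, p.zero_P q y hy (Or.inl hq),
        p.zero_u q y hy (Or.inl hq), p.gradSq_eq_zero hy (Or.inl hq)])
      (p.integrable_fluxT ha ha1 κ d) (p.integrable_divT ha ha1 κ d)
  have hsum : ∫ z, p.energyIntegrand K m κ c d z.1 z.2 ∂(boxMeasure n ρ Y) =
      ∫ z, (p.divY K m κ c z.1 z.2 + ∑ i, p.divX K m κ c i z.1 z.2 + p.divT κ d z.1 z.2)
        ∂(boxMeasure n ρ Y) := by
    refine integral_congr_ae ?_
    filter_upwards [ae_boxMeasure] with z hz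
    exact p.energyIntegrand_eq K m κ c d z.1 hz.2.1
  have hi := integrable_finsetSum Finset.univ fun i _ => p.integrable_divX ha ha1 K m κ c i
  have hi2 : Integrable (fun z : ThinPt n × ℝ => p.divY K m κ c z.1 z.2 +
      ∑ i, p.divX K m κ c i z.1 z.2) (boxMeasure n ρ Y) := (p.integrable_divY ha ha1 K m κ c).add hi
  rw [hsum, integral_add hi2 (p.integrable_divT ha ha1 κ d), integral_add (p.integrable_divY ha ha1 K m κ c) hi,
    integral_finsetSum _ fun i _ => p.integrable_divX ha ha1 K m κ c i, hT, hY]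
  simp only [hX, Finset.sum_const_zero, add_zero]
  congr 1
  refine integral_congr_ae (Filter.Eventually.of_forall fun q => ?_)
  -- At `y = 0` the parts of the normal flux carrying `y^(1-a)` or `y^(1+a)` vanish, and only
  -- multiplier times `P` survives.
  have h1 : (1 - a) ≠ 0 := by linarith
  have h2 : (1 + a) ≠ 0 := by linarith
  simp [fluxY, Real.zero_rpow h1, Real.zero_rpow h2]

end Profile
end
end ParabolicExtension

/-! ### The Carleman weights as functions of the squared radius -/

namespace ParabolicExtension

noncomputable section

/-- A smooth cutoff vanishing for `s ≤ c / 2` and equal to one for `s ≥ 3 c / 4`. -/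
def cutoff (c s : ℝ) : ℝ := Real.smoothTransition (4 / c * s - 2)

theorem cutoff_nonneg (c s : ℝ) : 0 ≤ cutoff c s := Real.smoothTransition.nonneg _

theorem cutoff_le_one (c s : ℝ) : cutoff c s ≤ 1 := Real.smoothTransition.le_one _

theorem cutoff_eq_one {c s : ℝ} (hc : 0 < c) (h : 3 / 4 * c ≤ s) : cutoff c s = 1 := by
  refine Real.smoothTransition.one_of_one_le ?_
  have : 4 / c * (3 / 4 * c) ≤ 4 / c * s := by gcongr
  have h2 : 4 / c * (3 / 4 * c) = 3 := by field_simp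
  linarith

theorem cutoff_eq_zero {c s : ℝ} (hc : 0 < c) (h : s ≤ c / 2) : cutoff c s = 0 := by
  refine Real.smoothTransition.zero_of_nonpos ?_
  have : 4 / c * s ≤ 4 / c * (c / 2) := by gcongr
  have h2 : 4 / c * (c / 2) = 2 := by field_simp; norm_num
  linarith

theorem contDiff_cutoff (c : ℝ) : ContDiff ℝ ∞ (cutoff c) :=
  Real.smoothTransition.contDiff.comp ((contDiff_const.mul contDiff_id).sub contDiff_const)

/-- A smooth cutoff equal to one on `[3 c / 4, 2]` and vanishing off `[c / 2, 3]`. -/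
def window (c s : ℝ) : ℝ := cutoff c s * (1 - cutoff 4 s)

theorem window_nonneg (c s : ℝ) : 0 ≤ window c s :=
  mul_nonneg (cutoff_nonneg c s) (by linarith [cutoff_le_one 4 s])

theorem window_le_one (c s : ℝ) : window c s ≤ 1 :=
  mul_le_one₀ (cutoff_le_one c s) (by linarith [cutoff_le_one 4 s])
    (by linarith [cutoff_nonneg 4 s])

theorem window_eq_one {c s : ℝ} (hc : 0 < c) (h : 3 / 4 * c ≤ s) (h2 : s ≤ 2) :
    window c s = 1 := by
  rw [window, cutoff_eq_one hc h, cutoff_eq_zero (by norm_num) (by linarith)]; norm_num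

theorem contDiff_window (c : ℝ) : ContDiff ℝ ∞ (window c) :=
  (contDiff_cutoff c).mul (contDiff_const.sub (contDiff_cutoff 4))

/-- The truncation of a smooth function on `(0, 4)` to a weight, keeping its values on
`[c, 1]`. -/
def RadialWeight.extend (c : ℝ) (hc : 0 < c) (φ : ℝ → ℝ) (hφ : ContDiffOn ℝ ∞ φ (Ioo 0 4)) :
    RadialWeight := by
  have hs : ContDiff ℝ ∞ (fun s => window c s * φ s) := by
    rw [contDiff_iff_contDiffAt]
    intro s
    rcases lt_or_ge s (c / 2) with h | h
    · refine (contDiffAt_const (c := (0 : ℝ))).congr_of_eventuallyEq ?_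
      filter_upwards [Iio_mem_nhds h] with t ht
      rw [window, cutoff_eq_zero hc (le_of_lt ht), zero_mul, zero_mul]
    · rcases lt_or_ge 3 s with h3 | h3
      · refine (contDiffAt_const (c := (0 : ℝ))).congr_of_eventuallyEq ?_
        filter_upwards [Ioi_mem_nhds h3] with t ht
        have ht : 3 < t := ht
        rw [window, cutoff_eq_one (c := 4) (by norm_num) (by linarith), sub_self, mul_zero,
          zero_mul]
      · exact (contDiff_window c).contDiffAt.mul
          (hφ.contDiffAt (Ioo_mem_nhds (by linarith) (by linarith)))
  exact
    { fn := fun s => window c s * φ s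
      dfn := fun s => 2 * deriv (fun s => window c s * φ s) s
      hasDerivAt := fun s => by
        rw [mul_div_cancel_left₀ _ two_ne_zero]
        exact (hs.differentiable (by simp) s).hasDerivAt
      continuous_dfn := continuous_const.mul (hs.continuous_deriv (by simp)) }

namespace RadialWeight

variable {c : ℝ} {hc : 0 < c} {φ : ℝ → ℝ} {hφ : ContDiffOn ℝ ∞ φ (Ioo 0 4)}

theorem extend_fn_apply (s : ℝ) : (extend c hc φ hφ).fn s = window c s * φ s := rfl

theorem extend_fn {s : ℝ} (h : c ≤ s) (h1 : s ≤ 1) : (extend c hc φ hφ).fn s = φ s := by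
  rw [extend_fn_apply, window_eq_one hc (by linarith) (by linarith), one_mul]

theorem extend_dfn {s φ' : ℝ} (h : c ≤ s) (h1 : s ≤ 1) (hd : HasDerivAt φ (φ' / 2) s) :
    (extend c hc φ hφ).dfn s = φ' := by
  have : HasDerivAt (fun s => window c s * φ s) (φ' / 2) s := by
    refine hd.congr_of_eventuallyEq ?_
    -- The window equals one on a neighbourhood of `[c, 1]`, not only on this interval, so
    -- derivatives at the endpoints are unchanged too.
    filter_upwards [Ioo_mem_nhds (show 3 / 4 * c < s by linarith) (show s < 2 by linarith)] with t ht
    rw [window_eq_one hc ht.1.le ht.2.le, one_mul]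
  change 2 * deriv (fun s => window c s * φ s) s = φ'
  rw [this.deriv]; ring

/-- The zero weight. -/
def zero : RadialWeight := ⟨fun _ => 0, fun _ => 0, fun s => by simpa using hasDerivAt_const s (0:ℝ),
  continuous_const⟩

end RadialWeight

/-- `ε |X| ^ ε` as a function of `s = |X|²`. -/
def rhoFn (ε s : ℝ) : ℝ := ε * s ^ (ε / 2)

/-- The Carleman weight `|X| ^ (-2 α - 2) e ^ (2 α |X| ^ ε)` as a function of `s = |X|²`. -/
def carlemanFn (α ε s : ℝ) : ℝ := s ^ (-α - 1) * Real.exp (2 * α * s ^ (ε / 2))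

/-- The logarithmic radial derivative of the conjugating weight. -/
def betaFn (D α ε s : ℝ) : ℝ := -α - 2 + D / 2 + α * rhoFn ε s

/-- The weight of the time derivative in the multiplier. -/
def timeFn (α ε s : ℝ) : ℝ := carlemanFn α ε s * s / (2 * α * (1 - rhoFn ε s))

/-- The coefficient that removes the cross terms from the energy identity. -/
def crossFn (D α ε s : ℝ) : ℝ := carlemanFn α ε s / s / 2 *
  (2 * betaFn D α ε s ^ 2 - (D - 2) * betaFn D α ε s - α * ε * rhoFn ε s)

/-- Twice the derivative of `timeFn`. -/
def timeFn' (α ε s : ℝ) : ℝ := carlemanFn α ε s / (2 * α * (1 - rhoFn ε s)) *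
  (-2 * α * (1 - rhoFn ε s) + ε * rhoFn ε s / (1 - rhoFn ε s))

section Derivatives

variable {D α ε s : ℝ}

theorem hasDerivAt_rhoFn (hs : 0 < s) : HasDerivAt (rhoFn ε) (ε * rhoFn ε s / s / 2) s := by
  refine ((Real.hasDerivAt_rpow_const (p := ε / 2) (Or.inl hs.ne')).const_mul ε).congr_deriv ?_
  rw [rhoFn, Real.rpow_sub hs, Real.rpow_one]; ring

/-- The dimension `D` is a free parameter, since `2β + 2 - D = -2α - 2 + 2αρ` does not depend on it.
In this form the derivative is expressed by `β`, as needed for completing squares. -/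
theorem hasDerivAt_carlemanFn (hs : 0 < s) : HasDerivAt (carlemanFn α ε)
    (carlemanFn α ε s / s * (2 * betaFn D α ε s + 2 - D) / 2) s := by
  have h1 := Real.hasDerivAt_rpow_const (x := s) (p := -α - 1) (Or.inl hs.ne')
  have h2 := (((Real.hasDerivAt_rpow_const (x := s) (p := ε / 2) (Or.inl hs.ne')).const_mul
    (2 * α))).exp
  refine (h1.mul h2).congr_deriv ?_
  simp only [carlemanFn, betaFn, rhoFn]
  rw [Real.rpow_sub_one hs.ne' (-α - 1), Real.rpow_sub_one hs.ne' (ε / 2)]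
  field_simp
  ring

theorem hasDerivAt_betaFn (hs : 0 < s) : HasDerivAt (betaFn D α ε)
    (α * (ε * rhoFn ε s) / s / 2) s :=
  (((hasDerivAt_rhoFn hs).const_mul α).const_add (-α - 2 + D / 2)).congr_deriv (by ring)

theorem hasDerivAt_timeFn (hs : 0 < s) (hα : α ≠ 0) (hρ : 1 - rhoFn ε s ≠ 0) :
    HasDerivAt (timeFn α ε) (timeFn' α ε s / 2) s := by
  have h1 := (hasDerivAt_carlemanFn (D := 0) (α := α) (ε := ε) hs).mul (hasDerivAt_id s)
  have h2 := ((hasDerivAt_rhoFn (ε := ε) hs).const_sub 1).const_mul (2 * α)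
  refine (h1.div h2 (by positivity)).congr_deriv ?_
  simp only [timeFn', betaFn, id, Pi.mul_apply]
  field_simp
  ring

theorem hasDerivAt_crossFn (hs : 0 < s) : HasDerivAt (crossFn D α ε)
    ((crossFn D α ε s * (2 * betaFn D α ε s - D) + carlemanFn α ε s / s / 2 *
      (α * ε * rhoFn ε s * (4 * betaFn D α ε s - (D - 2) - ε))) / s / 2) s := by
  have h1 := ((hasDerivAt_carlemanFn (D := D) (α := α) (ε := ε) hs).div (hasDerivAt_id s)
    hs.ne').div_const 2
  have hb := hasDerivAt_betaFn (D := D) (α := α) (ε := ε) hs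
  have h2 := (((hb.pow 2).const_mul 2).sub (hb.const_mul (D - 2))).sub
    ((hasDerivAt_rhoFn (ε := ε) hs).const_mul (α * ε))
  refine (h1.mul h2).congr_deriv ?_
  simp only [crossFn, id, Pi.div_apply, Pi.pow_apply, Pi.sub_apply]
  field_simp
  ring

/-- The weight of the gradient estimate. -/
def gradFn (α ε s : ℝ) : ℝ := carlemanFn α ε s * s ^ (ε / 2)

theorem hasDerivAt_gradFn (hs : 0 < s) : HasDerivAt (gradFn α ε)
    (gradFn α ε s / s * (2 * betaFn D α ε s + 2 - D + ε) / 2) s := by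
  refine ((hasDerivAt_carlemanFn (D := D) hs).mul (Real.hasDerivAt_rpow_const (x := s)
    (p := ε / 2) (Or.inl hs.ne'))).congr_deriv ?_
  rw [gradFn, Real.rpow_sub_one hs.ne' (ε / 2)]
  field_simp

theorem hasDerivAt_mul_betaFn (hs : 0 < s) :
    HasDerivAt (fun s => carlemanFn α ε s * betaFn D α ε s)
      (carlemanFn α ε s / s * ((2 * betaFn D α ε s + 2 - D) * betaFn D α ε s +
        α * (ε * rhoFn ε s)) / 2) s := by
  refine ((hasDerivAt_carlemanFn (D := D) hs).mul (hasDerivAt_betaFn (D := D) hs)).congr_deriv ?_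
  ring

theorem carlemanFn_pos (hs : 0 < s) : 0 < carlemanFn α ε s := by
  unfold carlemanFn; positivity

theorem contDiffOn_rpow (p : ℝ) : ContDiffOn ℝ ∞ (fun s : ℝ => s ^ p) (Ioo 0 4) :=
  contDiffOn_id.rpow_const_of_ne fun _ hx => hx.1.ne'

theorem contDiffOn_rhoFn : ContDiffOn ℝ ∞ (rhoFn ε) (Ioo 0 4) :=
  contDiffOn_const.mul (contDiffOn_rpow _)

theorem contDiffOn_carlemanFn : ContDiffOn ℝ ∞ (carlemanFn α ε) (Ioo 0 4) :=
  (contDiffOn_rpow _).mul (contDiffOn_const.mul (contDiffOn_rpow _)).exp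

theorem contDiffOn_betaFn : ContDiffOn ℝ ∞ (betaFn D α ε) (Ioo 0 4) :=
  contDiffOn_const.add (contDiffOn_const.mul contDiffOn_rhoFn)

/-- The interval `(0, 4)` exceeds the range `|X|² ≤ 1` because the truncating window lives up to `s
= 3`. The condition `ε < 1/2` with `s^(ε/2) ≤ 2` keeps the denominator `1 - ρ` positive there. -/
theorem rhoFn_lt_one (hε : 0 < ε) (hε1 : ε < 1 / 2) (hs : s ∈ Ioo (0 : ℝ) 4) :
    rhoFn ε s < 1 := by
  have h1 : s ^ (ε / 2) ≤ 4 ^ (ε / 2) := Real.rpow_le_rpow hs.1.le hs.2.le (by positivity)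
  have h2 : (4 : ℝ) ^ (ε / 2) ≤ 4 ^ (1 / 2 : ℝ) :=
    Real.rpow_le_rpow_of_exponent_le (by norm_num) (by linarith)
  have h3 : (4 : ℝ) ^ (1 / 2 : ℝ) = 2 := by
    rw [← Real.sqrt_eq_rpow, show (4 : ℝ) = 2 ^ 2 by norm_num, Real.sqrt_sq (by norm_num)]
  have h4 : s ^ (ε / 2) ≤ 2 := by linarith
  unfold rhoFn
  nlinarith [Real.rpow_nonneg hs.1.le (ε / 2)]

theorem contDiffOn_one_sub_rhoFn : ContDiffOn ℝ ∞ (fun s => 1 - rhoFn ε s) (Ioo 0 4) :=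
  contDiffOn_const.sub contDiffOn_rhoFn

theorem contDiffOn_timeFn (hα : α ≠ 0) (hε : 0 < ε) (hε1 : ε < 1 / 2) :
    ContDiffOn ℝ ∞ (timeFn α ε) (Ioo 0 4) :=
  (contDiffOn_carlemanFn.mul contDiffOn_id).div
    (contDiffOn_const.mul contDiffOn_one_sub_rhoFn) fun s hs => by
      have := rhoFn_lt_one hε hε1 hs
      have : 1 - rhoFn ε s ≠ 0 := by linarith
      positivity

theorem contDiffOn_timeFn' (hα : α ≠ 0) (hε : 0 < ε) (hε1 : ε < 1 / 2) :
    ContDiffOn ℝ ∞ (timeFn' α ε) (Ioo 0 4) := by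
  have h0 : ∀ s ∈ Ioo (0 : ℝ) 4, 1 - rhoFn ε s ≠ 0 := fun s hs => by
    have := rhoFn_lt_one hε hε1 hs
    linarith
  exact (contDiffOn_carlemanFn.div (contDiffOn_const.mul contDiffOn_one_sub_rhoFn) fun s hs => by
      have := h0 s hs
      positivity).mul
    ((contDiffOn_const.mul contDiffOn_one_sub_rhoFn).add
      ((contDiffOn_const.mul contDiffOn_rhoFn).div contDiffOn_one_sub_rhoFn h0))

theorem contDiffOn_crossFn : ContDiffOn ℝ ∞ (crossFn D α ε) (Ioo 0 4) :=
  ((contDiffOn_carlemanFn.div contDiffOn_id fun _ hs => hs.1.ne').div_const 2).mul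
    (((contDiffOn_const.mul (contDiffOn_betaFn.pow 2)).sub
      (contDiffOn_const.mul contDiffOn_betaFn)).sub (contDiffOn_const.mul contDiffOn_rhoFn))

theorem contDiffOn_gradFn : ContDiffOn ℝ ∞ (gradFn α ε) (Ioo 0 4) :=
  contDiffOn_carlemanFn.mul (contDiffOn_rpow _)

end Derivatives

end
end ParabolicExtension

/-! ### Pointwise quadratic inequalities behind the interior estimates -/

namespace ParabolicExtension

noncomputable section

/-- Here `b = z + τ`. Since `2α(1-ρ) ≥ α`, the leading square absorbs both `bG ≤ α b²/2 + G²/(2α)`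
and the mixed term, whose coefficient `ερ/(1-ρ)` is at most `1/2`. One `z²` is left over from `-2
z²`, and half of the main part of the `u²` coefficient is kept. -/
theorem carleman_quadratic {α ε ρ z τ G u : ℝ} (hα : 1 ≤ α) (hε : 0 < ε) (hε1 : ε < 1 / 2)
    (hρ0 : 0 ≤ ρ) (hρ : ρ ≤ 1 / 2) :
    (z + τ) * G - 2 * α * (1 - ρ) * (z + τ) ^ 2 - (2 + ε * ρ / (1 - ρ)) * z ^ 2 +
      ε * ρ / (1 - ρ) * z * (z + τ) - α * ε * ρ * (α * (1 - ρ) + 1 + ε / 2) * u ^ 2 ≤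
    G ^ 2 / (2 * α) - z ^ 2 - α ^ 2 * ε * ρ / 2 * u ^ 2 := by
  set b := z + τ with hb
  set e := ε * ρ / (1 - ρ) with he
  have he0 : 0 ≤ e := div_nonneg (by positivity) (by linarith)
  have he1 : e ≤ 1 / 2 := by rw [he, div_le_iff₀ (by linarith)]; nlinarith
  have h1 : b * G ≤ α / 2 * b ^ 2 + G ^ 2 / (2 * α) := by
    have : 0 ≤ (α * b - G) ^ 2 / (2 * α) := by positivity
    have h2 : (α * b - G) ^ 2 / (2 * α) = α / 2 * b ^ 2 + G ^ 2 / (2 * α) - b * G := by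
      field_simp; ring
    linarith
  have h2 : α * b ^ 2 ≤ 2 * α * (1 - ρ) * b ^ 2 := by
    have : 0 ≤ α * b ^ 2 := by positivity
    nlinarith
  have h3 : e * z * b ≤ 1 / 2 * (z ^ 2 + b ^ 2) := by
    have : z * b ≤ (z ^ 2 + b ^ 2) / 2 := by nlinarith [sq_nonneg (z - b)]
    nlinarith [sq_nonneg z, sq_nonneg b]
  have h4 : α ^ 2 * ε * ρ / 2 * u ^ 2 ≤ α * ε * ρ * (α * (1 - ρ) + 1 + ε / 2) * u ^ 2 := by
    have h5 : α / 2 ≤ α * (1 - ρ) + 1 + ε / 2 := by nlinarith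
    have h6 : 0 ≤ α * ε * ρ * u ^ 2 := by positivity
    nlinarith
  have h7 : 0 ≤ e * z ^ 2 := by positivity
  nlinarith [sq_nonneg b]

/-- The left side equals `w K/s` times the quadratic form of `carleman_quadratic` with `z = Z + βu`,
`τ = s u_t/(2α(1-ρ))` and `G = s v g`. Three choices produce this. `C` solves `m' + 2C = 2K'β`,
where `m = Kβ` and the primes denote twice the derivative in `s`, so that `Z` occurs only through
`z`. The coefficient `Tβ/2` likewise turns `u_t Z` into `u_t z`. Finally `κ = Ks/(2α(1-ρ))` matches
`-w u_t K(z+τ)` with the leading part `-2α(1-ρ)` of `K'` and of `T`, giving `-2α(1-ρ)(z+τ)²`. -/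
theorem carleman_pointwise {D α ε ρ s K w v Z u ut g β T C : ℝ} (hα : 1 ≤ α) (hε : 0 < ε)
    (hε1 : ε < 1 / 2) (hρ0 : 0 ≤ ρ) (hρ : ρ ≤ 1 / 2) (hs : 0 < s) (hK : 0 < K) (hw : 0 < w)
    (hwv : w * v = 1) (hβ : β = -α - 2 + D / 2 + α * ρ)
    (hT : T = K / (2 * α * (1 - ρ)) * (-2 * α * (1 - ρ) + ε * ρ / (1 - ρ)))
    (hC : C = K / s / 2 * (2 * β ^ 2 - (D - 2) * β - α * ε * ρ)) :
    (K * Z + K * β * u + K * s / (2 * α * (1 - ρ)) * ut) * (g - w * ut) +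
      w * (K / s * (2 * β + 2 - D) * Z ^ 2) +
      w * (K / s * ((2 * β + 2 - D) * β + α * (ε * ρ)) * u * Z + T * ut * Z + 2 * C * u * Z +
        (D * C + (C * (2 * β - D) + K / s / 2 * (α * ε * ρ * (4 * β - (D - 2) - ε)))) * u ^ 2 +
        2 * (T * β / 2) * u * ut) ≤
    1 / (2 * α) * (v * (K * s * g ^ 2)) - w * (K / s * (Z + β * u) ^ 2) -
      α ^ 2 * ε / 2 * (w * (K / s * ρ * u ^ 2)) := by
  have hα0 : 0 < α := by linarith
  have hA : 0 < 1 - ρ := by linarith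
  have hv : v = 1 / w := by field_simp; linarith
  have key := carleman_quadratic (z := Z + β * u) (τ := s * ut / (2 * α * (1 - ρ)))
    (G := s * v * g) (u := u) hα hε hε1 hρ0 hρ
  have hk : 0 < w * K / s := by positivity
  have key2 := mul_le_mul_of_nonneg_left key hk.le
  refine le_trans (le_of_eq ?_) (key2.trans (le_of_eq ?_))
  · rw [hC, hT, hv]
    have hD : D = 2 * (β + α + 2 - α * ρ) := by rw [hβ]; ring
    rw [hD]
    field_simp
    ring
  · rw [hv]
    field_simp

/-- Young's inequality after substituting `Z = z - βu`. With `q = 2β + 2 - D + ε` one has `|q| ≤ 4α`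
and `|β| ≤ 2α`, so the terms `qβu²`, `-quz` and `-uG` cost `8`, `4` and `1` times `α²u²`, which
gives the constant `13`. -/
theorem gradient_pointwise {D α ε r s K w v Z u g β : ℝ} (hα : 1 ≤ α) (hε : 0 < ε)
    (hε1 : ε < 1 / 2) (hr0 : 0 ≤ r) (hr : r ≤ 1) (hs : 0 < s) (hK : 0 < K) (hw : 0 < w)
    (hwv : w * v = 1) (hβ : β = -α - 2 + D / 2 + α * (ε * r)) (hD : 0 < D) (hDα : D + 2 ≤ α) :
    -(K * r * u * g) - w * (K * r / s * (2 * β + 2 - D + ε) * u * Z) ≤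
      13 * α ^ 2 * (w * (K / s * r * u ^ 2)) + w * (K / s * (Z + β * u) ^ 2) +
        1 / α * (v * (K * s * g ^ 2)) := by
  have hα0 : 0 < α := by linarith
  have hv : v = 1 / w := by field_simp; linarith
  set z := Z + β * u with hz
  have hZ : Z = z - β * u := by rw [hz]; ring
  set G := s * v * g with hG
  have hρ1 : ε * r ≤ 1 / 2 := by nlinarith
  have hρ0 : 0 ≤ ε * r := by positivity
  set q := 2 * β + 2 - D + ε with hq
  have hq1 : |q| ≤ 4 * α := by rw [abs_le, hq, hβ]; constructor <;> nlinarith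
  have hb1 : |β| ≤ 2 * α := by rw [abs_le, hβ]; constructor <;> nlinarith
  have hqβ : q * β ≤ 8 * α ^ 2 := by
    calc q * β ≤ |q * β| := le_abs_self _
      _ = |q| * |β| := abs_mul _ _
      _ ≤ (4 * α) * (2 * α) := by gcongr
      _ = 8 * α ^ 2 := by ring
  have hquz : -(q * u * z) ≤ 4 * α ^ 2 * u ^ 2 + z ^ 2 := by
    have hq2 : q ^ 2 ≤ 16 * α ^ 2 := by
      rw [← sq_abs]; nlinarith [abs_nonneg q]
    have h1 : 0 ≤ (q * u / 2 + z) ^ 2 := sq_nonneg _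
    have h2 : q ^ 2 * u ^ 2 ≤ 16 * α ^ 2 * u ^ 2 := by gcongr
    nlinarith
  have hug : -(u * G) ≤ α ^ 2 * u ^ 2 + G ^ 2 / α := by
    have h1 : 0 ≤ (α * u + G / (2 * α)) ^ 2 := sq_nonneg _
    have h2 : (α * u + G / (2 * α)) ^ 2 = α ^ 2 * u ^ 2 + u * G + G ^ 2 / (4 * α ^ 2) := by
      field_simp; ring
    have h3 : G ^ 2 / (4 * α ^ 2) ≤ G ^ 2 / α := by
      apply div_le_div_of_nonneg_left (sq_nonneg _) hα0; nlinarith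
    linarith
  have key : r * (-(u * G) - q * u * Z) ≤ 13 * α ^ 2 * (r * u ^ 2) + z ^ 2 + 1 / α * G ^ 2 := by
    have h1 : -(u * G) - q * u * Z ≤ 13 * α ^ 2 * u ^ 2 + (z ^ 2 + G ^ 2 / α) := by
      rw [hZ]
      have : q * β * u ^ 2 ≤ 8 * α ^ 2 * u ^ 2 := by gcongr
      nlinarith
    have h2 := mul_le_mul_of_nonneg_left h1 hr0
    have h3 : 0 ≤ z ^ 2 + G ^ 2 / α := by positivity
    have h4 : r * (z ^ 2 + G ^ 2 / α) ≤ 1 * (z ^ 2 + G ^ 2 / α) := by gcongr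
    calc _ ≤ _ := h2
      _ = 13 * α ^ 2 * (r * u ^ 2) + r * (z ^ 2 + G ^ 2 / α) := by ring
      _ ≤ _ := by rw [one_div_mul_eq_div]; linarith
  have hk : 0 < w * K / s := by positivity
  have key2 := mul_le_mul_of_nonneg_left key hk.le
  refine le_trans (le_of_eq ?_) (key2.trans (le_of_eq ?_))
  · rw [hG, hv]; field_simp
  · rw [hG, hv]; field_simp

end
end ParabolicExtension

/-! ### Integrated interior estimates, up to boundary terms -/

namespace ParabolicExtension

noncomputable section

/-- The parameters of the Carleman inequality: the exponents, the large parameter `α` and a lower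
bound `c` for `|X|²` on the support. -/
structure CarlemanParams (n : ℕ) where
  /-- the exponent of the weight `y ^ a` -/
  a : ℝ
  /-- the exponent in the exponential weight -/
  ε : ℝ
  /-- the large parameter -/
  α : ℝ
  /-- a lower bound for `|X|²` on the support -/
  c : ℝ
  a_eq : a = 1 - 4 * ε
  ε_pos : 0 < ε
  ε_lt : ε < 1 / 2
  le_α : n + 1 + a + 2 ≤ α
  c_pos : 0 < c

namespace CarlemanParams

variable {n : ℕ} (C : CarlemanParams n)

/-- The homogeneous dimension. -/
def dim : ℝ := n + 1 + C.a

theorem neg_one_lt_a : -1 < C.a := by linarith [C.a_eq, C.ε_lt]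

theorem a_lt_one : C.a < 1 := by linarith [C.a_eq, C.ε_pos]

theorem dim_pos : 0 < C.dim := by
  have := C.neg_one_lt_a
  have : (0 : ℝ) ≤ n := n.cast_nonneg
  unfold dim; linarith

theorem dim_add_two_le : C.dim + 2 ≤ C.α := C.le_α

theorem one_le_α : 1 ≤ C.α := by linarith [C.dim_pos, C.dim_add_two_le]

theorem α_pos : 0 < C.α := by linarith [C.one_le_α]

/-- The main weight. -/
def wK : RadialWeight := .extend C.c C.c_pos (carlemanFn C.α C.ε) contDiffOn_carlemanFn

/-- The main weight times the logarithmic derivative. -/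
def wm : RadialWeight := .extend C.c C.c_pos
  (fun s => carlemanFn C.α C.ε s * betaFn C.dim C.α C.ε s)
  (contDiffOn_carlemanFn.mul contDiffOn_betaFn)

/-- The weight of the time derivative. -/
def wt : RadialWeight := .extend C.c C.c_pos (timeFn C.α C.ε)
  (contDiffOn_timeFn C.α_pos.ne' C.ε_pos C.ε_lt)

/-- The weight removing the radial cross term. -/
def wc : RadialWeight := .extend C.c C.c_pos (crossFn C.dim C.α C.ε) contDiffOn_crossFn

/-- The weight removing the cross term in time. -/
def wd : RadialWeight := .extend C.c C.c_pos
  (fun s => timeFn' C.α C.ε s * betaFn C.dim C.α C.ε s / 2)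
  (((contDiffOn_timeFn' C.α_pos.ne' C.ε_pos C.ε_lt).mul contDiffOn_betaFn).div_const 2)

/-- The weight of the gradient. -/
def wg : RadialWeight := .extend C.c C.c_pos (gradFn C.α C.ε) contDiffOn_gradFn

/-- Half the weight of the gradient. -/
def wg' : RadialWeight := .extend C.c C.c_pos (fun s => gradFn C.α C.ε s / 2)
  (contDiffOn_gradFn.div_const 2)

/-- The weight of the conjugated radial derivative. -/
def wz : RadialWeight := .extend C.c C.c_pos (fun s => carlemanFn C.α C.ε s / s)
  (contDiffOn_carlemanFn.div contDiffOn_id fun _ hs => hs.1.ne')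

/-- The weight of the function on the left-hand side. -/
def wu : RadialWeight := .extend C.c C.c_pos
  (fun s => carlemanFn C.α C.ε s / s * s ^ (C.ε / 2))
  ((contDiffOn_carlemanFn.div contDiffOn_id fun _ hs => hs.1.ne').mul (contDiffOn_rpow _))

theorem extend_nonneg {c : ℝ} {hc : 0 < c} {φ : ℝ → ℝ} {hφ : ContDiffOn ℝ ∞ φ (Ioo 0 4)}
    (h : ∀ s, 0 ≤ s → 0 ≤ φ s) (s : ℝ) : 0 ≤ (RadialWeight.extend c hc φ hφ).fn s := by
  rw [RadialWeight.extend_fn_apply]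
  rcases le_total 0 s with hs | hs
  · exact mul_nonneg (window_nonneg c s) (h s hs)
  · rw [window, cutoff_eq_zero hc (by linarith)]; simp

theorem carlemanFn_nonneg {α ε s : ℝ} (hs : 0 ≤ s) : 0 ≤ carlemanFn α ε s := by
  unfold carlemanFn; positivity

theorem wK_nonneg (s : ℝ) : 0 ≤ C.wK.fn s := extend_nonneg (fun _ hs => carlemanFn_nonneg hs) s

theorem wz_nonneg (s : ℝ) : 0 ≤ C.wz.fn s :=
  extend_nonneg (fun _ hs => div_nonneg (carlemanFn_nonneg hs) hs) s

theorem wu_nonneg (s : ℝ) : 0 ≤ C.wu.fn s :=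
  extend_nonneg (fun _ hs => mul_nonneg (div_nonneg (carlemanFn_nonneg hs) hs)
    (Real.rpow_nonneg hs _)) s

theorem wg_nonneg (s : ℝ) : 0 ≤ C.wg.fn s :=
  extend_nonneg (fun _ hs => mul_nonneg (carlemanFn_nonneg hs) (Real.rpow_nonneg hs _)) s

end CarlemanParams

namespace Profile

variable {n : ℕ} {C : CarlemanParams n} {ρ Y : ℝ} (p : Profile n C.a ρ Y)

/-- The right-hand side `div (y ^ a ∇ u) + y ^ a u_t`. -/
def source (q : ThinPt n) (y : ℝ) : ℝ :=
  p.f q y + y ^ C.a * p.lap q y + y ^ C.a * p.ut q y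

/-- The profile vanishes unless `c ≤ |X|² ≤ 1`. -/
def SupportedIn : Prop := ∀ q y, 0 ≤ y → (radSq q y < C.c ∨ 1 < radSq q y) →
  p.u q y = 0 ∧ p.P q y = 0 ∧ p.ut q y = 0 ∧ ∀ i, p.ui i q y = 0

/-- The conjugated radial derivative. -/
def conj (q : ThinPt n) (y : ℝ) : ℝ :=
  p.euler q y + betaFn C.dim C.α C.ε (radSq q y) * p.u q y

theorem bdd_conj : BoxBounded ρ Y p.conj :=
  (p.bdd_euler C.a_lt_one).add ((BoxBounded.radial (continuous_const.add (continuous_const.mul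
    (continuous_const.mul (Real.continuous_rpow_const (by linarith [C.ε_pos])))))).mul p.bdd_u)

/-- The density of the left-hand side of the Carleman inequality. -/
def massDensity (q : ThinPt n) (y : ℝ) : ℝ := y ^ C.a * (C.wu.fn (radSq q y) * p.u q y ^ 2)

/-- The density of the conjugated radial derivative. -/
def conjDensity (q : ThinPt n) (y : ℝ) : ℝ := y ^ C.a * (C.wz.fn (radSq q y) * p.conj q y ^ 2)

/-- The weighted energy density. -/
def gradDensity (q : ThinPt n) (y : ℝ) : ℝ := C.wg.fn (radSq q y) * p.density q y

/-- The density of the right-hand side of the Carleman inequality. -/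
def sourceDensity (q : ThinPt n) (y : ℝ) : ℝ :=
  y ^ (-C.a) * (C.wK.fn (radSq q y) * radSq q y * p.source q y ^ 2)

/-- The weighted mass of the trace. -/
def traceMass : ℝ := ∫ q in Metric.closedBall 0 ρ, C.wK.fn (radSq q 0) * p.u q 0 ^ 2

theorem integrable_massDensity :
    Integrable (fun z : ThinPt n × ℝ => p.massDensity z.1 z.2) (boxMeasure n ρ Y) :=
  ((BoxBounded.radial C.wu.continuous_fn).mul (p.bdd_u.pow 2)).integrable_mul
    (integrable_rpow_height C.neg_one_lt_a)

theorem integrable_conjDensity :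
    Integrable (fun z : ThinPt n × ℝ => p.conjDensity z.1 z.2) (boxMeasure n ρ Y) :=
  ((BoxBounded.radial C.wz.continuous_fn).mul (p.bdd_conj.pow 2)).integrable_mul
    (integrable_rpow_height C.neg_one_lt_a)

theorem integrable_gradDensity :
    Integrable (fun z : ThinPt n × ℝ => p.gradDensity z.1 z.2) (boxMeasure n ρ Y) := by
  have bK := BoxBounded.radial (n := n) (ρ := ρ) (Y := Y) C.wg.continuous_fn
  refine (integrable_height_mul C.neg_one_lt_a C.a_lt_one (bK.mul (p.bdd_P.pow 2))
    (bK.mul p.bdd_gradSq)).congr (Filter.Eventually.of_forall fun z => ?_)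
  simp only [gradDensity, density]; ring

theorem aestronglyMeasurable_source :
    AEStronglyMeasurable (fun z : ThinPt n × ℝ => p.source z.1 z.2) (boxMeasure n ρ Y) := by
  have h1 := p.int_f.aestronglyMeasurable
  have h2 := p.bdd_lap.1
  have h3 := p.bdd_ut.1
  have h4 : Measurable fun z : ThinPt n × ℝ => z.2 ^ C.a := by fun_prop
  exact (h1.add (h4.mul h2).aestronglyMeasurable).add (h4.mul h3).aestronglyMeasurable

theorem aestronglyMeasurable_sourceDensity :
    AEStronglyMeasurable (fun z : ThinPt n × ℝ => p.sourceDensity z.1 z.2)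
      (boxMeasure n ρ Y) := by
  have h4 : Measurable fun z : ThinPt n × ℝ => z.2 ^ (-C.a) := by fun_prop
  have h5 := (C.wK.continuous_fn.comp (continuous_radSq (n := n))).mul continuous_radSq
  exact h4.aestronglyMeasurable.mul (h5.aestronglyMeasurable.mul
    (p.aestronglyMeasurable_source.pow 2))

variable {p}

/-- Where `c ≤ |X|² ≤ 1` the truncated weights are the true ones and the claim is
`carleman_pointwise`; elsewhere the profile vanishes and only the nonnegative source term remains.
The extra factor `ε` in front of the mass comes from `ρ = ε s^(ε/2)`. -/
theorem SupportedIn.energyIntegrand_le (hp : p.SupportedIn) {q : ThinPt n} {y : ℝ} (hy : 0 < y) :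
    p.energyIntegrand C.wK C.wm C.wt C.wc C.wd q y ≤
      1 / (2 * C.α) * p.sourceDensity q y - p.conjDensity q y -
        C.α ^ 2 * C.ε ^ 2 / 2 * p.massDensity q y := by
  have hrw := rpow_height_relations hy C.a
  by_cases hs : C.c ≤ radSq q y ∧ radSq q y ≤ 1
  · obtain ⟨hc, h1⟩ := hs
    set s := radSq q y with hsd
    have hs0 : 0 < s := lt_of_lt_of_le C.c_pos hc
    have hρ0 : 0 ≤ rhoFn C.ε s := mul_nonneg C.ε_pos.le (Real.rpow_nonneg hs0.le _)
    have hsε : s ^ (C.ε / 2) ≤ 1 := Real.rpow_le_one hs0.le h1 (by linarith [C.ε_pos])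
    have hρ : rhoFn C.ε s ≤ 1 / 2 := by
      unfold rhoFn; nlinarith [C.ε_pos, C.ε_lt]
    have hfin : p.f q y + y ^ C.a * p.lap q y = p.source q y - y ^ C.a * p.ut q y := by
      simp only [source]; ring
    have key := carleman_pointwise (D := C.dim) (Z := p.euler q y) (u := p.u q y) (ut := p.ut q y)
      (g := p.source q y) C.one_le_α C.ε_pos C.ε_lt hρ0 hρ hs0 (carlemanFn_pos (α := C.α)
      (ε := C.ε) hs0) (Real.rpow_pos_of_pos hy C.a) hrw.2.2 (β := betaFn C.dim C.α C.ε s) rfl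
      (T := timeFn' C.α C.ε s) rfl (C := crossFn C.dim C.α C.ε s) rfl
    have hne : 1 - rhoFn C.ε s ≠ 0 := by linarith
    have eK : C.wK.fn s = carlemanFn C.α C.ε s := RadialWeight.extend_fn hc h1
    have eK' : C.wK.dfn s = _ := RadialWeight.extend_dfn hc h1
      (hasDerivAt_carlemanFn (D := C.dim) hs0)
    have em : C.wm.fn s = _ := RadialWeight.extend_fn hc h1
    have em' : C.wm.dfn s = _ := RadialWeight.extend_dfn hc h1 (hasDerivAt_mul_betaFn hs0)
    have et : C.wt.fn s = _ := RadialWeight.extend_fn hc h1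
    have et' : C.wt.dfn s = _ := RadialWeight.extend_dfn hc h1
      (hasDerivAt_timeFn hs0 C.α_pos.ne' hne)
    have ec : C.wc.fn s = _ := RadialWeight.extend_fn hc h1
    have ec' : C.wc.dfn s = _ := RadialWeight.extend_dfn hc h1 (hasDerivAt_crossFn hs0)
    have ed : C.wd.fn s = _ := RadialWeight.extend_fn hc h1
    have ez : C.wz.fn s = _ := RadialWeight.extend_fn hc h1
    have eu : C.wu.fn s = _ := RadialWeight.extend_fn hc h1
    -- This is the equation defining `β`: the coefficient of the energy density vanishes
    -- identically.
    have hdens : ((n : ℝ) - 1 + C.a) / 2 * carlemanFn C.α C.ε s + s / 2 *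
        (carlemanFn C.α C.ε s / s * (2 * betaFn C.dim C.α C.ε s + 2 - C.dim)) -
        carlemanFn C.α C.ε s * betaFn C.dim C.α C.ε s = 0 := by
      rw [show C.dim = n + 1 + C.a from rfl]; field_simp; ring
    have hsc : ∀ t : ℝ, s * (t / s) = t := fun t => by field_simp
    simp only [energyIntegrand, sourceDensity, conjDensity, massDensity, conj, multiplier, hfin,
      ← hsd, eK, eK', em, em', et, et', ec, ec', ed, ez, eu, hdens, hsc]
    refine le_trans (le_of_eq ?_) (key.trans (le_of_eq ?_))
    · rw [show ((n : ℝ) + 1 + C.a) = C.dim from rfl, timeFn]; ring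
    · rw [rhoFn]; ring
  · have hz := hp q y hy.le (by by_contra! h; exact hs h)
    obtain ⟨h1, h2, h3, h4⟩ := hz
    have e0 : p.euler q y = 0 := by simp [euler, h2, h4]
    have e1 : p.density q y = 0 := by simp [density, gradSq, h2, h4]
    have e2 : 0 ≤ p.sourceDensity q y := by
      unfold sourceDensity
      have := C.wK_nonneg (radSq q y)
      have : 0 ≤ radSq q y := by unfold radSq; positivity
      positivity
    have e3 := C.α_pos
    have e4 : 0 ≤ 1 / (2 * C.α) * p.sourceDensity q y := by positivity
    simpa [energyIntegrand, multiplier, conjDensity, massDensity, conj, e0, e1, h1, h3] using e4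

/-- The multiplier is now `wg u`, so the energy density appears with coefficient `wg`. The time
weight `wg / 2` cancels the product `u u_t` that arises on replacing `f + y^a lap` by the source
minus `y^a u_t`. -/
theorem SupportedIn.gradDensity_le (hp : p.SupportedIn) {q : ThinPt n} {y : ℝ} (hy : 0 < y) :
    p.gradDensity q y ≤ p.energyIntegrand .zero C.wg .zero .zero C.wg' q y +
      (13 * C.α ^ 2 * p.massDensity q y + p.conjDensity q y + 1 / C.α * p.sourceDensity q y) := by
  have hrw := rpow_height_relations hy C.a
  by_cases hs : C.c ≤ radSq q y ∧ radSq q y ≤ 1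
  · obtain ⟨hc, h1⟩ := hs
    set s := radSq q y with hsd
    have hs0 : 0 < s := lt_of_lt_of_le C.c_pos hc
    have hsε : s ^ (C.ε / 2) ≤ 1 := Real.rpow_le_one hs0.le h1 (by linarith [C.ε_pos])
    have hfin : p.f q y + y ^ C.a * p.lap q y = p.source q y - y ^ C.a * p.ut q y := by
      simp only [source]; ring
    have key := gradient_pointwise (D := C.dim) (Z := p.euler q y) (u := p.u q y)
      (g := p.source q y) C.one_le_α C.ε_pos C.ε_lt (Real.rpow_nonneg hs0.le (C.ε / 2)) hsε hs0
      (carlemanFn_pos (α := C.α) (ε := C.ε) hs0) (Real.rpow_pos_of_pos hy C.a) hrw.2.2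
      (β := betaFn C.dim C.α C.ε s) rfl C.dim_pos C.dim_add_two_le
    have eK : C.wK.fn s = carlemanFn C.α C.ε s := RadialWeight.extend_fn hc h1
    have eg : C.wg.fn s = _ := RadialWeight.extend_fn hc h1
    have eg' : C.wg.dfn s = _ := RadialWeight.extend_dfn hc h1 (hasDerivAt_gradFn (D := C.dim) hs0)
    have ed : C.wg'.fn s = _ := RadialWeight.extend_fn hc h1
    have ez : C.wz.fn s = _ := RadialWeight.extend_fn hc h1
    have eu : C.wu.fn s = _ := RadialWeight.extend_fn hc h1
    simp only [energyIntegrand, gradDensity, sourceDensity, conjDensity, massDensity, conj,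
      multiplier, hfin, ← hsd, eK, eg, eg', ed, ez, eu, RadialWeight.zero, gradFn]
    linarith
  · have hz := hp q y hy.le (by by_contra! h; exact hs h)
    obtain ⟨h1, h2, h3, h4⟩ := hz
    have e0 : p.euler q y = 0 := by simp [euler, h2, h4]
    have e1 : p.density q y = 0 := by simp [density, gradSq, h2, h4]
    have e2 : 0 ≤ p.sourceDensity q y := by
      unfold sourceDensity
      have := C.wK_nonneg (radSq q y)
      have : 0 ≤ radSq q y := by unfold radSq; positivity
      positivity
    have e3 := C.α_pos
    have e4 : 0 ≤ 1 / C.α * p.sourceDensity q y := by positivity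
    simpa [energyIntegrand, multiplier, conjDensity, massDensity, gradDensity, conj, e0, e1, h1, h3]
      using e4

/-- The basic energy inequality, up to the boundary term. -/
theorem SupportedIn.integral_conjDensity_le (hp : p.SupportedIn)
    (hg : Integrable (fun z : ThinPt n × ℝ => p.sourceDensity z.1 z.2) (boxMeasure n ρ Y)) :
    (∫ z, p.conjDensity z.1 z.2 ∂(boxMeasure n ρ Y)) + C.α ^ 2 * C.ε ^ 2 / 2 *
        (∫ z, p.massDensity z.1 z.2 ∂(boxMeasure n ρ Y)) ≤
      1 / (2 * C.α) * (∫ z, p.sourceDensity z.1 z.2 ∂(boxMeasure n ρ Y)) +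
        ∫ q in Metric.closedBall 0 ρ, p.multiplier C.wK C.wm C.wt q 0 * p.P q 0 := by
  have h1 := p.integral_energyIntegrand C.neg_one_lt_a C.a_lt_one C.wK C.wm C.wt C.wc C.wd
  have iG := hg.const_mul (1 / (2 * C.α))
  have iZ := p.integrable_conjDensity
  have iM := p.integrable_massDensity.const_mul (C.α ^ 2 * C.ε ^ 2 / 2)
  have h2 : ∫ z, p.energyIntegrand C.wK C.wm C.wt C.wc C.wd z.1 z.2 ∂(boxMeasure n ρ Y) ≤
      ∫ z, (1 / (2 * C.α) * p.sourceDensity z.1 z.2 - p.conjDensity z.1 z.2 -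
        C.α ^ 2 * C.ε ^ 2 / 2 * p.massDensity z.1 z.2) ∂(boxMeasure n ρ Y) := by
    refine integral_mono_ae
      (p.integrable_energyIntegrand C.neg_one_lt_a C.a_lt_one C.wK C.wm C.wt C.wc C.wd)
      ((iG.sub iZ).sub iM) ?_
    filter_upwards [ae_boxMeasure] with z hz
    exact hp.energyIntegrand_le hz.2.1
  rw [integral_sub (f := fun z => 1 / (2 * C.α) * p.sourceDensity z.1 z.2 - p.conjDensity z.1 z.2)
    (iG.sub iZ) iM, integral_sub iG iZ, integral_const_mul, integral_const_mul] at h2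
  linarith

/-- The gradient estimate, up to the boundary term. -/
theorem SupportedIn.integral_gradDensity_le (hp : p.SupportedIn)
    (hg : Integrable (fun z : ThinPt n × ℝ => p.sourceDensity z.1 z.2) (boxMeasure n ρ Y)) :
    ∫ z, p.gradDensity z.1 z.2 ∂(boxMeasure n ρ Y) ≤
      13 * C.α ^ 2 * (∫ z, p.massDensity z.1 z.2 ∂(boxMeasure n ρ Y)) +
        (∫ z, p.conjDensity z.1 z.2 ∂(boxMeasure n ρ Y)) +
        1 / C.α * (∫ z, p.sourceDensity z.1 z.2 ∂(boxMeasure n ρ Y)) -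
        ∫ q in Metric.closedBall 0 ρ, p.multiplier .zero C.wg .zero q 0 * p.P q 0 := by
  have h1 := p.integral_energyIntegrand C.neg_one_lt_a C.a_lt_one .zero C.wg .zero .zero C.wg'
  have iE := p.integrable_energyIntegrand C.neg_one_lt_a C.a_lt_one .zero C.wg .zero .zero C.wg'
  have iG := hg.const_mul (1 / C.α)
  have iZ := p.integrable_conjDensity
  have iM := p.integrable_massDensity.const_mul (13 * C.α ^ 2)
  have h2 : ∫ z, p.gradDensity z.1 z.2 ∂(boxMeasure n ρ Y) ≤
      ∫ z, (p.energyIntegrand .zero C.wg .zero .zero C.wg' z.1 z.2 +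
      (13 * C.α ^ 2 * p.massDensity z.1 z.2 + p.conjDensity z.1 z.2 +
        1 / C.α * p.sourceDensity z.1 z.2)) ∂(boxMeasure n ρ Y) := by
    refine integral_mono_ae p.integrable_gradDensity (iE.add ((iM.add iZ).add iG)) ?_
    filter_upwards [ae_boxMeasure] with z hz
    exact hp.gradDensity_le hz.2.1
  rw [integral_add (g := fun z => 13 * C.α ^ 2 * p.massDensity z.1 z.2 + p.conjDensity z.1 z.2 +
        1 / C.α * p.sourceDensity z.1 z.2) iE ((iM.add iZ).add iG),
    integral_add (f := fun z => 13 * C.α ^ 2 * p.massDensity z.1 z.2 + p.conjDensity z.1 z.2)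
      (iM.add iZ) iG, integral_add iM iZ, integral_const_mul, integral_const_mul] at h2
  linarith

end Profile

end
end ParabolicExtension

/-! ### The weighted trace inequality -/

namespace ParabolicExtension

noncomputable section

/-- A relative change of `s` by at most `1/α²` changes `s^(α+1)` by at most `exp((α+1)/α²) ≤ e²`,
because `α ≥ 1`; the exponential factor is increasing. -/
theorem carlemanFn_le_of_le {α ε s₀ s : ℝ} (hα : 1 ≤ α) (hε : 0 < ε) (hs₀ : 0 < s₀) (h0 : s₀ ≤ s)
    (h : s ≤ s₀ * (1 + 1 / α ^ 2)) :
    carlemanFn α ε s₀ ≤ Real.exp 2 * carlemanFn α ε s := by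
  have hα0 : 0 < α := by linarith
  have hs : 0 < s := by linarith
  have h1 : s ^ (α + 1) ≤ Real.exp 2 * s₀ ^ (α + 1) := by
    calc s ^ (α + 1) ≤ (s₀ * Real.exp (1 / α ^ 2)) ^ (α + 1) := by
          refine Real.rpow_le_rpow hs.le (h.trans ?_) (by linarith)
          gcongr
          linarith [Real.add_one_le_exp (1 / α ^ 2)]
      _ = s₀ ^ (α + 1) * Real.exp (1 / α ^ 2 * (α + 1)) := by
          rw [Real.mul_rpow hs₀.le (Real.exp_pos _).le, ← Real.exp_mul]
      _ ≤ s₀ ^ (α + 1) * Real.exp 2 := by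
          gcongr
          rw [one_div_mul_eq_div, div_le_iff₀ (by positivity)]
          nlinarith
      _ = _ := mul_comm _ _
  have h2 : s₀ ^ (-α - 1) ≤ Real.exp 2 * s ^ (-α - 1) := by
    rw [show -α - 1 = -(α + 1) by ring, Real.rpow_neg hs₀.le, Real.rpow_neg hs.le,
      ← div_eq_mul_inv, le_div_iff₀ (by positivity), inv_mul_le_iff₀ (by positivity)]
    linarith
  have h3 : Real.exp (2 * α * s₀ ^ (ε / 2)) ≤ Real.exp (2 * α * s ^ (ε / 2)) := by
    gcongr
  unfold carlemanFn
  calc _ ≤ (Real.exp 2 * s ^ (-α - 1)) * Real.exp (2 * α * s ^ (ε / 2)) := by gcongr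
    _ = _ := by ring

theorem BoxBounded.integrableOn_zero {n : ℕ} {ρ Y : ℝ} (hY : 0 ≤ Y) {A : ThinPt n → ℝ → ℝ}
    (hA : BoxBounded ρ Y A) : IntegrableOn (fun q => A q 0) (Metric.closedBall 0 ρ) := by
  obtain ⟨mA, K, hK⟩ := hA
  refine Integrable.of_bound (mA.comp (measurable_id.prodMk measurable_const)).aestronglyMeasurable
    K ?_
  filter_upwards [ae_restrict_mem Metric.isClosed_closedBall.measurableSet] with q hq
  exact hK q hq 0 ⟨le_rfl, hY⟩

theorem setIntegral_Ioc_le_of_le {h Y : ℝ} (hh : h ≤ Y) {F G : ℝ → ℝ}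
    (hF : ∀ y ∈ Ioc 0 h, F y ≤ G y) (hG : ∀ y ∈ Ioc 0 Y, 0 ≤ G y)
    (hFi : IntegrableOn F (Ioc 0 h)) (hGi : IntegrableOn G (Ioc 0 Y)) :
    ∫ y in Ioc 0 h, F y ≤ ∫ y in Ioc 0 Y, G y := by
  have hsub : Ioc 0 h ⊆ Ioc 0 Y := Ioc_subset_Ioc_right hh
  calc ∫ y in Ioc 0 h, F y ≤ ∫ y in Ioc 0 h, G y :=
        setIntegral_mono_on hFi (hGi.mono_set hsub) measurableSet_Ioc hF
    _ ≤ _ := setIntegral_mono_set hGi ((ae_restrict_iff' measurableSet_Ioc).2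
        (Filter.Eventually.of_forall hG)) hsub.eventuallyLE

namespace Profile

variable {n : ℕ} {C : CarlemanParams n} {ρ Y : ℝ} {p : Profile n C.a ρ Y}

theorem massDensity_nonneg (q : ThinPt n) {y : ℝ} (hy : 0 ≤ y) : 0 ≤ p.massDensity q y := by
  have := C.wu_nonneg (radSq q y)
  unfold massDensity; positivity

theorem conjDensity_nonneg (q : ThinPt n) {y : ℝ} (hy : 0 ≤ y) : 0 ≤ p.conjDensity q y := by
  have := C.wz_nonneg (radSq q y)
  unfold conjDensity; positivity

theorem gradSq_nonneg (q : ThinPt n) (y : ℝ) : 0 ≤ p.gradSq q y :=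
  Finset.sum_nonneg fun _ _ => sq_nonneg _

theorem gradDensity_nonneg (q : ThinPt n) {y : ℝ} (hy : 0 ≤ y) : 0 ≤ p.gradDensity q y := by
  have := C.wg_nonneg (radSq q y)
  have := p.gradSq_nonneg q y
  unfold gradDensity density; positivity

/-- The constant of the weighted trace inequality. -/
def traceConst (a : ℝ) : ℝ := (1 + a) * Real.exp 2 * (4 + 1 / (1 - a))

/-- The one-dimensional trace inequality is applied up to the height `|x|/α`, over which the
Carleman weight is comparable with its value at `y = 0`. The powers of `h` then yield `α^(1+a)` and
`α^(a-1)`, and the powers of `|x|` that remain are dominated by those in the mass and energy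
weights. -/
theorem SupportedIn.sq_trace_le (hp : p.SupportedIn) (hY : 1 ≤ Y) (q : ThinPt n)
    (iM : IntegrableOn (p.massDensity q) (Ioc 0 Y))
    (iG : IntegrableOn (p.gradDensity q) (Ioc 0 Y)) :
    C.wK.fn (radSq q 0) * p.u q 0 ^ 2 ≤ traceConst C.a *
      (C.α ^ (1 + C.a) * (∫ y in Ioc 0 Y, p.massDensity q y) +
        C.α ^ (C.a - 1) * ∫ y in Ioc 0 Y, p.gradDensity q y) := by
  have ha := C.neg_one_lt_a
  have ha1 := C.a_lt_one
  have hα := C.one_le_α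
  have hα0 := C.α_pos
  have ha' : 0 < 1 - C.a := by linarith
  have ha'' : 0 < 1 + C.a := by linarith
  have hM0 : 0 ≤ ∫ y in Ioc 0 Y, p.massDensity q y :=
    setIntegral_nonneg measurableSet_Ioc fun y hy => massDensity_nonneg q hy.1.le
  have hG0 : 0 ≤ ∫ y in Ioc 0 Y, p.gradDensity q y :=
    setIntegral_nonneg measurableSet_Ioc fun y hy => gradDensity_nonneg q hy.1.le
  by_cases hb : p.u q 0 = 0
  · rw [hb]
    have : 0 ≤ traceConst C.a := by unfold traceConst; positivity
    have : 0 ≤ C.α ^ (1 + C.a) * (∫ y in Ioc 0 Y, p.massDensity q y) +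
        C.α ^ (C.a - 1) * ∫ y in Ioc 0 Y, p.gradDensity q y := by positivity
    simp only [ne_eq, OfNat.ofNat_ne_zero, not_false_eq_true, zero_pow, mul_zero]
    positivity
  set s₀ := radSq q 0 with hs₀
  have hs₀c : C.c ≤ s₀ := by
    by_contra hlt; exact hb (hp q 0 le_rfl (Or.inl (not_le.1 hlt))).1
  have hs₀1 : s₀ ≤ 1 := by
    by_contra hlt; exact hb (hp q 0 le_rfl (Or.inr (not_le.1 hlt))).1
  have hs₀0 : 0 < s₀ := lt_of_lt_of_le C.c_pos hs₀c
  have hrs : ∀ y, radSq q y = s₀ + y ^ 2 := fun y => by simp [hs₀, radSq]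
  -- For `y ≤ h` one has `|X|² ≤ s₀ (1 + 1/α²)`, the range allowed in `carlemanFn_le_of_le`.
  set h := Real.sqrt s₀ / C.α with hh
  have hsq : Real.sqrt s₀ ≤ 1 := by rw [Real.sqrt_le_one]; exact hs₀1
  have hh0 : 0 < h := by positivity
  have hh1 : h ≤ Y := by
    refine le_trans ?_ hY
    rw [hh, div_le_one hα0]; linarith
  have e1 : h ^ (-1 - C.a) = C.α ^ (1 + C.a) * (s₀⁻¹ * s₀ ^ (2 * C.ε)) := by
    rw [hh, Real.div_rpow (Real.sqrt_nonneg _) hα0.le, Real.sqrt_eq_rpow, ← Real.rpow_mul hs₀0.le,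
      div_eq_mul_inv, ← Real.rpow_neg hα0.le, ← Real.rpow_neg_one s₀, ← Real.rpow_add hs₀0, mul_comm]
    congr 2 <;> rw [C.a_eq] <;> ring
  have e2 : h ^ (1 - C.a) = C.α ^ (C.a - 1) * s₀ ^ (2 * C.ε) := by
    rw [hh, Real.div_rpow (Real.sqrt_nonneg _) hα0.le, Real.sqrt_eq_rpow, ← Real.rpow_mul hs₀0.le,
      div_eq_mul_inv, ← Real.rpow_neg hα0.le, mul_comm]
    congr 2 <;> rw [C.a_eq] <;> ring
  have hcomp : ∀ y ∈ Ioc 0 h, s₀ + y ^ 2 ≤ s₀ * (1 + 1 / C.α ^ 2) := fun y hy => by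
    have h1 : y ^ 2 ≤ h ^ 2 := pow_le_pow_left₀ hy.1.le hy.2 2
    have h2 : h ^ 2 = s₀ * (1 / C.α ^ 2) := by
      rw [hh, div_pow, Real.sq_sqrt hs₀0.le]; ring
    linarith
  -- The exponent `2ε` is `(1-a)/2`. As `s₀ ≤ 1`, the power `s₀^(2ε)` is smaller than the `s^(ε/2)`
  -- present in the mass and energy weights.
  have hpow : ∀ y, s₀ ^ (2 * C.ε) ≤ (s₀ + y ^ 2) ^ (C.ε / 2) := fun y => by
    calc s₀ ^ (2 * C.ε) ≤ s₀ ^ (C.ε / 2) :=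
          Real.rpow_le_rpow_of_exponent_ge hs₀0 hs₀1 (by linarith [C.ε_pos])
      _ ≤ _ := Real.rpow_le_rpow hs₀0.le (by linarith [sq_nonneg y]) (by linarith [C.ε_pos])
  have ptM : ∀ y ∈ Ioc 0 h, C.wK.fn s₀ * (h ^ (-1 - C.a) * (y ^ C.a * p.u q y ^ 2)) ≤
      2 * Real.exp 2 * C.α ^ (1 + C.a) * p.massDensity q y := fun y hy => by
    by_cases hu : p.u q y = 0
    · rw [massDensity, hu]; simp
    have hs : C.c ≤ radSq q y ∧ radSq q y ≤ 1 := by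
      constructor <;> by_contra hlt
      · exact hu (hp q y hy.1.le (Or.inl (not_le.1 hlt))).1
      · exact hu (hp q y hy.1.le (Or.inr (not_le.1 hlt))).1
    have ew : C.wu.fn (radSq q y) = _ := RadialWeight.extend_fn hs.1 hs.2
    have eK : C.wK.fn s₀ = _ := RadialWeight.extend_fn hs₀c hs₀1
    rw [massDensity, ew, eK, e1, hrs y]
    set s := s₀ + y ^ 2 with hsd
    have hs0 : 0 < s := by positivity
    have hle : s₀ ≤ s := by linarith [sq_nonneg y]
    have k1 := carlemanFn_le_of_le (ε := C.ε) hα C.ε_pos hs₀0 hle (hcomp y hy)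
    have k2 : s₀⁻¹ ≤ 2 * s⁻¹ := by
      rw [← div_eq_mul_inv, le_div_iff₀ hs0, inv_mul_le_iff₀ hs₀0]
      have : 1 / C.α ^ 2 ≤ 1 := by
        rw [div_le_one (by positivity)]; nlinarith
      have := hcomp y hy
      nlinarith
    have k3 := hpow y
    have hcn := CarlemanParams.carlemanFn_nonneg (α := C.α) (ε := C.ε) hs0.le
    have hyp := hy.1
    calc carlemanFn C.α C.ε s₀ * (C.α ^ (1 + C.a) * (s₀⁻¹ * s₀ ^ (2 * C.ε)) *
          (y ^ C.a * p.u q y ^ 2)) ≤ (Real.exp 2 * carlemanFn C.α C.ε s) *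
          (C.α ^ (1 + C.a) * ((2 * s⁻¹) * s ^ (C.ε / 2)) * (y ^ C.a * p.u q y ^ 2)) := by
          gcongr
      _ = _ := by rw [div_eq_mul_inv]; ring
  have ptG : ∀ y ∈ Ioc 0 h, C.wK.fn s₀ * (h ^ (1 - C.a) * (y ^ (-C.a) * p.P q y ^ 2)) ≤
      Real.exp 2 * C.α ^ (C.a - 1) * p.gradDensity q y := fun y hy => by
    have hg0 := gradDensity_nonneg (p := p) q hy.1.le
    by_cases hP : p.P q y = 0
    · rw [hP]; simp only [ne_eq, OfNat.ofNat_ne_zero, not_false_eq_true, zero_pow, mul_zero]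
      positivity
    have hs : C.c ≤ radSq q y ∧ radSq q y ≤ 1 := by
      constructor <;> by_contra hlt
      · exact hP (hp q y hy.1.le (Or.inl (not_le.1 hlt))).2.1
      · exact hP (hp q y hy.1.le (Or.inr (not_le.1 hlt))).2.1
    have ew : C.wg.fn (radSq q y) = _ := RadialWeight.extend_fn hs.1 hs.2
    have eK : C.wK.fn s₀ = _ := RadialWeight.extend_fn hs₀c hs₀1
    rw [gradDensity, density, ew, eK, e2, hrs y]
    set s := s₀ + y ^ 2 with hsd
    have hs0 : 0 < s := by positivity
    have hle : s₀ ≤ s := by linarith [sq_nonneg y]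
    have k1 := carlemanFn_le_of_le (ε := C.ε) hα C.ε_pos hs₀0 hle (hcomp y hy)
    have k3 := hpow y
    have hcn := CarlemanParams.carlemanFn_nonneg (α := C.α) (ε := C.ε) hs0.le
    have hyp := hy.1
    have hgr := p.gradSq_nonneg q y
    calc carlemanFn C.α C.ε s₀ * (C.α ^ (C.a - 1) * s₀ ^ (2 * C.ε) *
          (y ^ (-C.a) * p.P q y ^ 2)) ≤ (Real.exp 2 * carlemanFn C.α C.ε s) *
          (C.α ^ (C.a - 1) * s ^ (C.ε / 2) * (y ^ (-C.a) * p.P q y ^ 2 + 0)) := by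
          rw [add_zero]; gcongr
      _ ≤ (Real.exp 2 * carlemanFn C.α C.ε s) *
          (C.α ^ (C.a - 1) * s ^ (C.ε / 2) *
            (y ^ (-C.a) * p.P q y ^ 2 + y ^ C.a * p.gradSq q y)) := by
          gcongr; positivity
      _ = _ := by rw [gradFn]; ring
  have tr := ParabolicExtension.sq_trace_le ha ha1 hh0 (p.prim_u q) (p.prim_P q).continuousOn
  have hsub : Icc 0 h ⊆ Ici (0 : ℝ) := Icc_subset_Ici_self
  have iu : IntegrableOn (fun y => y ^ C.a * p.u q y ^ 2) (Ioc 0 h) := by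
    rw [← intervalIntegrable_iff_integrableOn_Ioc_of_le hh0.le]
    refine (intervalIntegral.intervalIntegrable_rpow' ha).mul_continuousOn ?_
    rw [uIcc_of_le hh0.le]
    exact ((p.prim_u q).continuousOn.mono hsub).pow 2
  have iP : IntegrableOn (fun y => y ^ (-C.a) * p.P q y ^ 2) (Ioc 0 h) := by
    rw [← intervalIntegrable_iff_integrableOn_Ioc_of_le hh0.le]
    refine (intervalIntegral.intervalIntegrable_rpow' (by linarith)).mul_continuousOn ?_
    rw [uIcc_of_le hh0.le]
    exact ((p.prim_P q).continuousOn.mono hsub).pow 2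
  have IM := setIntegral_Ioc_le_of_le hh1 ptM (fun y hy => by
    have := massDensity_nonneg (p := p) q hy.1.le
    positivity) ((iu.const_mul _).const_mul _) (iM.const_mul _)
  have IG := setIntegral_Ioc_le_of_le hh1 ptG (fun y hy => by
    have := gradDensity_nonneg (p := p) q hy.1.le
    positivity) ((iP.const_mul _).const_mul _) (iG.const_mul _)
  rw [integral_const_mul, integral_const_mul, integral_const_mul] at IM IG
  have hK0 := C.wK_nonneg s₀
  set IM' := ∫ y in Ioc 0 Y, p.massDensity q y with hIM'
  set IG' := ∫ y in Ioc 0 Y, p.gradDensity q y with hIG'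
  calc C.wK.fn s₀ * p.u q 0 ^ 2 ≤ C.wK.fn s₀ * _ := mul_le_mul_of_nonneg_left tr hK0
    _ = (1 + C.a) * (2 * (C.wK.fn s₀ * (h ^ (-1 - C.a) * ∫ y in Ioc 0 h, y ^ C.a * p.u q y ^ 2)) +
        1 / (1 - C.a) *
          (C.wK.fn s₀ * (h ^ (1 - C.a) * ∫ y in Ioc 0 h, y ^ (-C.a) * p.P q y ^ 2))) := by ring
    _ ≤ (1 + C.a) * (2 * (2 * Real.exp 2 * C.α ^ (1 + C.a) * IM') +
        1 / (1 - C.a) * (Real.exp 2 * C.α ^ (C.a - 1) * IG')) := by gcongr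
    _ = (1 + C.a) * Real.exp 2 * (4 * (C.α ^ (1 + C.a) * IM') +
        1 / (1 - C.a) * (C.α ^ (C.a - 1) * IG')) := by ring
    _ ≤ (1 + C.a) * Real.exp 2 * ((4 + 1 / (1 - C.a)) * (C.α ^ (1 + C.a) * IM') +
        (4 + 1 / (1 - C.a)) * (C.α ^ (C.a - 1) * IG')) := by
        have : 0 < 1 / (1 - C.a) := by positivity
        gcongr <;> linarith
    _ = _ := by rw [traceConst]; ring

/-- The weighted trace inequality. -/
theorem SupportedIn.traceMass_le (hp : p.SupportedIn) (hY : 1 ≤ Y) :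
    p.traceMass ≤ traceConst C.a *
      (C.α ^ (1 + C.a) * (∫ z, p.massDensity z.1 z.2 ∂(boxMeasure n ρ Y)) +
        C.α ^ (C.a - 1) * ∫ z, p.gradDensity z.1 z.2 ∂(boxMeasure n ρ Y)) := by
  have iM := p.integrable_massDensity
  have iG := p.integrable_gradDensity
  have hL : IntegrableOn (fun q => C.wK.fn (radSq q 0) * p.u q 0 ^ 2) (Metric.closedBall 0 ρ) :=
    BoxBounded.integrableOn_zero (by linarith)
      ((BoxBounded.radial C.wK.continuous_fn).mul (p.bdd_u.pow 2))
  unfold boxMeasure at iM iG ⊢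
  rw [integral_prod _ iM, integral_prod _ iG, ← integral_const_mul, ← integral_const_mul,
    ← integral_add (iM.integral_prod_left.const_mul _) (iG.integral_prod_left.const_mul _),
    ← integral_const_mul, traceMass]
  refine integral_mono_ae hL (((iM.integral_prod_left.const_mul _).add
    (iG.integral_prod_left.const_mul _)).const_mul _) ?_
  filter_upwards [iM.prod_right_ae, iG.prod_right_ae] with q h1 h2
  exact hp.sq_trace_le hY q h1 h2

end Profile

end
end ParabolicExtension

/-! ### The boundary term on the thin space -/

namespace ParabolicExtension

noncomputable section

theorem dirX_apply_sum {n : ℕ} (L : ThinPt n →L[ℝ] ℝ) (x : EuclideanSpace ℝ (Fin n)) :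
    L (x, 0) = ∑ i, x i * L (dirX i) := by
  have h : ((x, 0) : ThinPt n) = ∑ i, x i • dirX i := by
    refine Prod.ext ?_ ?_
    · ext j
      simp [dirX, Prod.fst_sum, Finset.sum_apply, Pi.single_apply]
    · simp [dirX, Prod.snd_sum]
  rw [h, map_sum]
  simp

/-- A continuously differentiable potential with the bounds that enter the Carleman inequality. -/
structure Potential (n : ℕ) where
  /-- the potential -/
  V : ThinPt n → ℝ
  /-- the bound -/
  N : ℝ
  contDiff : ContDiff ℝ 1 V
  abs_le : ∀ q, |V q| ≤ N
  spatial_le : ∀ q x, |fderiv ℝ V q (x, 0)| ≤ N * ‖x‖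
  time_le : ∀ q, |fderiv ℝ V q (0, 1)| ≤ N

namespace Potential

variable {n : ℕ} (U : Potential n)

theorem N_nonneg : 0 ≤ U.N := (abs_nonneg _).trans (U.abs_le 0)

theorem hasTangential (e : ThinPt n) :
    HasTangential e (fun q _ => U.V q) (fun q _ => fderiv ℝ U.V q e) :=
  HasTangential.of_hasFDerivAt (D := fun q _ => fderiv ℝ U.V q)
    (fun q _ _ => (U.contDiff.differentiable one_ne_zero q).hasFDerivAt) e

theorem bdd_V {ρ Y : ℝ} : BoxBounded ρ Y (fun q _ => U.V q) :=
  BoxBounded.of_continuous (U.contDiff.continuous.comp continuous_fst)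

theorem bdd_fderiv {ρ Y : ℝ} (e : ThinPt n) : BoxBounded ρ Y (fun q _ => fderiv ℝ U.V q e) :=
  BoxBounded.of_continuous
    (((U.contDiff.continuous_fderiv one_ne_zero).clm_apply continuous_const).comp continuous_fst)

theorem sum_coord (q : ThinPt n) (x : EuclideanSpace ℝ (Fin n)) :
    ∑ i, x i * fderiv ℝ U.V q (dirX i) = fderiv ℝ U.V q (x, 0) :=
  (dirX_apply_sum _ x).symm

end Potential

namespace Profile

variable {n : ℕ} {C : CarlemanParams n} {ρ Y : ℝ} (p : Profile n C.a ρ Y) (U : Potential n)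

/-- The error in the boundary condition `P = V u`. -/
def err (q : ThinPt n) (y : ℝ) : ℝ := p.P q y - U.V q * p.u q y

/-- The spatial derivatives of the error in the boundary condition. -/
def errX (i : Fin n) (q : ThinPt n) (y : ℝ) : ℝ :=
  p.Pi i q y - fderiv ℝ U.V q (dirX i) * p.u q y - U.V q * p.ui i q y

/-- The time derivative of the error in the boundary condition. -/
def errT (q : ThinPt n) (y : ℝ) : ℝ :=
  p.Pt q y - fderiv ℝ U.V q (dirT n) * p.u q y - U.V q * p.ut q y

theorem bdd_err : BoxBounded ρ Y (p.err U) := p.bdd_P.sub (U.bdd_V.mul p.bdd_u)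

theorem bdd_errX (i : Fin n) : BoxBounded ρ Y (p.errX U i) :=
  ((p.bdd_Pi i).sub ((U.bdd_fderiv _).mul p.bdd_u)).sub (U.bdd_V.mul (p.bdd_ui i))

theorem bdd_errT : BoxBounded ρ Y (p.errT U) :=
  (p.bdd_Pt.sub ((U.bdd_fderiv _).mul p.bdd_u)).sub (U.bdd_V.mul p.bdd_ut)

theorem bdd_halfErr : BoxBounded ρ Y (fun q y => p.P q y - 1 / 2 * (U.V q * p.u q y)) :=
  p.bdd_P.sub ((BoxBounded.const (1 / 2)).mul (U.bdd_V.mul p.bdd_u))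

/-- In the derivative of `u (P - V u / 2)` the factor of `∂_i u` is `P - V u` up to the term `u ∂_i
P`. Subtracting this exact derivative from `∂_i u P` therefore moves the derivative from `u`, where
the trace mass does not control it, to the error `P - V u`, where commutator estimates do. -/
theorem tan_halfErr (i : Fin n) : HasTangential (dirX i)
    (fun q y => p.P q y - 1 / 2 * (U.V q * p.u q y))
    (fun q y => p.Pi i q y -
      1 / 2 * (fderiv ℝ U.V q (dirX i) * p.u q y + U.V q * p.ui i q y)) :=
  ((p.tan_P i).add (((U.hasTangential (dirX i)).mul (p.tan_u i)).const_mul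
    fun _ => -(1 / 2))).congr_both (fun q y => by ring) fun q y _ => by ring

theorem time_halfErr : HasTangential (dirT n)
    (fun q y => p.P q y - 1 / 2 * (U.V q * p.u q y))
    (fun q y => p.Pt q y -
      1 / 2 * (fderiv ℝ U.V q (dirT n) * p.u q y + U.V q * p.ut q y)) :=
  (p.time_P.add (((U.hasTangential (dirT n)).mul p.time_u).const_mul
    fun _ => -(1 / 2))).congr_both (fun q y => by ring) fun q y _ => by ring

/-- The commutator density on the thin space. -/
def commDensity (q : ThinPt n) : ℝ :=
  C.wK.fn (radSq q 0) * |p.u q 0| *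
    (4 * C.α * |p.err U q 0| + |∑ i, q.1 i * p.errX U i q 0| + |p.errT U q 0|)

theorem BoxBounded.abs {A : ThinPt n → ℝ → ℝ} (hA : BoxBounded ρ Y A) :
    BoxBounded ρ Y (fun q y => |A q y|) := by
  obtain ⟨mA, K, hK⟩ := hA
  exact ⟨mA.abs, K, fun q hq y hy => by rw [abs_abs]; exact hK q hq y hy⟩

theorem integrableOn_commDensity :
    IntegrableOn (p.commDensity U) (Metric.closedBall 0 ρ) := by
  have h1 := (BoxBounded.radial (n := n) (ρ := ρ) (Y := Y) C.wK.continuous_fn)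
  have h2 := BoxBounded.sum Finset.univ fun i =>
    (BoxBounded.coord (n := n) (ρ := ρ) (Y := Y) i).mul (p.bdd_errX U i)
  exact BoxBounded.integrableOn_zero p.pos_Y.le ((h1.mul (BoxBounded.abs p.bdd_u)).mul
    ((((BoxBounded.const (4 * C.α)).mul (BoxBounded.abs (p.bdd_err U))).add
      (BoxBounded.abs h2)).add (BoxBounded.abs (p.bdd_errT U))))

/-- The spatial flux of the boundary term. -/
def thinFlux (i : Fin n) (q : ThinPt n) (y : ℝ) : ℝ :=
  C.wK.fn (radSq q y) * q.1 i * (p.u q y * (p.P q y - 1 / 2 * (U.V q * p.u q y)))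

/-- The derivative of `thinFlux`. -/
def thinDiv (i : Fin n) (q : ThinPt n) (y : ℝ) : ℝ :=
  (C.wK.dfn (radSq q y) * q.1 i * q.1 i + C.wK.fn (radSq q y)) *
      (p.u q y * (p.P q y - 1 / 2 * (U.V q * p.u q y))) +
    C.wK.fn (radSq q y) * q.1 i * (p.ui i q y * (p.P q y - 1 / 2 * (U.V q * p.u q y)) +
      p.u q y * (p.Pi i q y -
        1 / 2 * (fderiv ℝ U.V q (dirX i) * p.u q y + U.V q * p.ui i q y)))

/-- The time flux of the boundary term. -/
def thinFluxT (q : ThinPt n) (y : ℝ) : ℝ :=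
  C.wt.fn (radSq q y) * (p.u q y * (p.P q y - 1 / 2 * (U.V q * p.u q y)))

/-- The derivative of `thinFluxT`. -/
def thinDivT (q : ThinPt n) (y : ℝ) : ℝ :=
  C.wt.fn (radSq q y) * (p.ut q y * (p.P q y - 1 / 2 * (U.V q * p.u q y)) +
      p.u q y * (p.Pt q y -
        1 / 2 * (fderiv ℝ U.V q (dirT n) * p.u q y + U.V q * p.ut q y)))

theorem bdd_thinDiv (i : Fin n) : BoxBounded ρ Y (p.thinDiv U i) := by
  have bK := BoxBounded.radial (n := n) (ρ := ρ) (Y := Y) C.wK.continuous_fn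
  have bK' := BoxBounded.radial (n := n) (ρ := ρ) (Y := Y) C.wK.continuous_dfn
  have bx := BoxBounded.coord (n := n) (ρ := ρ) (Y := Y) i
  exact ((((bK'.mul bx).mul bx).add bK).mul (p.bdd_u.mul (p.bdd_halfErr U))).add
    ((bK.mul bx).mul (((p.bdd_ui i).mul (p.bdd_halfErr U)).add (p.bdd_u.mul ((p.bdd_Pi i).sub
      ((BoxBounded.const (1 / 2)).mul (((U.bdd_fderiv _).mul p.bdd_u).add
        (U.bdd_V.mul (p.bdd_ui i))))))))

theorem bdd_thinDivT : BoxBounded ρ Y (p.thinDivT U) := by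
  have bK := BoxBounded.radial (n := n) (ρ := ρ) (Y := Y) C.wt.continuous_fn
  exact bK.mul ((p.bdd_ut.mul (p.bdd_halfErr U)).add (p.bdd_u.mul (p.bdd_Pt.sub
      ((BoxBounded.const (1 / 2)).mul (((U.bdd_fderiv _).mul p.bdd_u).add
        (U.bdd_V.mul p.bdd_ut))))))

theorem integral_thinDiv (i : Fin n) :
    ∫ q in Metric.closedBall 0 ρ, p.thinDiv U i q 0 = 0 := by
  have bK := BoxBounded.radial (n := n) (ρ := ρ) (Y := Y) C.wK.continuous_fn
  have bx := BoxBounded.coord (n := n) (ρ := ρ) (Y := Y) i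
  have ht : HasTangential (dirX i) (p.thinFlux U i) (p.thinDiv U i) :=
    (((C.wK.hasTangential i).mul (hasTangential_coord i i)).mul
      ((p.tan_u i).mul (p.tan_halfErr U i))).congr fun q y _ => by
        simp only [thinDiv, if_true]; ring
  have hb : BoxBounded ρ Y (p.thinFlux U i) :=
    (bK.mul bx).mul (p.bdd_u.mul (p.bdd_halfErr U))
  exact setIntegral_eq_zero_of_hasLineDerivAt p.lt_ρ (fun q => ht q 0 le_rfl)
    (fun q hq => by simp [thinFlux, p.zero_u q 0 le_rfl (Or.inl hq)])
    (hb.integrableOn_zero p.pos_Y.le) ((p.bdd_thinDiv U i).integrableOn_zero p.pos_Y.le)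

theorem integral_thinDivT : ∫ q in Metric.closedBall 0 ρ, p.thinDivT U q 0 = 0 := by
  have bK := BoxBounded.radial (n := n) (ρ := ρ) (Y := Y) C.wt.continuous_fn
  have ht : HasTangential (dirT n) (p.thinFluxT U) (p.thinDivT U) :=
    (C.wt.hasTangential_time.mul (p.time_u.mul (p.time_halfErr U))).congr fun q y _ => by
        simp only [thinDivT]; ring
  have hb : BoxBounded ρ Y (p.thinFluxT U) := bK.mul (p.bdd_u.mul (p.bdd_halfErr U))
  exact setIntegral_eq_zero_of_hasLineDerivAt p.lt_ρ (fun q => ht q 0 le_rfl)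
    (fun q hq => by simp [thinFluxT, p.zero_u q 0 le_rfl (Or.inl hq)])
    (hb.integrableOn_zero p.pos_Y.le) ((p.bdd_thinDivT U).integrableOn_zero p.pos_Y.le)

/-- The terms with `V` alone carry no power of `α`: `β` cancels, leaving the factor `(1-a)/2 ≤ 1`.
Together with the two halves from `∇_x V` and `V_t`, and `κ ≤ K`, this gives the constant `2`. Only
the error `h` in the boundary condition is multiplied by `α`. -/
theorem thin_pointwise {K κ N α β a b h V xV Vt xh ht s' : ℝ} (hK : 0 ≤ K) (hκ : 0 ≤ κ)
    (hκK : κ ≤ K) (hV : |V| ≤ N) (hxV : |xV| ≤ N) (hVt : |Vt| ≤ N) (ha : |a| < 1)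
    (hβ : |-β - 1 + a| ≤ 4 * α) (hs' : s' = -β - 1 + a) :
    K * (s' * (b * h) - (1 - a) / 2 * V * b ^ 2 - b * xh - 1 / 2 * xV * b ^ 2) -
      κ * (b * ht + 1 / 2 * Vt * b ^ 2) ≤
    2 * N * (K * b ^ 2) + K * |b| * (4 * α * |h| + |xh| + |ht|) := by
  have hN : 0 ≤ N := (abs_nonneg V).trans hV
  have hb : 0 ≤ b ^ 2 := sq_nonneg b
  have h1 : s' * (b * h) ≤ 4 * α * (|b| * |h|) := by
    calc s' * (b * h) ≤ |s' * (b * h)| := le_abs_self _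
      _ = |s'| * (|b| * |h|) := by rw [abs_mul, abs_mul]
      _ ≤ _ := by rw [hs']; gcongr
  have ha2 := abs_lt.1 ha
  have h2 : -((1 - a) / 2 * V * b ^ 2) ≤ N * b ^ 2 := by
    have : -((1 - a) / 2 * V) ≤ N := by
      have := (abs_le.1 hV).1
      nlinarith
    nlinarith
  have h3 : -(b * xh) ≤ |b| * |xh| := by rw [← abs_mul]; exact neg_le_abs _
  have h4 : -(1 / 2 * xV * b ^ 2) ≤ 1 / 2 * N * b ^ 2 := by
    have := (abs_le.1 hxV).1
    nlinarith
  have h5 : -(κ * (b * ht + 1 / 2 * Vt * b ^ 2)) ≤ K * (|b| * |ht| + 1 / 2 * N * b ^ 2) := by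
    have h6 : -(b * ht + 1 / 2 * Vt * b ^ 2) ≤ |b| * |ht| + 1 / 2 * N * b ^ 2 := by
      have e1 : -(b * ht) ≤ |b| * |ht| := by rw [← abs_mul]; exact neg_le_abs _
      have e2 := (abs_le.1 hVt).1
      nlinarith
    have h7 : 0 ≤ |b| * |ht| + 1 / 2 * N * b ^ 2 := by positivity
    nlinarith
  have h8 : K * (s' * (b * h) - (1 - a) / 2 * V * b ^ 2 - b * xh - 1 / 2 * xV * b ^ 2) ≤
      K * (4 * α * (|b| * |h|) + N * b ^ 2 + |b| * |xh| + 1 / 2 * N * b ^ 2) := by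
    apply mul_le_mul_of_nonneg_left _ hK; linarith
  nlinarith

variable {p}

/-- The multiplier times `P` is split into exact tangential derivatives, which integrate to zero,
and the quantity bounded in `thin_pointwise`. The cancellation of `β` rests on `K' s = K (2β + 2 -
D)` and `D = n + 1 + a`. -/
theorem SupportedIn.multiplier_mul_le (hp : p.SupportedIn) (q : ThinPt n) :
    p.multiplier C.wK C.wm C.wt q 0 * p.P q 0 ≤
      ∑ i, p.thinDiv U i q 0 + p.thinDivT U q 0 +
        (2 * U.N * (C.wK.fn (radSq q 0) * p.u q 0 ^ 2) + p.commDensity U q) := by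
  have ha := C.neg_one_lt_a
  have ha1 := C.a_lt_one
  have h1a : (1 - C.a) ≠ 0 := by linarith
  by_cases hs : C.c ≤ radSq q 0 ∧ radSq q 0 ≤ 1
  swap
  · obtain ⟨h1, h2, h3, h4⟩ := hp q 0 le_rfl (by by_contra! h; exact hs h)
    simp [multiplier, euler, thinDiv, thinDivT, commDensity, h1, h2, h3, h4]
  obtain ⟨hc, h1⟩ := hs
  set s := radSq q 0 with hsd
  have hs0 : 0 < s := lt_of_lt_of_le C.c_pos hc
  have hρ0 : 0 ≤ rhoFn C.ε s := mul_nonneg C.ε_pos.le (Real.rpow_nonneg hs0.le _)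
  have hsε : s ^ (C.ε / 2) ≤ 1 := Real.rpow_le_one hs0.le h1 (by linarith [C.ε_pos])
  have hρ : rhoFn C.ε s ≤ 1 / 2 := by
    unfold rhoFn; nlinarith [C.ε_pos, C.ε_lt]
  have hα := C.one_le_α
  have eK : C.wK.fn s = carlemanFn C.α C.ε s := RadialWeight.extend_fn hc h1
  have eK' : C.wK.dfn s = _ := RadialWeight.extend_dfn hc h1
      (hasDerivAt_carlemanFn (D := C.dim) hs0)
  have em : C.wm.fn s = _ := RadialWeight.extend_fn hc h1
  have et : C.wt.fn s = _ := RadialWeight.extend_fn hc h1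
  have hsum2 : ∑ i, q.1 i ^ 2 = s := by rw [hsd, radSq_eq_sum]; simp
  have hxn : ‖q.1‖ ≤ 1 := by
    have : ‖q.1‖ ^ 2 = s := by simp [hsd, radSq]
    nlinarith [norm_nonneg q.1]
  set K := carlemanFn C.α C.ε s with hKd
  have hK0 : 0 ≤ K := CarlemanParams.carlemanFn_nonneg hs0.le
  set κ := timeFn C.α C.ε s with hκd
  have hden : 0 < 2 * C.α * (1 - rhoFn C.ε s) := by
    have : 0 < 1 - rhoFn C.ε s := by linarith
    have := C.α_pos
    positivity
  have hκ0 : 0 ≤ κ := by rw [hκd, timeFn]; positivity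
  have hκK : κ ≤ K := by
    rw [hκd, timeFn, div_le_iff₀ hden, ← hKd]
    have : s ≤ 2 * C.α * (1 - rhoFn C.ε s) := by nlinarith
    exact mul_le_mul_of_nonneg_left this hK0
  set β := betaFn C.dim C.α C.ε s with hβd
  have hβ : |-β - 1 + C.a| ≤ 4 * C.α := by
    have := C.dim_add_two_le
    have := C.dim_pos
    have e : β = -C.α - 2 + C.dim / 2 + C.α * rhoFn C.ε s := rfl
    rw [abs_le, e]
    constructor <;> nlinarith
  have hxV : |fderiv ℝ U.V q (q.1, 0)| ≤ U.N := (U.spatial_le q q.1).trans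
    (mul_le_of_le_one_right U.N_nonneg hxn)
  have key := thin_pointwise (b := p.u q 0) (h := p.err U q 0)
    (xh := ∑ i, q.1 i * p.errX U i q 0) (ht := p.errT U q 0) hK0 hκ0 hκK (U.abs_le q) hxV
    (U.time_le q) (abs_lt.2 ⟨by linarith, ha1⟩) hβ rfl
  have exh : ∑ i, q.1 i * p.errX U i q 0 = ∑ i, q.1 i * p.Pi i q 0 -
      fderiv ℝ U.V q (q.1, 0) * p.u q 0 - U.V q * ∑ i, q.1 i * p.ui i q 0 := by
    rw [← U.sum_coord q q.1, Finset.mul_sum, Finset.sum_mul, ← Finset.sum_sub_distrib,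
      ← Finset.sum_sub_distrib]
    exact Finset.sum_congr rfl fun i _ => by simp only [errX]; ring
  have ediv : ∑ i, p.thinDiv U i q 0 =
      (C.wK.dfn s * s + n * K) * (p.u q 0 * (p.P q 0 - 1 / 2 * (U.V q * p.u q 0))) +
      K * ((∑ i, q.1 i * p.ui i q 0) * (p.P q 0 - U.V q * p.u q 0) +
        p.u q 0 * (∑ i, q.1 i * p.Pi i q 0 -
          1 / 2 * (fderiv ℝ U.V q (q.1, 0) * p.u q 0))) := by
    have hi : ∀ i, p.thinDiv U i q 0 =
        C.wK.dfn s * (p.u q 0 * (p.P q 0 - 1 / 2 * (U.V q * p.u q 0))) * q.1 i ^ 2 +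
        K * (p.u q 0 * (p.P q 0 - 1 / 2 * (U.V q * p.u q 0))) +
        K * (p.P q 0 - U.V q * p.u q 0) * (q.1 i * p.ui i q 0) +
        K * p.u q 0 * (q.1 i * p.Pi i q 0) -
        K * p.u q 0 * (1 / 2 * p.u q 0) * (q.1 i * fderiv ℝ U.V q (dirX i)) := fun i => by
      simp only [thinDiv, ← hsd, eK]; ring
    simp only [hi, Finset.sum_add_distrib, Finset.sum_sub_distrib, ← Finset.mul_sum, hsum2,
      U.sum_coord, Finset.sum_const, Finset.card_univ, Fintype.card_fin, nsmul_eq_mul]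
    ring
  have hKs : C.wK.dfn s * s = K * (2 * β + 2 - C.dim) := by
    rw [eK']; field_simp
  rw [ediv, hKs]
  simp only [commDensity, ← hsd, eK]
  have hM : p.multiplier C.wK C.wm C.wt q 0 = K * (∑ i, q.1 i * p.ui i q 0) +
      K * β * p.u q 0 + κ * p.ut q 0 := by
    simp [multiplier, euler, ← hsd, eK, em, et, Real.zero_rpow h1a, hKd, hβd, hκd]
  rw [hM]
  have edim : C.dim = n + 1 + C.a := rfl
  rw [edim]
  simp only [thinDivT, ← hsd, et]
  refine le_trans (le_of_eq ?_) (add_le_add_right key _)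
  rw [exh]
  simp only [err, errT, dirT]
  ring

theorem SupportedIn.integral_multiplier_le (hp : p.SupportedIn) :
    ∫ q in Metric.closedBall 0 ρ, p.multiplier C.wK C.wm C.wt q 0 * p.P q 0 ≤
      2 * U.N * p.traceMass + ∫ q in Metric.closedBall 0 ρ, p.commDensity U q := by
  have h0 := p.pos_Y.le
  have i1 := integrable_finsetSum Finset.univ fun i (_ : i ∈ Finset.univ) =>
    (p.bdd_thinDiv U i).integrableOn_zero h0
  have i2 := (p.bdd_thinDivT U).integrableOn_zero h0
  have i3 := (((BoxBounded.radial C.wK.continuous_fn).mul (p.bdd_u.pow 2)).integrableOn_zero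
    h0).const_mul (2 * U.N)
  have i4 := p.integrableOn_commDensity U
  have i12 : IntegrableOn (fun q => ∑ i, p.thinDiv U i q 0 + p.thinDivT U q 0)
    (Metric.closedBall 0 ρ) := i1.add i2
  have i34 : IntegrableOn (fun q => 2 * U.N * (C.wK.fn (radSq q 0) * p.u q 0 ^ 2) +
    p.commDensity U q) (Metric.closedBall 0 ρ) := i3.add i4
  have h1 := integral_mono (((p.bdd_multiplier C.a_lt_one C.wK C.wm C.wt).mul
    p.bdd_P).integrableOn_zero h0) (i12.add i34)
    (fun q => hp.multiplier_mul_le U q)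
  refine h1.trans (le_of_eq ?_)
  simp only [Pi.add_apply]
  rw [integral_add i12 i34, integral_add i1 i2, integral_add i3 i4, integral_const_mul,
    integral_finsetSum _ fun i _ => (p.bdd_thinDiv U i).integrableOn_zero h0,
    p.integral_thinDivT U]
  simp [p.integral_thinDiv U, traceMass]

/-- No integration by parts is needed: the multiplier contains no derivative of `u`, and `P = V u`
up to the error. The additional weight `s^(ε/2)` is at most one. -/
theorem SupportedIn.neg_multiplier_mul_le (hp : p.SupportedIn) (q : ThinPt n) :
    -(p.multiplier .zero C.wg .zero q 0 * p.P q 0) ≤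
      2 * U.N * (C.wK.fn (radSq q 0) * p.u q 0 ^ 2) + p.commDensity U q := by
  by_cases hs : C.c ≤ radSq q 0 ∧ radSq q 0 ≤ 1
  swap
  · obtain ⟨h1, h2, h3, h4⟩ := hp q 0 le_rfl (by by_contra! h; exact hs h)
    simp [multiplier, commDensity, h1, h2, RadialWeight.zero]
  obtain ⟨hc, h1⟩ := hs
  set s := radSq q 0 with hsd
  have hs0 : 0 < s := lt_of_lt_of_le C.c_pos hc
  have hsε : s ^ (C.ε / 2) ≤ 1 := Real.rpow_le_one hs0.le h1 (by linarith [C.ε_pos])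
  have hsε0 : 0 ≤ s ^ (C.ε / 2) := Real.rpow_nonneg hs0.le _
  have hα := C.one_le_α
  have eK : C.wK.fn s = carlemanFn C.α C.ε s := RadialWeight.extend_fn hc h1
  have eg : C.wg.fn s = gradFn C.α C.ε s := RadialWeight.extend_fn hc h1
  have hK0 : 0 ≤ carlemanFn C.α C.ε s := CarlemanParams.carlemanFn_nonneg hs0.le
  simp only [commDensity, multiplier, RadialWeight.zero, ← hsd, eK, eg, gradFn]
  have eP : p.P q 0 = p.err U q 0 + U.V q * p.u q 0 := by simp [err]
  rw [eP]
  set K := carlemanFn C.α C.ε s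
  set b := p.u q 0
  set h := p.err U q 0
  set r := s ^ (C.ε / 2)
  have e1 : -(b * (h + U.V q * b)) ≤ |b| * |h| + U.N * b ^ 2 := by
    have e2 : -(b * h) ≤ |b| * |h| := by rw [← abs_mul]; exact neg_le_abs _
    have e3 := (abs_le.1 (U.abs_le q)).1
    nlinarith [sq_nonneg b]
  have e4 : 0 ≤ |b| * |h| + U.N * b ^ 2 := by have := U.N_nonneg; positivity
  have e5 : r * -(b * (h + U.V q * b)) ≤ |b| * |h| + U.N * b ^ 2 := by nlinarith
  have e6 := mul_le_mul_of_nonneg_left e5 hK0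
  have e7 : K * (|b| * |h|) ≤ K * |b| * (4 * C.α * |h|) := by
    have : |h| ≤ 4 * C.α * |h| := le_mul_of_one_le_left (abs_nonneg h) (by linarith)
    calc K * (|b| * |h|) = K * |b| * |h| := by ring
      _ ≤ _ := by gcongr
  have e8 : 0 ≤ K * |b| * (|∑ i, q.1 i * p.errX U i q 0| + |p.errT U q 0|) := by positivity
  have e9 : 0 ≤ U.N * (K * b ^ 2) := by have := U.N_nonneg; positivity
  nlinarith

theorem SupportedIn.neg_integral_multiplier_le (hp : p.SupportedIn) :
    -∫ q in Metric.closedBall 0 ρ, p.multiplier .zero C.wg .zero q 0 * p.P q 0 ≤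
      2 * U.N * p.traceMass + ∫ q in Metric.closedBall 0 ρ, p.commDensity U q := by
  have h0 := p.pos_Y.le
  have i3 := (((BoxBounded.radial C.wK.continuous_fn).mul (p.bdd_u.pow 2)).integrableOn_zero
    h0).const_mul (2 * U.N)
  have i4 := p.integrableOn_commDensity U
  have h1 := integral_mono (((p.bdd_multiplier C.a_lt_one .zero C.wg .zero).mul
    p.bdd_P).integrableOn_zero h0).neg (i3.add i4) (fun q => hp.neg_multiplier_mul_le U q)
  simp only [Pi.add_apply, Pi.neg_apply] at h1
  rw [integral_neg, integral_add i3 i4, integral_const_mul] at h1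
  exact h1

end Profile

end
end ParabolicExtension

/-! ### Absorption of the boundary term: the Carleman inequality for profiles -/

namespace ParabolicExtension

noncomputable section

namespace Profile

variable {n : ℕ} {C : CarlemanParams n} {ρ Y : ℝ} {p : Profile n C.a ρ Y}

theorem traceMass_nonneg : 0 ≤ p.traceMass :=
  integral_nonneg fun _ => mul_nonneg (C.wK_nonneg _) (sq_nonneg _)

/-- The Carleman inequality for a profile whose boundary commutator is controlled by its trace. -/
theorem SupportedIn.carleman_le (hp : p.SupportedIn) (hY : 1 ≤ Y)
    (hg : Integrable (fun z : ThinPt n × ℝ => p.sourceDensity z.1 z.2) (boxMeasure n ρ Y))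
    (U : Potential n) {c₀ l : ℝ} (hc₀ : 0 ≤ c₀)
    (hcomm : ∫ q in Metric.closedBall 0 ρ, p.commDensity U q ≤ c₀ * U.N * p.traceMass)
    (hN : U.N ≤ l * C.α ^ (1 - C.a))
    (hl : (2 + c₀) * traceConst C.a * l ≤ C.ε ^ 2 / 112) :
    C.α ^ 3 * ∫ z, p.massDensity z.1 z.2 ∂(boxMeasure n ρ Y) ≤
      4 / C.ε ^ 2 * ∫ z, p.sourceDensity z.1 z.2 ∂(boxMeasure n ρ Y) := by
  have h1 := hp.integral_conjDensity_le hg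
  have h2 := hp.integral_gradDensity_le hg
  have h3 := hp.traceMass_le hY
  have h4 := hp.integral_multiplier_le U
  have h5 := hp.neg_integral_multiplier_le U
  have hα := C.α_pos
  have hε := C.ε_pos
  have hε2 := C.ε_lt
  have nonneg : ∀ {F : ThinPt n → ℝ → ℝ}, (∀ q y, 0 ≤ y → 0 ≤ F q y) →
      0 ≤ ∫ z, F z.1 z.2 ∂(boxMeasure n ρ Y) := fun {F} hF => by
    refine integral_nonneg_of_ae ?_
    filter_upwards [ae_boxMeasure] with z hz
    exact hF _ _ hz.2.1.le
  have hM := nonneg fun q y hy => p.massDensity_nonneg q hy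
  have hZ := nonneg fun q y hy => p.conjDensity_nonneg q hy
  have hE := nonneg fun q y hy => p.gradDensity_nonneg q hy
  have hS := nonneg (F := p.sourceDensity) fun q y hy => by
    unfold sourceDensity
    have := C.wK_nonneg (radSq q y)
    have : 0 ≤ radSq q y := by unfold radSq; positivity
    positivity
  set M := ∫ z, p.massDensity z.1 z.2 ∂(boxMeasure n ρ Y)
  set Z := ∫ z, p.conjDensity z.1 z.2 ∂(boxMeasure n ρ Y)
  set E := ∫ z, p.gradDensity z.1 z.2 ∂(boxMeasure n ρ Y)
  set G := ∫ z, p.sourceDensity z.1 z.2 ∂(boxMeasure n ρ Y)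
  set T := p.traceMass
  have hT : 0 ≤ T := traceMass_nonneg
  have hτ : 0 ≤ traceConst C.a := by
    have := C.neg_one_lt_a
    have := C.a_lt_one
    have h6 : 0 < 1 - C.a := by linarith
    have h7 : 0 < 1 + C.a := by linarith
    unfold traceConst; positivity
  have hN0 := U.N_nonneg
  -- The size `l α^(1-a)` of the potential turns the two powers in the trace inequality into `α²`
  -- and `1`, the powers with which mass and energy can be absorbed.
  have e1 : U.N * C.α ^ (1 + C.a) ≤ l * C.α ^ 2 := by
    calc U.N * C.α ^ (1 + C.a) ≤ l * C.α ^ (1 - C.a) * C.α ^ (1 + C.a) := by gcongr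
      _ = l * C.α ^ 2 := by
        rw [mul_assoc, ← Real.rpow_add hα, ← Real.rpow_natCast]; norm_num
  have e2 : U.N * C.α ^ (C.a - 1) ≤ l := by
    calc U.N * C.α ^ (C.a - 1) ≤ l * C.α ^ (1 - C.a) * C.α ^ (C.a - 1) := by gcongr
      _ = l := by rw [mul_assoc, ← Real.rpow_add hα]; simp
  have hNT : U.N * T ≤ traceConst C.a * (l * (C.α ^ 2 * M + E)) := by
    calc U.N * T ≤ U.N * (traceConst C.a * (C.α ^ (1 + C.a) * M + C.α ^ (C.a - 1) * E)) := by
          gcongr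
      _ = traceConst C.a * (U.N * C.α ^ (1 + C.a) * M + U.N * C.α ^ (C.a - 1) * E) := by ring
      _ ≤ traceConst C.a * (l * C.α ^ 2 * M + l * E) := by gcongr
      _ = _ := by ring
  have hB : (2 + c₀) * (U.N * T) ≤ C.ε ^ 2 / 112 * (C.α ^ 2 * M + E) := by
    calc (2 + c₀) * (U.N * T) ≤ (2 + c₀) * (traceConst C.a * (l * (C.α ^ 2 * M + E))) := by gcongr
      _ = (2 + c₀) * traceConst C.a * l * (C.α ^ 2 * M + E) := by ring
      _ ≤ _ := by gcongr
  have hαM : 0 ≤ C.α ^ 2 * M := by positivity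
  have hGα : 0 ≤ G / C.α := by positivity
  have f1 : 1 / (2 * C.α) * G = G / C.α / 2 := by field_simp
  have f2 : 1 / C.α * G = G / C.α := by field_simp
  rw [f1] at h1
  rw [f2] at h2
  have hε3 : C.ε ^ 2 ≤ 1 / 4 := by nlinarith
  set A := C.α ^ 2 * M
  have h1' : Z + C.ε ^ 2 / 2 * A ≤ G / C.α / 2 + C.ε ^ 2 / 112 * (A + E) := by
    have : C.α ^ 2 * C.ε ^ 2 / 2 * M = C.ε ^ 2 / 2 * A := by ring
    linarith
  have h2' : E ≤ 13 * A + Z + G / C.α + C.ε ^ 2 / 112 * (A + E) := by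
    have : 13 * C.α ^ 2 * M = 13 * A := by ring
    linarith
  have h6 : C.ε ^ 2 / 112 * (A + E) ≤ 1 / 4 * (A + E) := by
    have : C.ε ^ 2 / 112 ≤ 1 / 4 := by linarith
    gcongr
  have h7 : E ≤ 27 * A + 2 * Z + 2 * (G / C.α) := by linarith
  -- Since `112 = 4 · 28`, the boundary term costs `ε² A / 4`, half of the available `ε² A / 2`.
  have h8 : C.ε ^ 2 / 112 * (A + E) ≤ C.ε ^ 2 / 112 * (28 * A + 2 * Z + 2 * (G / C.α)) :=
    mul_le_mul_of_nonneg_left (by linarith) (by positivity)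
  have h9 : C.ε ^ 2 * Z ≤ 1 / 4 * Z := by gcongr
  have h10 : C.ε ^ 2 * (G / C.α) ≤ 1 / 4 * (G / C.α) := by gcongr
  have h11 : C.ε ^ 2 / 4 * A ≤ G / C.α := by linarith
  calc C.α ^ 3 * M = 4 / C.ε ^ 2 * C.α * (C.ε ^ 2 / 4 * A) := by
        simp only [A]; field_simp
    _ ≤ 4 / C.ε ^ 2 * C.α * (G / C.α) := by gcongr
    _ = _ := by field_simp

end Profile

end
end ParabolicExtension

/-! ### Convolution in the tangential variables -/

namespace ParabolicExtension

noncomputable section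

variable {n : ℕ}

/-- Smooth compactly supported kernels on the thin space. -/
structure IsKernel (κ : ThinPt n → ℝ) : Prop where
  smooth : ContDiff ℝ ∞ κ
  compact : HasCompactSupport κ

/-- The derivative of a kernel in the direction `e`. -/
def dKer (e : ThinPt n) (κ : ThinPt n → ℝ) (z : ThinPt n) : ℝ := fderiv ℝ κ z e

theorem IsKernel.dKer {κ : ThinPt n → ℝ} (h : IsKernel κ) (e : ThinPt n) :
    IsKernel (dKer e κ) :=
  ⟨(h.smooth.fderiv_right (m := ∞) le_rfl).clm_apply contDiff_const, by
    have := h.compact.fderiv (𝕜 := ℝ)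
    exact this.comp_left (g := fun L : ThinPt n →L[ℝ] ℝ => L e) (by simp)⟩

theorem IsKernel.continuous {κ : ThinPt n → ℝ} (h : IsKernel κ) : Continuous κ :=
  h.smooth.continuous

theorem IsKernel.add {κ l : ThinPt n → ℝ} (hκ : IsKernel κ) (hl : IsKernel l) :
    IsKernel (fun z => κ z + l z) :=
  ⟨hκ.smooth.add hl.smooth, hκ.compact.add hl.compact⟩

theorem IsKernel.sum {ι : Type*} (s : Finset ι) {κ : ι → ThinPt n → ℝ}
    (hκ : ∀ i, IsKernel (κ i)) : IsKernel (fun z => ∑ i ∈ s, κ i z) := by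
  classical
  induction s using Finset.induction_on with
  | empty =>
    refine ⟨by simpa using contDiff_const, ?_⟩
    simp only [Finset.sum_empty]
    exact HasCompactSupport.zero
  | insert i s hi ih =>
    simp only [Finset.sum_insert hi]
    exact (hκ i).add ih

theorem dKer_comm {κ : ThinPt n → ℝ} (h : IsKernel κ) (e e' : ThinPt n) :
    dKer e (dKer e' κ) = dKer e' (dKer e κ) := by
  funext z
  have hd : ∀ v, fderiv ℝ (dKer v κ) z = (fderiv ℝ (fderiv ℝ κ) z).flip v := fun v => by
    have h1 : DifferentiableAt ℝ (fderiv ℝ κ) z :=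
      (h.smooth.fderiv_right (m := ∞) le_rfl).differentiable (by simp) z
    refine ContinuousLinearMap.ext fun w => ?_
    have := fderiv_clm_apply h1 (differentiableAt_const v)
    unfold dKer
    rw [this]
    simp
  have hs : IsSymmSndFDerivAt ℝ κ z :=
    (h.smooth.contDiffAt).isSymmSndFDerivAt
      (by rw [minSmoothness_of_isRCLikeNormedField]; exact WithTop.coe_le_coe.2 le_top)
  unfold dKer at hd ⊢
  rw [hd, hd]
  exact hs e e'

/-- The convolution of a kernel with a function on the thin space. -/
def smear (κ A : ThinPt n → ℝ) (q : ThinPt n) : ℝ := ∫ z, κ (q - z) * A z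

theorem smear_eq_convolution (κ A : ThinPt n → ℝ) :
    smear κ A = convolution A κ (ContinuousLinearMap.mul ℝ ℝ) volume := by
  funext q
  simp [smear, convolution_def, mul_comm]

theorem IsKernel.integrable_smear {κ A : ThinPt n → ℝ} (h : IsKernel κ)
    (hA : LocallyIntegrable A) (q : ThinPt n) : Integrable (fun z => κ (q - z) * A z) := by
  have := h.compact.convolutionExists_right (ContinuousLinearMap.mul ℝ ℝ) hA h.continuous q
  simpa [ConvolutionExistsAt, mul_comm] using this

theorem IsKernel.hasFDerivAt_smear {κ A : ThinPt n → ℝ} (h : IsKernel κ)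
    (hA : LocallyIntegrable A) (q : ThinPt n) :
    ∃ D : ThinPt n →L[ℝ] ℝ, HasFDerivAt (smear κ A) D q ∧
      ∀ e, D e = smear (ParabolicExtension.dKer e κ) A q := by
  have h1 := h.compact.hasFDerivAt_convolution_right (ContinuousLinearMap.mul ℝ ℝ) hA
    (h.smooth.of_le (by simp)) q
  rw [← smear_eq_convolution] at h1
  refine ⟨_, h1, fun e => ?_⟩
  have h2 := (h.compact.fderiv (𝕜 := ℝ)).convolutionExists_right
    ((ContinuousLinearMap.mul ℝ ℝ).precompR (ThinPt n)) hA
    (h.smooth.continuous_fderiv (by simp)) q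
  rw [convolution_def, ContinuousLinearMap.integral_apply h2]
  simp only [smear, ParabolicExtension.dKer]
  refine integral_congr_ae (Filter.Eventually.of_forall fun z => ?_)
  simp [ContinuousLinearMap.precompR_apply, mul_comm]

theorem IsKernel.hasLineDerivAt_smear {κ A : ThinPt n → ℝ} (h : IsKernel κ)
    (hA : LocallyIntegrable A) (q e : ThinPt n) :
    HasLineDerivAt ℝ (smear κ A) (smear (ParabolicExtension.dKer e κ) A q) q e := by
  obtain ⟨D, hD, hDe⟩ := h.hasFDerivAt_smear hA q
  rw [← hDe e]
  exact hD.hasLineDerivAt e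

theorem IsKernel.continuous_smear {κ A : ThinPt n → ℝ} (h : IsKernel κ)
    (hA : LocallyIntegrable A) : Continuous (smear κ A) := by
  rw [smear_eq_convolution]
  exact h.compact.continuous_convolution_right _ hA h.continuous

theorem IsKernel.smear_sum {ι : Type*} (s : Finset ι) {κ : ι → ThinPt n → ℝ}
    (hκ : ∀ i, IsKernel (κ i)) {A : ThinPt n → ℝ} (hA : LocallyIntegrable A) (q : ThinPt n) :
    smear (fun z => ∑ i ∈ s, κ i z) A q = ∑ i ∈ s, smear (κ i) A q := by
  simp only [smear, Finset.sum_mul]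
  exact integral_finsetSum _ fun i _ => (hκ i).integrable_smear hA q

theorem IsKernel.smear_add {κ l : ThinPt n → ℝ} (hκ : IsKernel κ) (hl : IsKernel l)
    {A : ThinPt n → ℝ} (hA : LocallyIntegrable A) (q : ThinPt n) :
    smear (fun z => κ z + l z) A q = smear κ A q + smear l A q := by
  simp only [smear, add_mul]
  exact integral_add (hκ.integrable_smear hA q) (hl.integrable_smear hA q)

/-- Functions on the slabs which are locally integrable up to `{y = 0}`. -/
def LocSlab (H : ThinPt n → ℝ → ℝ) : Prop :=
  Measurable (fun z : ThinPt n × ℝ => H z.1 z.2) ∧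
    ∀ ρ Y, Integrable (fun z : ThinPt n × ℝ => H z.1 z.2) (boxMeasure n ρ Y)

/-- Functions on the slabs which are locally integrable on the slices, locally uniformly. -/
def BddSlab (A : ThinPt n → ℝ → ℝ) : Prop :=
  Measurable (fun z : ThinPt n × ℝ => A z.1 z.2) ∧
    ∀ ρ Y, ∃ M, ∀ y ∈ Icc 0 Y, IntegrableOn (fun z => A z y) (Metric.closedBall 0 ρ) ∧
      ∫ z in Metric.closedBall 0 ρ, |A z y| ≤ M

/-- The primitive in the variable `y`. -/
def prim (H : ThinPt n → ℝ → ℝ) (z : ThinPt n) (y : ℝ) : ℝ := ∫ t in 0..y, H z t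

theorem BddSlab.locallyIntegrable {A : ThinPt n → ℝ → ℝ} (hA : BddSlab A) {y : ℝ} (hy : 0 ≤ y) :
    LocallyIntegrable (fun z => A z y) := by
  rw [locallyIntegrable_iff]
  intro k hk
  obtain ⟨ρ, hρ⟩ := hk.isBounded.subset_closedBall 0
  obtain ⟨M, hM⟩ := hA.2 ρ y
  exact (hM y ⟨hy, le_rfl⟩).1.mono_set hρ

theorem BddSlab.add {A B : ThinPt n → ℝ → ℝ} (hA : BddSlab A) (hB : BddSlab B) :
    BddSlab (fun z y => A z y + B z y) := by
  refine ⟨hA.1.add hB.1, fun ρ Y => ?_⟩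
  obtain ⟨M, hM⟩ := hA.2 ρ Y
  obtain ⟨M', hM'⟩ := hB.2 ρ Y
  refine ⟨M + M', fun y hy => ⟨(hM y hy).1.add (hM' y hy).1, ?_⟩⟩
  calc ∫ z in Metric.closedBall 0 ρ, |A z y + B z y|
      ≤ ∫ z in Metric.closedBall 0 ρ, (|A z y| + |B z y|) :=
        integral_mono ((hM y hy).1.add (hM' y hy).1).abs ((hM y hy).1.abs.add (hM' y hy).1.abs)
          fun z => abs_add_le _ _
    _ = _ := integral_add (hM y hy).1.abs (hM' y hy).1.abs
    _ ≤ _ := add_le_add (hM y hy).2 (hM' y hy).2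

theorem BddSlab.of_thin {b : ThinPt n → ℝ} (hm : Measurable b) (hb : LocallyIntegrable b) :
    BddSlab (fun z _ => b z) :=
  ⟨hm.comp measurable_fst, fun ρ _ => ⟨_, fun _ _ =>
    ⟨hb.integrableOn_isCompact (isCompact_closedBall 0 ρ), le_rfl⟩⟩⟩

theorem measurable_prim {H : ThinPt n → ℝ → ℝ}
    (hH : Measurable (fun z : ThinPt n × ℝ => H z.1 z.2)) :
    Measurable (fun z : ThinPt n × ℝ => prim H z.1 z.2) := by
  have h1 : Measurable (fun w : (ThinPt n × ℝ) × ℝ => H w.1.1 w.2) :=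
    hH.comp ((measurable_fst.comp measurable_fst).prodMk measurable_snd)
  have h2 : ∀ s : Set ((ThinPt n × ℝ) × ℝ), MeasurableSet s →
      Measurable (fun z : ThinPt n × ℝ => ∫ t, s.indicator (fun w => H w.1.1 w.2) (z, t)) :=
    fun s hs => ((h1.indicator hs).stronglyMeasurable.integral_prod_right').measurable
  have e : (fun z : ThinPt n × ℝ => prim H z.1 z.2) = fun z =>
      (∫ t, {w : (ThinPt n × ℝ) × ℝ | 0 < w.2 ∧ w.2 ≤ w.1.2}.indicator
        (fun w => H w.1.1 w.2) (z, t)) -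
      ∫ t, {w : (ThinPt n × ℝ) × ℝ | w.1.2 < w.2 ∧ w.2 ≤ 0}.indicator
        (fun w => H w.1.1 w.2) (z, t) := by
    funext z
    unfold prim
    rw [intervalIntegral, ← integral_indicator measurableSet_Ioc,
      ← integral_indicator measurableSet_Ioc]
    rfl
  rw [e]
  refine (h2 _ ?_).sub (h2 _ ?_)
  · exact (measurableSet_lt measurable_const measurable_snd).inter
      (measurableSet_le measurable_snd (measurable_snd.comp measurable_fst))
  · exact (measurableSet_lt (measurable_snd.comp measurable_fst) measurable_snd).inter
      (measurableSet_le measurable_snd measurable_const)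

theorem boxMeasure_mono (ρ : ℝ) {y Y : ℝ} (h : y ≤ Y) : boxMeasure n ρ y ≤ boxMeasure n ρ Y :=
  Measure.prod_mono le_rfl (Measure.restrict_mono (Ioc_subset_Ioc_right h) le_rfl)

/-- Integrating in `y` from the boundary turns joint local integrability into a bound for every
slice `y ≥ 0`, uniform for `y` in compact intervals. Such primitives can therefore be smeared at
every height. -/
theorem LocSlab.bddSlab_prim {H : ThinPt n → ℝ → ℝ} (hH : LocSlab H) : BddSlab (prim H) := by
  refine ⟨measurable_prim hH.1, fun ρ Y => ⟨∫ z, |H z.1 z.2| ∂(boxMeasure n ρ Y), fun y hy => ?_⟩⟩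
  have h1 : Integrable (fun z : ThinPt n × ℝ => H z.1 z.2) (boxMeasure n ρ y) := hH.2 ρ y
  have e : ∀ z, prim H z y = ∫ t in Ioc 0 y, H z t := fun z =>
    intervalIntegral.integral_of_le hy.1
  simp only [e]
  have h2 : ∫ z, |H z.1 z.2| ∂(boxMeasure n ρ y) =
      ∫ z in Metric.closedBall 0 ρ, ∫ t in Ioc 0 y, |H z t| := integral_prod _ h1.abs
  refine ⟨h1.integral_prod_left, ?_⟩
  calc ∫ z in Metric.closedBall 0 ρ, |∫ t in Ioc 0 y, H z t|
      ≤ ∫ z in Metric.closedBall 0 ρ, ∫ t in Ioc 0 y, |H z t| :=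
        integral_mono h1.integral_prod_left.abs h1.abs.integral_prod_left
          fun z => abs_integral_le_integral_abs
    _ = ∫ z, |H z.1 z.2| ∂(boxMeasure n ρ y) := h2.symm
    _ ≤ _ := integral_mono_measure (boxMeasure_mono ρ hy.2)
      (Filter.Eventually.of_forall fun z => abs_nonneg _) (hH.2 ρ Y).abs

/-- Fubini: the slice norms are bounded and `y^p` is integrable at `0` for `p > -1`. It allows a
second integration in `y`, after multiplication by `y^(-a)`. -/
theorem BddSlab.locSlab_rpow {A : ThinPt n → ℝ → ℝ} (hA : BddSlab A) {p : ℝ} (hp : -1 < p) :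
    LocSlab (fun z y => y ^ p * A z y) := by
  have hm : Measurable (fun z : ThinPt n × ℝ => z.2 ^ p * A z.1 z.2) :=
    Measurable.mul (by fun_prop) hA.1
  refine ⟨hm, fun ρ Y => ?_⟩
  obtain ⟨M, hM⟩ := hA.2 ρ Y
  rw [boxMeasure, integrable_prod_iff' hm.aestronglyMeasurable]
  have hmem : ∀ᵐ y ∂(volume.restrict (Ioc 0 Y)), y ∈ Ioc 0 Y := ae_restrict_mem measurableSet_Ioc
  constructor
  · filter_upwards [hmem] with y hy
    exact (hM y ⟨hy.1.le, hy.2⟩).1.const_mul _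
  · have h1 : IntegrableOn (fun y : ℝ => y ^ p) (Ioc 0 Y) := by
      rcases le_total 0 Y with h | h
      · exact (intervalIntegrable_iff_integrableOn_Ioc_of_le h).1
          (intervalIntegral.intervalIntegrable_rpow' hp)
      · simp [Ioc_eq_empty (not_lt.2 h)]
    refine (h1.mul_const M).mono' ?_ ?_
    · exact (hm.norm.stronglyMeasurable.integral_prod_left').aestronglyMeasurable
    · filter_upwards [hmem] with y hy
      have h0 : 0 ≤ y ^ p := Real.rpow_nonneg hy.1.le _
      have e : ∀ z, ‖y ^ p * A z y‖ = y ^ p * |A z y| := fun z => by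
        rw [norm_mul, Real.norm_of_nonneg h0, Real.norm_eq_abs]
      simp only [e]
      rw [integral_const_mul, Real.norm_of_nonneg (by positivity)]
      exact mul_le_mul_of_nonneg_left (hM y ⟨hy.1.le, hy.2⟩).2 h0

theorem IsKernel.exists_bound {κ : ThinPt n → ℝ} (h : IsKernel κ) :
    ∃ r B : ℝ, 0 ≤ r ∧ 0 ≤ B ∧ (∀ z, |κ z| ≤ B) ∧ ∀ z, r < ‖z‖ → κ z = 0 := by
  obtain ⟨r, hr⟩ := h.compact.isCompact.isBounded.subset_closedBall 0
  obtain ⟨B, hB⟩ := h.compact.exists_bound_of_continuous h.continuous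
  refine ⟨max r 0, B, le_max_right _ _, (norm_nonneg _).trans (hB 0), hB, fun z hz => ?_⟩
  by_contra hne
  have := hr (subset_tsupport _ hne)
  rw [mem_closedBall_zero_iff] at this
  exact absurd (this.trans (le_max_left r 0)) (not_le.2 hz)

theorem IsKernel.smear_eq_setIntegral {κ : ThinPt n → ℝ} {r ρ : ℝ}
    (hr : ∀ z, r < ‖z‖ → κ z = 0) (A : ThinPt n → ℝ) {q : ThinPt n}
    (hq : q ∈ Metric.closedBall 0 ρ) :
    smear κ A q = ∫ z in Metric.closedBall 0 (ρ + r), κ (q - z) * A z := by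
  rw [setIntegral_eq_integral_of_forall_compl_eq_zero]
  · rfl
  · intro z hz
    rw [mem_closedBall_zero_iff] at hz hq
    rw [hr, zero_mul]
    have := norm_sub_norm_le z q
    rw [norm_sub_rev] at this
    linarith

theorem measurable_smear {κ : ThinPt n → ℝ} (hκ : Measurable κ) {A : ThinPt n → ℝ → ℝ}
    (hA : Measurable (fun z : ThinPt n × ℝ => A z.1 z.2)) :
    Measurable (fun z : ThinPt n × ℝ => smear κ (fun w => A w z.2) z.1) := by
  have h1 : Measurable (fun w : (ThinPt n × ℝ) × ThinPt n => κ (w.1.1 - w.2) * A w.2 w.1.2) :=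
    (hκ.comp ((measurable_fst.comp measurable_fst).sub measurable_snd)).mul
      (hA.comp (measurable_snd.prodMk (measurable_snd.comp measurable_fst)))
  exact (h1.stronglyMeasurable.integral_prod_right').measurable

theorem IsKernel.boxBounded_smear {κ : ThinPt n → ℝ} (h : IsKernel κ) {A : ThinPt n → ℝ → ℝ}
    (hA : BddSlab A) (ρ Y : ℝ) : BoxBounded ρ Y (fun q y => smear κ (fun z => A z y) q) := by
  refine ⟨measurable_smear h.continuous.measurable hA.1, ?_⟩
  obtain ⟨r, B, hr0, hB0, hB, hr⟩ := h.exists_bound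
  obtain ⟨M, hM⟩ := hA.2 (ρ + r) Y
  refine ⟨B * M, fun q hq y hy => ?_⟩
  show |smear κ (fun z => A z y) q| ≤ B * M
  rw [IsKernel.smear_eq_setIntegral hr _ hq]
  calc |∫ z in Metric.closedBall 0 (ρ + r), κ (q - z) * A z y|
      ≤ ∫ z in Metric.closedBall 0 (ρ + r), B * |A z y| := by
        refine abs_integral_le_integral_abs.trans (integral_mono_of_nonneg
          (Filter.Eventually.of_forall fun z => abs_nonneg _) ((hM y hy).1.abs.const_mul B)
          (Filter.Eventually.of_forall fun z => ?_))
        simp only [abs_mul]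
        exact mul_le_mul_of_nonneg_right (hB _) (abs_nonneg _)
    _ = B * ∫ z in Metric.closedBall 0 (ρ + r), |A z y| := integral_const_mul _ _
    _ ≤ _ := mul_le_mul_of_nonneg_left (hM y hy).2 hB0

theorem IsKernel.integrable_mul_slab {κ : ThinPt n → ℝ} (h : IsKernel κ) {H : ThinPt n → ℝ → ℝ}
    (hH : LocSlab H) (q : ThinPt n) (ρ Y : ℝ) :
    Integrable (fun z : ThinPt n × ℝ => κ (q - z.1) * H z.1 z.2) (boxMeasure n ρ Y) := by
  obtain ⟨r, B, hr0, hB0, hB, hr⟩ := h.exists_bound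
  exact (hH.2 ρ Y).bdd_mul (c := B)
    (h.continuous.comp (continuous_const.sub continuous_fst)).aestronglyMeasurable
    (Filter.Eventually.of_forall fun z => hB _)

theorem IsKernel.integrableOn_smear {κ : ThinPt n → ℝ} (h : IsKernel κ) {H : ThinPt n → ℝ → ℝ}
    (hH : LocSlab H) (q : ThinPt n) (Y : ℝ) :
    IntegrableOn (fun y => smear κ (fun z => H z y) q) (Ioc 0 Y) := by
  obtain ⟨r, B, hr0, hB0, hB, hr⟩ := h.exists_bound
  have h1 := (h.integrable_mul_slab hH q (‖q‖ + r) Y).integral_prod_right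
  refine h1.congr (Filter.Eventually.of_forall fun y => ?_)
  exact (IsKernel.smear_eq_setIntegral hr _ (by simp)).symm

theorem IsKernel.intervalIntegrable_smear {κ : ThinPt n → ℝ} (h : IsKernel κ)
    {H : ThinPt n → ℝ → ℝ} (hH : LocSlab H) (q : ThinPt n) {Y : ℝ} (hY : 0 ≤ Y) :
    IntervalIntegrable (fun y => smear κ (fun z => H z y) q) volume 0 Y :=
  (intervalIntegrable_iff_integrableOn_Ioc_of_le hY).2 (h.integrableOn_smear hH q Y)

theorem IsKernel.integrable_smear_box {κ : ThinPt n → ℝ} (h : IsKernel κ) {H : ThinPt n → ℝ → ℝ}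
    (hH : LocSlab H) (ρ Y : ℝ) :
    Integrable (fun z : ThinPt n × ℝ => smear κ (fun w => H w z.2) z.1) (boxMeasure n ρ Y) := by
  obtain ⟨r, B, hr0, hB0, hB, hr⟩ := h.exists_bound
  have hm := measurable_smear h.continuous.measurable hH.1
  have h2 := (hH.2 (ρ + r) Y).abs.integral_prod_right.const_mul B
  have h3 : Integrable (fun z : ThinPt n × ℝ =>
      B * ∫ w in Metric.closedBall 0 (ρ + r), |H w z.2|) (boxMeasure n ρ Y) :=
    integrable_height (c := fun y => B * ∫ w in Metric.closedBall 0 (ρ + r), |H w y|) h2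
  have h4 : ∀ᵐ z ∂(boxMeasure n ρ Y),
      IntegrableOn (fun w => H w z.2) (Metric.closedBall 0 (ρ + r)) := by
    have := (hH.2 (ρ + r) Y).prod_left_ae
    exact Measure.quasiMeasurePreserving_snd.ae this
  refine h3.mono' hm.aestronglyMeasurable ?_
  filter_upwards [ae_boxMeasure, h4] with z hz hi
  rw [IsKernel.smear_eq_setIntegral hr _ hz.1, ← integral_const_mul]
  refine abs_integral_le_integral_abs.trans (integral_mono_of_nonneg
    (Filter.Eventually.of_forall fun z => abs_nonneg _) (hi.abs.const_mul B)
    (Filter.Eventually.of_forall fun w => ?_))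
  simp only [abs_mul]
  exact mul_le_mul_of_nonneg_right (hB _) (abs_nonneg _)

theorem IsKernel.smear_prim {κ : ThinPt n → ℝ} (h : IsKernel κ) {H : ThinPt n → ℝ → ℝ}
    (hH : LocSlab H) (q : ThinPt n) {y : ℝ} (hy : 0 ≤ y) :
    smear κ (fun z => prim H z y) q = ∫ t in 0..y, smear κ (fun z => H z t) q := by
  obtain ⟨r, B, hr0, hB0, hB, hr⟩ := h.exists_bound
  have hq : q ∈ Metric.closedBall (0 : ThinPt n) ‖q‖ := by simp
  rw [IsKernel.smear_eq_setIntegral hr _ hq, intervalIntegral.integral_of_le hy]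
  simp only [IsKernel.smear_eq_setIntegral hr _ hq, prim, intervalIntegral.integral_of_le hy,
    ← integral_const_mul]
  exact integral_integral_swap (h.integrable_mul_slab hH q _ y)

end
end ParabolicExtension

/-! ### From a weak solution to a mollified profile -/

namespace ParabolicExtension

noncomputable section

/-- A weak solution in the coordinates `((x, t), y)`, with the weak formulations tested against
products of a kernel on the thin space and a function of `y`. -/
structure SlabSolution (n : ℕ) (a : ℝ) where
  /-- the solution -/
  W : ThinPt n → ℝ → ℝ
  /-- the right-hand side -/
  g : ThinPt n → ℝ → ℝ
  /-- the weak derivative in `y` -/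
  Gy : ThinPt n → ℝ → ℝ
  /-- the weak derivatives in `x` -/
  Gx : Fin n → ThinPt n → ℝ → ℝ
  /-- the trace -/
  b : ThinPt n → ℝ
  /-- the conormal derivative -/
  c : ThinPt n → ℝ
  loc_W : LocSlab W
  loc_wW : LocSlab (fun z y => y ^ a * W z y)
  loc_g : LocSlab g
  loc_Gy : LocSlab Gy
  loc_wGy : LocSlab (fun z y => y ^ a * Gy z y)
  loc_Gx : ∀ i, LocSlab (Gx i)
  loc_wGx : ∀ i, LocSlab (fun z y => y ^ a * Gx i z y)
  meas_b : Measurable b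
  loc_b : LocallyIntegrable b
  sq_b : MemLp b 2 volume
  meas_c : Measurable c
  loc_c : LocallyIntegrable c
  weak_trace : ∀ κ, IsKernel κ → ∀ q χ, ContDiff ℝ ∞ χ → HasCompactSupport χ →
    ∫ y in Ioi (0 : ℝ), (smear κ (fun z => W z y) q * deriv χ y +
      smear κ (fun z => Gy z y) q * χ y) = -(smear κ b q * χ 0)
  weak_grad : ∀ i κ, IsKernel κ → ∀ q χ, ContDiff ℝ ∞ χ → HasCompactSupport χ →
    tsupport χ ⊆ Ioi 0 →
    ∫ y in Ioi (0 : ℝ), χ y * (smear (dKer (dirX i) κ) (fun z => W z y) q -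
      smear κ (fun z => Gx i z y) q) = 0
  weak_eq : ∀ κ, IsKernel κ → ∀ q χ, ContDiff ℝ ∞ χ → HasCompactSupport χ →
    ∫ y in Ioi (0 : ℝ), (y ^ a * smear κ (fun z => Gy z y) q * deriv χ y +
      (smear κ (fun z => g z y) q -
        ∑ i, y ^ a * smear (dKer (dirX i) κ) (fun z => Gx i z y) q -
        y ^ a * smear (dKer (dirT n) κ) (fun z => W z y) q) * χ y) = -(smear κ c q * χ 0)

theorem smear_rpow_mul {n : ℕ} (κ : ThinPt n → ℝ) (A : ThinPt n → ℝ) (r : ℝ) (q : ThinPt n) :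
    smear κ (fun z => r * A z) q = r * smear κ A q := by
  simp only [smear, ← integral_const_mul]
  exact integral_congr_ae (Filter.Eventually.of_forall fun z => by ring)

theorem IsKernel.isPrimitive_smear {n : ℕ} {κ : ThinPt n → ℝ} (h : IsKernel κ)
    {H : ThinPt n → ℝ → ℝ} (hH : LocSlab H) (q : ThinPt n) :
    IsPrimitive (fun y => smear κ (fun z => prim H z y) q)
      (fun y => smear κ (fun z => H z y) q) := by
  refine IsPrimitive.of_integral (fun Y hY => h.intervalIntegrable_smear hH q hY) fun y hy => ?_
  rw [h.smear_prim hH q hy, h.smear_prim hH q le_rfl]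
  simp

theorem IsKernel.isPrimitive_smear_add {n : ℕ} {κ : ThinPt n → ℝ} (h : IsKernel κ)
    {b : ThinPt n → ℝ} (hb : LocallyIntegrable b) {H : ThinPt n → ℝ → ℝ} (hH : LocSlab H)
    (q : ThinPt n) :
    IsPrimitive (fun y => smear κ (fun z => b z + prim H z y) q)
      (fun y => smear κ (fun z => H z y) q) := by
  have e : ∀ y, 0 ≤ y → smear κ (fun z => b z + prim H z y) q =
      smear κ b q + ∫ t in 0..y, smear κ (fun z => H z t) q := fun y hy => by
    rw [← h.smear_prim hH q hy]
    simp only [smear, mul_add]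
    exact integral_add (h.integrable_smear hb q)
      (h.integrable_smear (hH.bddSlab_prim.locallyIntegrable hy) q)
  refine IsPrimitive.of_integral (fun Y hY => h.intervalIntegrable_smear hH q hY) fun y hy => ?_
  rw [e y hy, e 0 le_rfl]
  simp

theorem IsPrimitive.sub {A A' B B' : ℝ → ℝ} (hA : IsPrimitive A A') (hB : IsPrimitive B B') :
    IsPrimitive (fun y => A y - B y) (fun y => A' y - B' y) :=
  (hA.add (hB.const_mul (-1))).congr_both (fun y => by ring) fun y _ => by ring

-- All tangential derivatives fall on the kernel, so no tangential regularity of the smeared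
-- function is required.
theorem IsKernel.hasTangential_smear {n : ℕ} {κ : ThinPt n → ℝ} (h : IsKernel κ)
    {A : ThinPt n → ℝ → ℝ} (hA : BddSlab A) (e : ThinPt n) :
    HasTangential e (fun q y => smear κ (fun z => A z y) q)
      (fun q y => smear (ParabolicExtension.dKer e κ) (fun z => A z y) q) :=
  fun q _ hy => h.hasLineDerivAt_smear (hA.locallyIntegrable hy) q e

theorem HasTangential.sub {n : ℕ} {e : ThinPt n} {A A' B B' : ThinPt n → ℝ → ℝ}
    (hA : HasTangential e A A') (hB : HasTangential e B B') :
    HasTangential e (fun q y => A q y - B q y) (fun q y => A' q y - B' q y) :=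
  (hA.add (hB.const_mul fun _ => -1)).congr_both (fun q y => by ring) fun q y _ => by ring

/-- The kernel of the tangential part `Δ_x + ∂_t` of the operator. -/
def kerL {n : ℕ} (κ : ThinPt n → ℝ) (z : ThinPt n) : ℝ :=
  ∑ i, dKer (dirX i) (dKer (dirX i) κ) z + dKer (dirT n) κ z

theorem IsKernel.kerL {n : ℕ} {κ : ThinPt n → ℝ} (h : IsKernel κ) :
    IsKernel (kerL κ) :=
  (IsKernel.sum _ fun i => (h.dKer (dirX i)).dKer (dirX i)).add (h.dKer _)

theorem IsKernel.smear_kerL {n : ℕ} {κ : ThinPt n → ℝ} (h : IsKernel κ) {A : ThinPt n → ℝ}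
    (hA : LocallyIntegrable A) (q : ThinPt n) :
    smear (ParabolicExtension.kerL κ) A q =
      ∑ i, smear (ParabolicExtension.dKer (dirX i) (ParabolicExtension.dKer (dirX i) κ)) A q +
        smear (ParabolicExtension.dKer (dirT n) κ) A q := by
  rw [← IsKernel.smear_sum _ (fun i => (h.dKer (dirX i)).dKer (dirX i)) hA]
  exact IsKernel.smear_add (IsKernel.sum _ fun i => (h.dKer (dirX i)).dKer (dirX i)) (h.dKer _)
    hA q

theorem LocSlab.ae_locallyIntegrable {n : ℕ} {H : ThinPt n → ℝ → ℝ} (hH : LocSlab H) :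
    ∀ᵐ y ∂(volume.restrict (Ioi (0 : ℝ))), LocallyIntegrable (fun z => H z y) := by
  have h1 : ∀ k : ℕ, ∀ᵐ y : ℝ, y ∈ Ioc (0 : ℝ) k →
      IntegrableOn (fun z => H z y) (Metric.closedBall 0 k) := fun k => by
    rw [← ae_restrict_iff' measurableSet_Ioc]
    exact (hH.2 k k).prod_left_ae
  rw [← ae_all_iff] at h1
  rw [ae_restrict_iff' measurableSet_Ioi]
  filter_upwards [h1] with y hy hy0
  rw [locallyIntegrable_iff]
  intro s hs
  obtain ⟨ρ, hρ⟩ := hs.isBounded.subset_closedBall 0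
  obtain ⟨k, hk⟩ := exists_nat_ge (max ρ y)
  exact (hy k ⟨hy0, (le_max_right _ _).trans hk⟩).mono_set
    (hρ.trans (Metric.closedBall_subset_closedBall ((le_max_left _ _).trans hk)))

theorem intervalIntegral_congr_of_ae {F G : ℝ → ℝ}
    (h : ∀ᵐ y ∂(volume.restrict (Ioi (0 : ℝ))), F y = G y) {y : ℝ} (hy : 0 ≤ y) :
    ∫ t in 0..y, F t = ∫ t in 0..y, G t := by
  rw [intervalIntegral.integral_of_le hy, intervalIntegral.integral_of_le hy]
  exact integral_congr_ae (ae_restrict_of_ae_restrict_of_subset Ioc_subset_Ioi_self h)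

/-- A function continuous on `[0, ∞)` which vanishes almost everywhere on the trace of an open set
vanishes there. -/
theorem eqOn_zero_of_ae {A : ℝ → ℝ} {U : Set ℝ} (hU : IsOpen U) (hA : ContinuousOn A (Ici 0))
    (h : ∀ᵐ y ∂(volume.restrict (Ioi (0 : ℝ))), y ∈ U → A y = 0) {y : ℝ}
    (hy : y ∈ Ici (0 : ℝ) ∩ U) : A y = 0 := by
  have h1 : ∀ x ∈ Ioi (0 : ℝ) ∩ U, A x = 0 := by
    have h2 : A =ᵐ[volume.restrict (Ioi (0 : ℝ) ∩ U)] fun _ => 0 := by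
      rw [Filter.EventuallyEq, ae_restrict_iff' (measurableSet_Ioi.inter hU.measurableSet)]
      rw [ae_restrict_iff' measurableSet_Ioi] at h
      filter_upwards [h] with x hx hx'
      exact hx hx'.1 hx'.2
    exact Measure.eqOn_open_of_ae_eq h2 (isOpen_Ioi.inter hU)
      (hA.mono fun x hx => mem_Ici.2 (le_of_lt (mem_Ioi.1 hx.1))) continuousOn_const
  rcases (show (0 : ℝ) ≤ y from hy.1).eq_or_lt with h0 | h0
  · subst h0
    -- The value at the boundary is a limit from the interior, where the continuous function already
    -- vanishes on the open set.
    have h3 : Filter.Tendsto A (nhdsWithin 0 (Ioi 0)) (nhds (A 0)) :=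
      ((hA 0 (mem_Ici.2 le_rfl)).mono Ioi_subset_Ici_self)
    refine tendsto_nhds_unique h3 (tendsto_const_nhds.congr' ?_)
    filter_upwards [self_mem_nhdsWithin, mem_nhdsWithin_of_mem_nhds (hU.mem_nhds hy.2)] with x h4 h5
    exact (h1 x ⟨h4, h5⟩).symm
  · exact h1 y ⟨h0, hy.2⟩

namespace SlabSolution

variable {n : ℕ} {a : ℝ} (S : SlabSolution n a)

/-- The part of the conormal derivative which does not involve tangential derivatives. -/
def A₁ (z : ThinPt n) (y : ℝ) : ℝ := S.c z + prim S.g z y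

/-- The part of the conormal derivative which involves tangential derivatives. -/
def A₂ (z : ThinPt n) (y : ℝ) : ℝ := prim (fun z y => y ^ a * S.W z y) z y

/-- The part of the solution which does not involve tangential derivatives. -/
def B₁ (z : ThinPt n) (y : ℝ) : ℝ := S.b z + prim (fun z y => y ^ (-a) * S.A₁ z y) z y

/-- The part of the solution which involves tangential derivatives. -/
def B₂ (z : ThinPt n) (y : ℝ) : ℝ := prim (fun z y => y ^ (-a) * S.A₂ z y) z y

theorem bdd_A₁ : BddSlab S.A₁ := (BddSlab.of_thin S.meas_c S.loc_c).add S.loc_g.bddSlab_prim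

theorem bdd_A₂ : BddSlab S.A₂ := S.loc_wW.bddSlab_prim

theorem loc_wA₁ (ha1 : a < 1) : LocSlab (fun z y => y ^ (-a) * S.A₁ z y) :=
  S.bdd_A₁.locSlab_rpow (by linarith)

theorem loc_wA₂ (ha1 : a < 1) : LocSlab (fun z y => y ^ (-a) * S.A₂ z y) :=
  S.bdd_A₂.locSlab_rpow (by linarith)

theorem bdd_B₁ (ha1 : a < 1) : BddSlab S.B₁ :=
  (BddSlab.of_thin S.meas_b S.loc_b).add (S.loc_wA₁ ha1).bddSlab_prim

theorem bdd_B₂ (ha1 : a < 1) : BddSlab S.B₂ := (S.loc_wA₂ ha1).bddSlab_prim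

/-- The smeared conormal derivative. -/
def conormal (κ l : ThinPt n → ℝ) (q : ThinPt n) (y : ℝ) : ℝ :=
  smear κ (fun z => S.A₁ z y) q - smear l (fun z => S.A₂ z y) q

/-- The smeared solution. -/
def value (κ l : ThinPt n → ℝ) (q : ThinPt n) (y : ℝ) : ℝ :=
  smear κ (fun z => S.B₁ z y) q - smear l (fun z => S.B₂ z y) q

variable {S}

theorem isPrimitive_conormal {κ l : ThinPt n → ℝ} (hκ : IsKernel κ) (hl : IsKernel l)
    (q : ThinPt n) : IsPrimitive (S.conormal κ l q) (fun y =>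
      smear κ (fun z => S.g z y) q - y ^ a * smear l (fun z => S.W z y) q) :=
  ((hκ.isPrimitive_smear_add S.loc_c S.loc_g q).sub
    (hl.isPrimitive_smear S.loc_wW q)).congr fun y _ => by rw [smear_rpow_mul]

/-- `value` and `conormal` take two kernels because the tangential operator `Δ_x + ∂_t` has been
moved onto the kernel: the intended choice is `l = kerL κ`. Both are defined for every `q` and every
`y ≥ 0`, unlike slices of the weak solution, and differentiating them merely differentiates both
kernels. -/
theorem isPrimitive_value (ha1 : a < 1) {κ l : ThinPt n → ℝ} (hκ : IsKernel κ) (hl : IsKernel l)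
    (q : ThinPt n) : IsPrimitive (S.value κ l q) (fun y => y ^ (-a) * S.conormal κ l q y) :=
  ((hκ.isPrimitive_smear_add S.loc_b (S.loc_wA₁ ha1) q).sub
    (hl.isPrimitive_smear (S.loc_wA₂ ha1) q)).congr fun y _ => by
      rw [smear_rpow_mul, smear_rpow_mul, conormal]; ring

theorem conormal_zero (κ l : ThinPt n → ℝ) (q : ThinPt n) :
    S.conormal κ l q 0 = smear κ S.c q := by
  simp [conormal, A₁, A₂, prim, smear]

theorem value_zero (κ l : ThinPt n → ℝ) (q : ThinPt n) :
    S.value κ l q 0 = smear κ S.b q := by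
  simp [value, B₁, B₂, prim, smear]

theorem tan_conormal {κ l : ThinPt n → ℝ} (hκ : IsKernel κ) (hl : IsKernel l) (e : ThinPt n) :
    HasTangential e (S.conormal κ l) (S.conormal (dKer e κ) (dKer e l)) :=
  (hκ.hasTangential_smear S.bdd_A₁ e).sub (hl.hasTangential_smear S.bdd_A₂ e)

theorem tan_value (ha1 : a < 1) {κ l : ThinPt n → ℝ} (hκ : IsKernel κ) (hl : IsKernel l)
    (e : ThinPt n) : HasTangential e (S.value κ l) (S.value (dKer e κ) (dKer e l)) :=
  (hκ.hasTangential_smear (S.bdd_B₁ ha1) e).sub (hl.hasTangential_smear (S.bdd_B₂ ha1) e)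

theorem bdd_conormal {κ l : ThinPt n → ℝ} (hκ : IsKernel κ) (hl : IsKernel l) (ρ Y : ℝ) :
    BoxBounded ρ Y (S.conormal κ l) :=
  (hκ.boxBounded_smear S.bdd_A₁ ρ Y).sub (hl.boxBounded_smear S.bdd_A₂ ρ Y)

theorem bdd_value (ha1 : a < 1) {κ l : ThinPt n → ℝ} (hκ : IsKernel κ) (hl : IsKernel l)
    (ρ Y : ℝ) : BoxBounded ρ Y (S.value κ l) :=
  (hκ.boxBounded_smear (S.bdd_B₁ ha1) ρ Y).sub (hl.boxBounded_smear (S.bdd_B₂ ha1) ρ Y)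

theorem value_kerL (ha1 : a < 1) {κ l : ThinPt n → ℝ} (hκ : IsKernel κ) (hl : IsKernel l)
    (q : ThinPt n) {y : ℝ} (hy : 0 ≤ y) :
    S.value (kerL κ) (kerL l) q y =
      ∑ i, S.value (dKer (dirX i) (dKer (dirX i) κ)) (dKer (dirX i) (dKer (dirX i) l)) q y +
        S.value (dKer (dirT n) κ) (dKer (dirT n) l) q y := by
  simp only [value, Finset.sum_sub_distrib,
    hκ.smear_kerL ((S.bdd_B₁ ha1).locallyIntegrable hy) q,
    hl.smear_kerL ((S.bdd_B₂ ha1).locallyIntegrable hy) q]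
  ring

/-- In the product test function the derivative in `x` falls on `κ (q - ·)` and is thus transferred
to the kernel. Interior test functions suffice, since the identity is only needed for almost every
height. -/
theorem ae_smear_Gx (i : Fin n) {κ : ThinPt n → ℝ} (hκ : IsKernel κ) (q : ThinPt n) :
    ∀ᵐ y ∂(volume.restrict (Ioi (0 : ℝ))), smear κ (fun z => S.Gx i z y) q =
      smear (dKer (dirX i) κ) (fun z => S.W z y) q := by
  have hloc : ∀ {l : ThinPt n → ℝ} {H : ThinPt n → ℝ → ℝ}, IsKernel l → LocSlab H →
      LocallyIntegrableOn (fun y => smear l (fun z => H z y) q) (Ioi 0) := fun hl hH => by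
    rw [locallyIntegrableOn_iff isOpen_Ioi.isLocallyClosed]
    intro k hk hkc
    obtain ⟨Y, hY⟩ := hkc.isBounded.bddAbove
    exact (hl.integrableOn_smear hH q Y).mono_set fun y hy => ⟨hk hy, hY hy⟩
  have h1 := isOpen_Ioi.ae_eq_zero_of_integral_contDiff_smul_eq_zero (μ := volume)
    ((hloc (hκ.dKer (dirX i)) S.loc_W).sub (hloc hκ (S.loc_Gx i))) fun χ hχ hc hs => by
      rw [← S.weak_grad i κ hκ q χ hχ hc hs]
      rw [setIntegral_eq_integral_of_forall_compl_eq_zero]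
      · rfl
      · intro y hy
        have : χ y = 0 := by
          by_contra h
          exact hy (hs (subset_tsupport _ h))
        simp [this]
  rw [ae_restrict_iff' measurableSet_Ioi]
  filter_upwards [h1] with y hy hy0
  have := hy hy0
  simp only [Pi.sub_apply] at this
  linarith

/-- Tested with products, the weak equation says that `y^a (κ * Gy)` has weak derivative `κ * g -
y^a (kerL κ) * W` up to the boundary, with boundary value `κ * c`. The lemma of du Bois-Reymond type
above identifies it with the explicit primitive. -/
theorem ae_smear_Gy {κ : ThinPt n → ℝ} (hκ : IsKernel κ) (q : ThinPt n) :
    ∀ᵐ y ∂(volume.restrict (Ioi (0 : ℝ))),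
      y ^ a * smear κ (fun z => S.Gy z y) q = S.conormal κ (kerL κ) q y := by
  have hX : ∀ᵐ y ∂(volume.restrict (Ioi (0 : ℝ))), ∀ i,
      smear (dKer (dirX i) κ) (fun z => S.Gx i z y) q =
      smear (dKer (dirX i) (dKer (dirX i) κ)) (fun z => S.W z y) q :=
    ae_all_iff.2 fun i => ae_smear_Gx i (hκ.dKer (dirX i)) q
  have hf : ∀ᵐ y ∂(volume.restrict (Ioi (0 : ℝ))), smear κ (fun z => S.g z y) q -
        ∑ i, y ^ a * smear (dKer (dirX i) κ) (fun z => S.Gx i z y) q -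
        y ^ a * smear (dKer (dirT n) κ) (fun z => S.W z y) q =
      smear κ (fun z => S.g z y) q - y ^ a * smear (kerL κ) (fun z => S.W z y) q := by
    filter_upwards [hX, S.loc_W.ae_locallyIntegrable] with y hy hi
    simp only [hκ.smear_kerL hi q, hy, mul_add, Finset.mul_sum]
    ring
  have hint : ∀ {l : ThinPt n → ℝ} {H : ThinPt n → ℝ → ℝ}, IsKernel l →
      LocSlab (fun z y => y ^ a * H z y) → ∀ Y, 0 ≤ Y →
      IntervalIntegrable (fun y => y ^ a * smear l (fun z => H z y) q) volume 0 Y :=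
    fun hl hH Y hY => by
      have := hl.intervalIntegrable_smear hH q hY
      simpa only [smear_rpow_mul] using this
  have hfi : ∀ Y, 0 ≤ Y → IntervalIntegrable (fun y => smear κ (fun z => S.g z y) q -
        ∑ i, y ^ a * smear (dKer (dirX i) κ) (fun z => S.Gx i z y) q -
        y ^ a * smear (dKer (dirT n) κ) (fun z => S.W z y) q) volume 0 Y := fun Y hY => by
    refine ((hκ.intervalIntegrable_smear S.loc_g q hY).sub ?_).sub
      (hint (hκ.dKer _) S.loc_wW Y hY)
    have := IntervalIntegrable.sum Finset.univ
      fun i (_ : i ∈ Finset.univ) => hint (hκ.dKer (dirX i)) (S.loc_wGx i) Y hY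
    simpa [Finset.sum_fn] using this
  have h1 := ae_eq_add_integral_of_weak (hint hκ S.loc_wGy) hfi
    fun χ hχ hc => S.weak_eq κ hκ q χ hχ hc
  filter_upwards [h1, ae_restrict_mem measurableSet_Ioi] with y hy hy0
  have hy0' : (0 : ℝ) ≤ y := le_of_lt hy0
  rw [hy, intervalIntegral_congr_of_ae hf hy0',
    (isPrimitive_conormal hκ hκ.kerL q).integral_eq hy0', conormal_zero]
  ring

/-- Same argument one order lower: Green's formula for the trace prescribes the boundary value `κ *
b`, and the derivative has just been identified. -/
theorem ae_smear_W (ha1 : a < 1) {κ : ThinPt n → ℝ} (hκ : IsKernel κ) (q : ThinPt n) :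
    ∀ᵐ y ∂(volume.restrict (Ioi (0 : ℝ))),
      smear κ (fun z => S.W z y) q = S.value κ (kerL κ) q y := by
  have h1 := ae_eq_add_integral_of_weak (fun Y => hκ.intervalIntegrable_smear S.loc_W q (Y := Y))
    (fun Y => hκ.intervalIntegrable_smear S.loc_Gy q (Y := Y))
    fun χ hχ hc => S.weak_trace κ hκ q χ hχ hc
  have h2 : ∀ᵐ y ∂(volume.restrict (Ioi (0 : ℝ))), smear κ (fun z => S.Gy z y) q =
      y ^ (-a) * S.conormal κ (kerL κ) q y := by
    filter_upwards [ae_smear_Gy hκ q, ae_restrict_mem measurableSet_Ioi] with y hy hy0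
    rw [← hy, ← mul_assoc, ← Real.rpow_add hy0]
    simp
  filter_upwards [h1, ae_restrict_mem measurableSet_Ioi] with y hy hy0
  have hy0' : (0 : ℝ) ≤ y := le_of_lt hy0
  rw [hy, intervalIntegral_congr_of_ae h2 hy0',
    (isPrimitive_value ha1 hκ hκ.kerL q).integral_eq hy0', value_zero]
  ring

/-- The set where the smeared solutions are required to vanish. -/
def farSet (n : ℕ) (c : ℝ) : Set (ThinPt n × ℝ) :=
  {p | radSq p.1 p.2 < c ∨ 1 < radSq p.1 p.2 ∨ 2 < ‖p.1‖}

theorem isOpen_farSet (n : ℕ) (c : ℝ) : IsOpen (farSet n c) :=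
  (isOpen_lt continuous_radSq continuous_const).union
    ((isOpen_lt continuous_const continuous_radSq).union
      (isOpen_lt continuous_const continuous_fst.norm))

/-- A kernel so concentrated that smearing with it keeps the solution away from `farSet`. -/
def Concentrated (S : SlabSolution n a) (c : ℝ) (κ : ThinPt n → ℝ) : Prop :=
  ∀ p ∈ farSet n c, ∀ z, S.W z p.2 ≠ 0 → κ (p.1 - z) = 0

/-- For almost every height the value is the convolution of `κ` with `W`, and no point of the
support of `W` is seen by the kernel. Continuity in `y` extends this to all heights, in particular
to the trace. -/
theorem Concentrated.value_eq_zero (ha1 : a < 1) {c : ℝ} {κ : ThinPt n → ℝ}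
    (h : Concentrated S c κ) (hκ : IsKernel κ) {q : ThinPt n} {y : ℝ} (hy : 0 ≤ y)
    (hq : (q, y) ∈ farSet n c) : S.value κ (kerL κ) q y = 0 := by
  refine eqOn_zero_of_ae (U := {t | (q, t) ∈ farSet n c})
    ((isOpen_farSet n c).preimage (by fun_prop))
    (isPrimitive_value ha1 hκ hκ.kerL q).continuousOn ?_ ⟨hy, hq⟩
  filter_upwards [ae_smear_W ha1 hκ q] with t ht hU
  rw [← ht]
  refine integral_eq_zero_of_ae (Filter.Eventually.of_forall fun z => ?_)
  by_cases hz : S.W z t = 0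
  · simp [hz]
  · simp [h _ hU z hz]

/-- The value vanishes on an open set of heights, so its derivative `y^(-a) P` does too, almost
everywhere; continuity of `P` does the rest. -/
theorem Concentrated.conormal_eq_zero (ha1 : a < 1) {c : ℝ} {κ : ThinPt n → ℝ}
    (h : Concentrated S c κ) (hκ : IsKernel κ) {q : ThinPt n} {y : ℝ} (hy : 0 ≤ y)
    (hq : (q, y) ∈ farSet n c) : S.conormal κ (kerL κ) q y = 0 := by
  have hopen : IsOpen {t | (q, t) ∈ farSet n c} := (isOpen_farSet n c).preimage (by fun_prop)
  refine eqOn_zero_of_ae (U := {t | (q, t) ∈ farSet n c}) hopen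
    (isPrimitive_conormal hκ hκ.kerL q).continuousOn ?_ ⟨hy, hq⟩
  filter_upwards [(isPrimitive_value ha1 hκ hκ.kerL q).2, ae_restrict_mem measurableSet_Ioi]
    with t ht ht0 hU
  have h0 : S.value κ (kerL κ) q =ᶠ[nhds t] fun _ => 0 := by
    filter_upwards [hopen.mem_nhds hU, Ioi_mem_nhds ht0] with s hs hs0
    exact h.value_eq_zero ha1 hκ (le_of_lt hs0) hs
  have h1 := (ht.congr_of_eventuallyEq h0.symm).unique (hasDerivAt_const t 0)
  exact (mul_eq_zero.1 h1).resolve_left (Real.rpow_pos_of_pos ht0 _).ne'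

theorem eq_zero_of_hasTangential {c : ℝ} {e : ThinPt n} {A A' : ThinPt n → ℝ → ℝ}
    (hA : HasTangential e A A') (h0 : ∀ q y, 0 ≤ y → (q, y) ∈ farSet n c → A q y = 0)
    {q : ThinPt n} {y : ℝ} (hy : 0 ≤ y) (hq : (q, y) ∈ farSet n c) : A' q y = 0 := by
  have h1 : HasDerivAt (fun t : ℝ => A (q + t • e) y) (A' q y) 0 := hA q y hy
  have hopen : IsOpen {t : ℝ | (q + t • e, y) ∈ farSet n c} :=
    (isOpen_farSet n c).preimage (by fun_prop)
  have h2 : (fun t : ℝ => A (q + t • e) y) =ᶠ[nhds 0] fun _ => 0 := by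
    filter_upwards [hopen.mem_nhds (by simpa using hq)] with t ht
    exact h0 _ _ hy ht
  exact (h1.congr_of_eventuallyEq h2.symm).unique (hasDerivAt_const 0 0)

theorem mem_farSet_of_far {c : ℝ} {q : ThinPt n} {y : ℝ} (h : 3 ≤ ‖q‖ ∨ 2 ≤ y) :
    (q, y) ∈ farSet n c := by
  rcases h with h | h
  · exact Or.inr (Or.inr (by simpa using lt_of_lt_of_le (by norm_num) h))
  · refine Or.inr (Or.inl ?_)
    have : (0 : ℝ) ≤ ‖q.1‖ ^ 2 := by positivity
    simp only [radSq]
    nlinarith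

variable (S) in
/-- The smeared solution as a profile. -/
def profile (ha1 : a < 1) {κ : ThinPt n → ℝ} (hκ : IsKernel κ) {c : ℝ}
    (h : Concentrated S c κ) : Profile n a 4 2 where
  u := S.value κ (kerL κ)
  P := S.conormal κ (kerL κ)
  f q y := smear κ (fun z => S.g z y) q - y ^ a * smear (kerL κ) (fun z => S.W z y) q
  ut := S.value (dKer (dirT n) κ) (dKer (dirT n) (kerL κ))
  Pt := S.conormal (dKer (dirT n) κ) (dKer (dirT n) (kerL κ))
  ui i := S.value (dKer (dirX i) κ) (dKer (dirX i) (kerL κ))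
  Pi i := S.conormal (dKer (dirX i) κ) (dKer (dirX i) (kerL κ))
  uit i := S.value (dKer (dirX i) (dKer (dirT n) κ)) (dKer (dirX i) (dKer (dirT n) (kerL κ)))
  uij i j := S.value (dKer (dirX j) (dKer (dirX i) κ)) (dKer (dirX j) (dKer (dirX i) (kerL κ)))
  prim_u q := isPrimitive_value ha1 hκ hκ.kerL q
  prim_ui i q := isPrimitive_value ha1 (hκ.dKer _) (hκ.kerL.dKer _) q
  prim_ut q := isPrimitive_value ha1 (hκ.dKer _) (hκ.kerL.dKer _) q
  prim_P q := isPrimitive_conormal hκ hκ.kerL q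
  tan_u i := tan_value ha1 hκ hκ.kerL _
  tan_ui i j := tan_value ha1 (hκ.dKer _) (hκ.kerL.dKer _) _
  tan_ut i := tan_value ha1 (hκ.dKer _) (hκ.kerL.dKer _) _
  tan_P i := tan_conormal hκ hκ.kerL _
  time_u := tan_value ha1 hκ hκ.kerL _
  time_ui i := by
    rw [dKer_comm hκ, dKer_comm hκ.kerL]
    exact tan_value ha1 (hκ.dKer _) (hκ.kerL.dKer _) _
  time_P := tan_conormal hκ hκ.kerL _
  symm i j := by rw [dKer_comm hκ, dKer_comm hκ.kerL]
  bdd_u := bdd_value ha1 hκ hκ.kerL 4 2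
  bdd_P := bdd_conormal hκ hκ.kerL 4 2
  bdd_ut := bdd_value ha1 (hκ.dKer _) (hκ.kerL.dKer _) 4 2
  bdd_Pt := bdd_conormal (hκ.dKer _) (hκ.kerL.dKer _) 4 2
  bdd_ui i := bdd_value ha1 (hκ.dKer _) (hκ.kerL.dKer _) 4 2
  bdd_Pi i := bdd_conormal (hκ.dKer _) (hκ.kerL.dKer _) 4 2
  bdd_uit i := bdd_value ha1 ((hκ.dKer _).dKer _) ((hκ.kerL.dKer _).dKer _) 4 2
  bdd_uij i j := bdd_value ha1 ((hκ.dKer _).dKer _) ((hκ.kerL.dKer _).dKer _) 4 2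
  int_f := by
    refine (hκ.integrable_smear_box S.loc_g 4 2).sub ?_
    simpa only [smear_rpow_mul] using hκ.kerL.integrable_smear_box S.loc_wW 4 2
  -- The far set contains all points with `‖q‖ > 2` or `|X| > 1`, so a radius of `3` and a height of
  -- `2` leave room inside the box of radius `4`.
  ρ₀ := 3
  lt_ρ := by norm_num
  pos_Y := by norm_num
  zero_u q y hy hq := h.value_eq_zero ha1 hκ hy (mem_farSet_of_far hq)
  zero_P q y hy hq := h.conormal_eq_zero ha1 hκ hy (mem_farSet_of_far hq)
  zero_ui i q y hy hq := eq_zero_of_hasTangential (tan_value ha1 hκ hκ.kerL (dirX i))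
    (fun _ _ => h.value_eq_zero ha1 hκ) hy (mem_farSet_of_far hq)

theorem profile_supportedIn {C : CarlemanParams n} {S : SlabSolution n C.a} {κ : ThinPt n → ℝ}
    (hκ : IsKernel κ) (h : Concentrated S C.c κ) :
    (S.profile C.a_lt_one hκ h).SupportedIn := by
  intro q y hy hq
  have hq' : (q, y) ∈ farSet n C.c := hq.elim Or.inl fun h => Or.inr (Or.inl h)
  refine ⟨h.value_eq_zero C.a_lt_one hκ hy hq', h.conormal_eq_zero C.a_lt_one hκ hy hq', ?_,
    fun i => ?_⟩
  · exact eq_zero_of_hasTangential (tan_value C.a_lt_one hκ hκ.kerL (dirT n))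
      (fun _ _ => h.value_eq_zero C.a_lt_one hκ) hy hq'
  · exact eq_zero_of_hasTangential (tan_value C.a_lt_one hκ hκ.kerL (dirX i))
      (fun _ _ => h.value_eq_zero C.a_lt_one hκ) hy hq'

/-- The `y`-equation gives `f = κ * g - y^a (kerL κ) * W`. Applying the identification of smeared
solutions to the kernel `kerL κ` shows that the last convolution is the tangential Laplacian plus
the time derivative of the profile. -/
theorem ae_profile_source {C : CarlemanParams n} {S : SlabSolution n C.a} {κ : ThinPt n → ℝ}
    (hκ : IsKernel κ) (h : Concentrated S C.c κ) (q : ThinPt n) :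
    ∀ᵐ y ∂(volume.restrict (Ioi (0 : ℝ))),
      (S.profile C.a_lt_one hκ h).source q y = smear κ (fun z => S.g z y) q := by
  filter_upwards [ae_smear_W C.a_lt_one hκ.kerL q, ae_restrict_mem measurableSet_Ioi] with y hy hy0
  have h1 := value_kerL (S := S) C.a_lt_one hκ hκ.kerL q (le_of_lt hy0)
  simp only [Profile.source, Profile.lap, profile]
  rw [hy, h1]
  ring

end SlabSolution
end
end ParabolicExtension

/-! ### Coordinates separating the height, and product test functions -/

namespace ParabolicExtension

noncomputable section

variable {n : ℕ}

/-- The coordinates `((x, t), y)` on the space of points `(x, y, t)`. -/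
def flat (n : ℕ) : ThinPt n × ℝ ≃ᵐ Pt n where
  toFun w := (w.1.1, w.2, w.1.2)
  invFun p := ((p.1, p.2.2), p.2.1)
  left_inv _ := rfl
  right_inv _ := rfl
  measurable_toFun := by simp only [Equiv.coe_fn_mk]; fun_prop
  measurable_invFun := by simp only [Equiv.coe_fn_symm_mk]; fun_prop

@[simp] theorem flat_apply (w : ThinPt n × ℝ) : flat n w = (w.1.1, w.2, w.1.2) := rfl

/-- Lebesgue measure on the half space in the coordinates `((x, t), y)`. -/
def slabMeasure (n : ℕ) : Measure (ThinPt n × ℝ) :=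
  (volume : Measure (ThinPt n)).prod (volume.restrict (Ioi (0 : ℝ)))

theorem measurePreserving_flat_volume :
    MeasurePreserving (flat n) (volume : Measure (ThinPt n × ℝ)) volume := by
  have h1 : MeasurePreserving
      (MeasurableEquiv.prodAssoc : (EuclideanSpace ℝ (Fin n) × ℝ) × ℝ ≃ᵐ _) volume volume :=
    measurePreserving_prodAssoc volume volume volume
  have h2 : MeasurePreserving (Prod.map id Prod.swap :
      EuclideanSpace ℝ (Fin n) × ℝ × ℝ → EuclideanSpace ℝ (Fin n) × ℝ × ℝ) volume volume :=
    (MeasurePreserving.id volume).prod (Measure.measurePreserving_swap (μ := volume) (ν := volume))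
  exact h2.comp h1

theorem measurePreserving_flat :
    MeasurePreserving (flat n) (slabMeasure n) (volume.restrict (upper n)) := by
  have hm : MeasurableSet (upper n) :=
    measurableSet_lt measurable_const (measurable_fst.comp measurable_snd)
  have h1 := measurePreserving_flat_volume (n := n).restrict_preimage hm
  have e : (volume : Measure (ThinPt n × ℝ)).restrict (flat n ⁻¹' upper n) = slabMeasure n := by
    rw [slabMeasure, ← Measure.restrict_univ (μ := (volume : Measure (ThinPt n))),
      Measure.prod_restrict]
    congr 1
    ext w
    simp [upper]
  rwa [e] at h1

theorem integral_upper (Φ : Pt n → ℝ) :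
    ∫ p in upper n, Φ p = ∫ w, Φ (flat n w) ∂(slabMeasure n) :=
  (measurePreserving_flat.integral_comp (flat n).measurableEmbedding Φ).symm

theorem boxMeasure_eq (ρ Y : ℝ) : boxMeasure n ρ Y =
    (slabMeasure n).restrict (Metric.closedBall 0 ρ ×ˢ Ioc 0 Y) := by
  rw [slabMeasure, ← Measure.prod_restrict, Measure.restrict_restrict measurableSet_Ioc,
    inter_eq_self_of_subset_left Ioc_subset_Ioi_self]
  rfl

theorem boxMeasure_le (ρ Y : ℝ) : boxMeasure n ρ Y ≤ slabMeasure n := by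
  rw [boxMeasure_eq]; exact Measure.restrict_le_self

/-- `F` is integrable on the half space, with slice integrals `φ`. -/
structure SlabIntegral (F : ThinPt n × ℝ → ℝ) (φ : ℝ → ℝ) : Prop where
  integrable : Integrable F (slabMeasure n)
  slice : ∀ᵐ y ∂(volume.restrict (Ioi (0 : ℝ))), ∫ z, F (z, y) = φ y

namespace SlabIntegral

variable {F G : ThinPt n × ℝ → ℝ} {φ ψ : ℝ → ℝ}

theorem integral_eq (h : SlabIntegral F φ) : ∫ w, F w ∂(slabMeasure n) = ∫ y in Ioi 0, φ y := by
  rw [slabMeasure, integral_prod_symm _ h.integrable]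
  exact integral_congr_ae h.slice

theorem add (hF : SlabIntegral F φ) (hG : SlabIntegral G ψ) :
    SlabIntegral (fun w => F w + G w) (fun y => φ y + ψ y) := by
  refine ⟨hF.integrable.add hG.integrable, ?_⟩
  have h1 := hF.integrable
  have h2 := hG.integrable
  rw [slabMeasure] at h1 h2
  filter_upwards [hF.slice, hG.slice, h1.prod_left_ae, h2.prod_left_ae] with y e1 e2 i1 i2
  rw [← e1, ← e2]
  exact integral_add i1 i2

theorem const_mul (c : ℝ) (hF : SlabIntegral F φ) :
    SlabIntegral (fun w => c * F w) (fun y => c * φ y) := by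
  refine ⟨hF.integrable.const_mul c, ?_⟩
  filter_upwards [hF.slice] with y e1
  rw [← e1]
  exact integral_const_mul _ _

theorem sum {ι : Type*} (s : Finset ι) {F : ι → ThinPt n × ℝ → ℝ} {φ : ι → ℝ → ℝ}
    (h : ∀ i, SlabIntegral (F i) (φ i)) :
    SlabIntegral (fun w => ∑ i ∈ s, F i w) (fun y => ∑ i ∈ s, φ i y) := by
  classical
  induction s using Finset.induction_on with
  | empty => simpa using (⟨integrable_zero _ _ _, by simp⟩ : SlabIntegral (n := n) (fun _ => 0) fun _ => 0)
  | insert i s hi ih =>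
    simp only [Finset.sum_insert hi]
    exact (h i).add ih

theorem of_locSlab {κ : ThinPt n → ℝ} (hκ : IsKernel κ) {χ : ℝ → ℝ} (hχ : Continuous χ)
    (hc : HasCompactSupport χ) {H : ThinPt n → ℝ → ℝ} (hH : LocSlab H) (q : ThinPt n) :
    SlabIntegral (fun w => κ (q - w.1) * χ w.2 * H w.1 w.2)
      (fun y => χ y * smear κ (fun z => H z y) q) := by
  refine ⟨?_, Filter.Eventually.of_forall fun y => ?_⟩
  · obtain ⟨r, B, hr0, hB0, hB, hr⟩ := hκ.exists_bound
    obtain ⟨B', hB'⟩ := hc.exists_bound_of_continuous hχ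
    obtain ⟨Y, hY⟩ := hc.isCompact.isBounded.bddAbove
    have h1 : Integrable (fun w : ThinPt n × ℝ => κ (q - w.1) * χ w.2 * H w.1 w.2)
        (boxMeasure n (‖q‖ + r) Y) :=
      (hH.2 _ _).bdd_mul (c := B * B') (by
        have := hκ.continuous
        exact Continuous.aestronglyMeasurable (by fun_prop))
        (Filter.Eventually.of_forall fun w => by
          rw [norm_mul]
          exact mul_le_mul (hB _) (hB' _) (norm_nonneg _) hB0)
    rw [boxMeasure_eq] at h1
    rw [slabMeasure, ← Measure.restrict_univ (μ := (volume : Measure (ThinPt n))),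
      Measure.prod_restrict] at h1 ⊢
    rw [Measure.restrict_restrict (measurableSet_closedBall.prod measurableSet_Ioc),
      inter_comm] at h1
    refine IntegrableOn.of_forall_sdiff_eq_zero (s := (univ ×ˢ Ioi 0) ∩
      (Metric.closedBall 0 (‖q‖ + r) ×ˢ Ioc 0 Y)) h1 (MeasurableSet.univ.prod measurableSet_Ioi) ?_
    rintro ⟨z, y⟩ ⟨⟨-, hy⟩, hz⟩
    by_contra hne
    apply hz
    refine ⟨⟨mem_univ _, hy⟩, ?_, hy, hY (subset_tsupport _ fun h0 => hne (by simp [h0]))⟩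
    rw [mem_closedBall_zero_iff]
    by_contra! hlt
    refine hne ?_
    simp only
    rw [hr, zero_mul, zero_mul]
    have := norm_sub_norm_le z q
    rw [norm_sub_rev] at this
    linarith
  · simp only [smear, ← integral_const_mul]
    exact integral_congr_ae (Filter.Eventually.of_forall fun z => by ring)

end SlabIntegral

/-- The product test function. -/
def testFn (κ : ThinPt n → ℝ) (χ : ℝ → ℝ) (q : ThinPt n) (p : Pt n) : ℝ :=
  κ (q - (p.1, p.2.2)) * χ p.2.1

theorem isTest_testFn {κ : ThinPt n → ℝ} (hκ : IsKernel κ) {χ : ℝ → ℝ} (hχ : ContDiff ℝ ∞ χ)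
    (hc : HasCompactSupport χ) (q : ThinPt n) : IsTest (testFn κ χ q) := by
  refine ⟨?_, ?_⟩
  · exact (hκ.smooth.comp (by fun_prop)).mul (hχ.comp (by fun_prop))
  · obtain ⟨r, B, hr0, hB0, hB, hr⟩ := hκ.exists_bound
    have hk : IsCompact ((fun w : ThinPt n × ℝ => ((w.1.1, w.2, w.1.2) : Pt n)) ''
        (Metric.closedBall q r ×ˢ tsupport χ)) :=
      ((isCompact_closedBall q r).prod hc.isCompact).image (by fun_prop)
    refine HasCompactSupport.intro hk fun p hp => ?_
    by_contra hne
    apply hp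
    refine ⟨((p.1, p.2.2), p.2.1), ⟨?_, subset_tsupport _ fun h0 => hne (by simp [testFn, h0])⟩, rfl⟩
    rw [Metric.mem_closedBall, dist_eq_norm, norm_sub_rev]
    by_contra! hlt
    exact hne (by simp [testFn, hr _ hlt])

/-- The minus sign comes from differentiating `κ (q - z)` in `z`; it is the origin of the signs in
front of the differentiated kernels in the smeared weak formulation. -/
theorem fderiv_testFn {κ : ThinPt n → ℝ} (hκ : IsKernel κ) {χ : ℝ → ℝ} (hχ : ContDiff ℝ ∞ χ)
    (q : ThinPt n) (p : Pt n) (h : EuclideanSpace ℝ (Fin n)) (k τ : ℝ) :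
    fderiv ℝ (testFn κ χ q) p (h, k, τ) =
      κ (q - (p.1, p.2.2)) * (deriv χ p.2.1 * k) -
        fderiv ℝ κ (q - (p.1, p.2.2)) (h, τ) * χ p.2.1 := by
  have d1 : HasFDerivAt (fun p : Pt n => q - (p.1, p.2.2))
      (-((ContinuousLinearMap.fst ℝ _ _).prod
        ((ContinuousLinearMap.snd ℝ ℝ ℝ).comp (ContinuousLinearMap.snd ℝ _ _)))) p :=
    (hasFDerivAt_fst.prodMk (hasFDerivAt_snd.snd)).const_sub q
  have d2 : HasFDerivAt (fun p : Pt n => p.2.1)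
      ((ContinuousLinearMap.fst ℝ ℝ ℝ).comp (ContinuousLinearMap.snd ℝ _ _)) p :=
    hasFDerivAt_snd.fst
  have d3 := ((hκ.smooth.differentiable (by simp) (q - (p.1, p.2.2))).hasFDerivAt).comp p d1
  have d4 := ((hχ.differentiable (by simp) p.2.1).hasDerivAt.hasFDerivAt).comp p d2
  have d5 := (d3.mul d4).fderiv
  have e : testFn κ χ q = (κ ∘ fun p : Pt n => q - (p.1, p.2.2)) *
    (χ ∘ fun p : Pt n => p.2.1) := rfl
  rw [e, d5]
  simp
  ring

theorem tsupport_testFn_subset (κ : ThinPt n → ℝ) {χ : ℝ → ℝ} (hs : tsupport χ ⊆ Ioi 0)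
    (q : ThinPt n) : tsupport (testFn κ χ q) ⊆ upper n := by
  have h1 : tsupport (testFn κ χ q) ⊆ (fun p : Pt n => p.2.1) ⁻¹' tsupport χ := by
    refine closure_minimal (fun p hp => subset_tsupport _ fun h0 => hp (by simp [testFn, h0])) ?_
    exact (isClosed_tsupport χ).preimage (by fun_prop)
  exact fun p hp => hs (h1 hp)

end
end ParabolicExtension

/-! ### Weak solutions in the separated coordinates -/

namespace ParabolicExtension

noncomputable section

variable {n : ℕ} {a : ℝ}

theorem measurableSet_upper : MeasurableSet (upper n) :=
  measurableSet_lt measurable_const (measurable_fst.comp measurable_snd)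

theorem measurable_weight : Measurable fun p : Pt n => ENNReal.ofReal (p.2.1 ^ a) := by fun_prop

theorem ae_upper_iff_ae_weighted {P : Pt n → Prop} :
    (∀ᵐ p ∂(weighted n a), P p) ↔ ∀ᵐ p ∂(volume.restrict (upper n)), P p := by
  rw [weighted, ae_withDensity_iff measurable_weight]
  constructor <;> intro h
  · filter_upwards [h, ae_restrict_mem measurableSet_upper] with p hp hp0
    exact hp (ENNReal.ofReal_pos.2 (Real.rpow_pos_of_pos hp0 _)).ne'
  · filter_upwards [h] with p hp _ using hp

theorem exists_measurable_of_memLp {f : Pt n → ℝ} (hf : MemLp f 2 (weighted n a)) :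
    ∃ f' : Pt n → ℝ, Measurable f' ∧ MemLp f' 2 (weighted n a) ∧
      f' =ᵐ[volume.restrict (upper n)] f := by
  obtain ⟨f', hm, he⟩ := hf.aestronglyMeasurable
  refine ⟨f', hm.measurable, (memLp_congr_ae he).1 hf, ?_⟩
  exact (ae_upper_iff_ae_weighted (a := a)).1 he.symm

/-- A function in the coordinates `((x, t), y)`. -/
def inSlab (f : Pt n → ℝ) (z : ThinPt n) (y : ℝ) : ℝ := f (flat n (z, y))

theorem measurable_inSlab {f : Pt n → ℝ} (hm : Measurable f) :
    Measurable fun w : ThinPt n × ℝ => inSlab f w.1 w.2 := hm.comp (flat n).measurable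

theorem integrable_weight_sq {f : Pt n → ℝ} (hf : MemLp f 2 (weighted n a)) (ρ Y : ℝ) :
    Integrable (fun w : ThinPt n × ℝ => w.2 ^ a * inSlab f w.1 w.2 ^ 2) (boxMeasure n ρ Y) := by
  have h1 := hf.integrable_sq
  rw [weighted, integrable_withDensity_iff measurable_weight
    (Filter.Eventually.of_forall fun _ => ENNReal.ofReal_lt_top)] at h1
  have h2 := ((measurePreserving_flat.integrable_comp_emb (flat n).measurableEmbedding).2
    h1).mono_measure (boxMeasure_le ρ Y)
  refine h2.congr ?_
  filter_upwards [ae_boxMeasure] with w hw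
  simp only [Function.comp_apply, flat_apply, inSlab]
  rw [ENNReal.toReal_ofReal (Real.rpow_nonneg hw.2.1.le _), mul_comm]

/-- From `|f| ≤ y^(-a) + y^a f²`, where `y^(-a)` is integrable near the boundary because `a < 1`. -/
theorem locSlab_of_memLp (ha1 : a < 1) {f : Pt n → ℝ} (hm : Measurable f)
    (hf : MemLp f 2 (weighted n a)) : LocSlab (inSlab f) := by
  refine ⟨measurable_inSlab hm, fun ρ Y => ?_⟩
  refine ((integrable_rpow_height (n := n) (ρ := ρ) (Y := Y) (p := -a) (by linarith)).add
    (integrable_weight_sq hf ρ Y)).mono' (measurable_inSlab hm).aestronglyMeasurable ?_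
  filter_upwards [ae_boxMeasure] with w hw
  have h0 : 0 < w.2 := hw.2.1
  have h1 : 0 < w.2 ^ a := Real.rpow_pos_of_pos h0 _
  simp only [Pi.add_apply, Real.rpow_neg h0.le, Real.norm_eq_abs]
  set v := inSlab f w.1 w.2
  set r := w.2 ^ a
  rw [← sq_abs v]
  have h2 : r⁻¹ * (r * |v| - 1) ^ 2 = r * |v| ^ 2 - 2 * |v| + r⁻¹ := by field_simp; ring
  have h3 : 0 ≤ r⁻¹ * (r * |v| - 1) ^ 2 := by positivity
  linarith [abs_nonneg v]

/-- From `y^a |f| ≤ y^a + y^a f²`, where now `a > -1` is used. -/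
theorem locSlab_rpow_of_memLp (ha : -1 < a) {f : Pt n → ℝ} (hm : Measurable f)
    (hf : MemLp f 2 (weighted n a)) : LocSlab (fun z y => y ^ a * inSlab f z y) := by
  have hm' : Measurable fun w : ThinPt n × ℝ => w.2 ^ a * inSlab f w.1 w.2 :=
    Measurable.mul (by fun_prop) (measurable_inSlab hm)
  refine ⟨hm', fun ρ Y => ?_⟩
  refine ((integrable_rpow_height (n := n) (ρ := ρ) (Y := Y) ha).add
    (integrable_weight_sq hf ρ Y)).mono' hm'.aestronglyMeasurable ?_
  filter_upwards [ae_boxMeasure] with w hw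
  have h1 : 0 < w.2 ^ a := Real.rpow_pos_of_pos hw.2.1 _
  simp only [Pi.add_apply, norm_mul, Real.norm_of_nonneg h1.le, Real.norm_eq_abs]
  set v := inSlab f w.1 w.2
  set r := w.2 ^ a
  rw [← sq_abs v]
  have h3 : 0 ≤ r * (|v| - 1) ^ 2 := by positivity
  nlinarith [abs_nonneg v, mul_nonneg h1.le (abs_nonneg v)]

theorem locSlab_of_locallyIntegrable {g g' : Pt n → ℝ}
    (hg : LocallyIntegrable g (volume.restrict (upper n))) (hm : Measurable g')
    (he : g' =ᵐ[volume.restrict (upper n)] g) : LocSlab (inSlab g') := by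
  refine ⟨measurable_inSlab hm, fun ρ Y => ?_⟩
  have hk : IsCompact ((fun w : ThinPt n × ℝ => ((w.1.1, w.2, w.1.2) : Pt n)) ''
      (Metric.closedBall 0 ρ ×ˢ Icc 0 Y)) :=
    ((isCompact_closedBall 0 ρ).prod isCompact_Icc).image (by fun_prop)
  have h1 := hg.integrableOn_isCompact hk
  have h2 : IntegrableOn g' _ (volume.restrict (upper n)) :=
    h1.congr (ae_restrict_of_ae (by filter_upwards [he] with p hp using hp.symm))
  have h3 := (measurePreserving_flat.restrict_preimage hk.measurableSet).integrable_comp_emb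
    (flat n).measurableEmbedding |>.2 h2
  rw [boxMeasure_eq]
  refine h3.mono_measure (Measure.restrict_mono ?_ le_rfl)
  rintro w ⟨hw1, hw2⟩
  exact ⟨w, ⟨hw1, Ioc_subset_Icc_self hw2⟩, rfl⟩

theorem integral_slab (F : ThinPt n × ℝ → ℝ) :
    ∫ w, F w ∂(slabMeasure n) = ∫ p in upper n, F ((p.1, p.2.2), p.2.1) :=
  (integral_upper fun p => F ((p.1, p.2.2), p.2.1)).symm

theorem smear_thin (κ : ThinPt n → ℝ) (χ : ℝ → ℝ) (b : ThinPt n → ℝ) (q : ThinPt n) :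
    ∫ z, b z * testFn κ χ q (onThin z) = smear κ b q * χ 0 := by
  rw [smear, ← integral_mul_const]
  exact integral_congr_ae (Filter.Eventually.of_forall fun z => by simp [testFn, onThin]; ring)

/-- A weak solution in the coordinates `((x, t), y)`, with measurable representatives. -/
theorem exists_slabSolution (ha : -1 < a) (ha1 : a < 1) {V : ThinPt n → ℝ} (hV : Continuous V)
    {W g : Pt n → ℝ} (h : IsWeakSolution a V g W) {K : Set (Pt n)} (hK : IsCompact K)
    (hWK : ∀ᵐ p ∂(volume.restrict (upper n)), p ∉ K → W p = 0) :
    ∃ S : SlabSolution n a, (∀ z y, S.W z y ≠ 0 → (z.1, y, z.2) ∈ K) ∧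
      (S.c = fun z => V z * S.b z) ∧
      (∀ᵐ w ∂(slabMeasure n), S.W w.1 w.2 = W (flat n w)) ∧
      ∀ᵐ w ∂(slabMeasure n), S.g w.1 w.2 = g (flat n w) := by
  obtain ⟨hW, hg, Gx, Gy, b, hGx, hGy, hb, hgrad, htr, heq⟩ := h
  obtain ⟨W₀, mW₀, lW₀, eW₀⟩ := exists_measurable_of_memLp hW
  -- The representative is set to zero off `K` everywhere, not only almost everywhere, because the
  -- concentration condition on kernels is pointwise.
  set W' : Pt n → ℝ := K.indicator W₀
  have mW : Measurable W' := mW₀.indicator hK.measurableSet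
  have eW : W' =ᵐ[volume.restrict (upper n)] W := by
    filter_upwards [eW₀, hWK] with p h1 h2
    by_cases hp : p ∈ K
    · rw [← h1]; exact indicator_of_mem hp _
    · rw [h2 hp]; exact indicator_of_notMem hp _
  have lW : MemLp W' 2 (weighted n a) := lW₀.indicator hK.measurableSet
  obtain ⟨Y', mY, lY, eY⟩ := exists_measurable_of_memLp hGy
  have hGxi : ∀ i, MemLp (fun p => Gx p i) 2 (weighted n a) := fun i =>
    (EuclideanSpace.proj (𝕜 := ℝ) i).comp_memLp' hGx
  choose X' mX lX eX using fun i => exists_measurable_of_memLp (hGxi i)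
  obtain ⟨g', mg, eg⟩ : ∃ g' : Pt n → ℝ, Measurable g' ∧
      g' =ᵐ[volume.restrict (upper n)] g := by
    obtain ⟨g', h1, h2⟩ := hg.aestronglyMeasurable
    exact ⟨g', h1.measurable, h2.symm⟩
  obtain ⟨b', mb, eb⟩ : ∃ b' : ThinPt n → ℝ, Measurable b' ∧ b' =ᵐ[volume] b := by
    obtain ⟨b', h1, h2⟩ := hb.aestronglyMeasurable
    exact ⟨b', h1.measurable, h2.symm⟩
  have lb : LocallyIntegrable b' :=
    (hb.locallyIntegrable (by norm_num)).congr eb.symm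
  have lc : LocallyIntegrable (fun z => V z * b' z) := by
    rw [locallyIntegrable_iff]
    intro k hk
    exact (lb.integrableOn_isCompact hk).continuousOn_mul hV.continuousOn hk
  have hzero : ∀ L : ThinPt n →L[ℝ] ℝ, L (0, 0) = 0 := fun L => map_zero L
  have sW := locSlab_of_memLp ha1 mW lW
  have swW := locSlab_rpow_of_memLp ha mW lW
  have sY := locSlab_of_memLp ha1 mY lY
  have swY := locSlab_rpow_of_memLp ha mY lY
  have sX := fun i => locSlab_of_memLp ha1 (mX i) (lX i)
  have swX := fun i => locSlab_rpow_of_memLp ha (mX i) (lX i)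
  have sg := locSlab_of_locallyIntegrable hg mg eg
  refine ⟨{
    W := inSlab W', g := inSlab g', Gy := inSlab Y', Gx := fun i => inSlab (X' i), b := b'
    c := fun z => V z * b' z
    loc_W := sW, loc_wW := swW, loc_g := sg, loc_Gy := sY, loc_wGy := swY
    loc_Gx := sX, loc_wGx := swX, meas_b := mb, loc_b := lb, sq_b := (memLp_congr_ae eb).2 hb
    meas_c := hV.measurable.mul mb, loc_c := lc
    weak_trace := ?_, weak_grad := ?_, weak_eq := ?_ }, ?_, rfl, ?_, ?_⟩
  · intro κ hκ q χ hχ hc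
    have hχ' : Continuous (deriv χ) := hχ.continuous_deriv (by simp)
    have h1 := htr _ (isTest_testFn hκ hχ hc q)
    rw [integral_congr_ae (eb.mono fun z hz => by simp only [hz] :
      (fun z => b z * testFn κ χ q (onThin z)) =ᵐ[volume]
        fun z => b' z * testFn κ χ q (onThin z)), smear_thin] at h1
    rw [← h1]
    have h2 := ((SlabIntegral.of_locSlab hκ hχ' hc.deriv sW q).add
      (SlabIntegral.of_locSlab hκ hχ.continuous hc sY q))
    have h3 : ∫ p in upper n, (W p * fderiv ℝ (testFn κ χ q) p (0, 1, 0) +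
        Gy p * testFn κ χ q p) = ∫ p in upper n, (W' p * fderiv ℝ (testFn κ χ q) p (0, 1, 0) +
        Y' p * testFn κ χ q p) := by
      refine integral_congr_ae ?_
      filter_upwards [eW, eY] with p e1 e2
      rw [e1, e2]
    rw [h3, integral_upper]
    refine Eq.trans ?_ (h2.integral_eq.symm.trans ?_)
    · exact integral_congr_ae (Filter.Eventually.of_forall fun y => by simp only; ring)
    · refine integral_congr_ae (Filter.Eventually.of_forall fun w => ?_)
      simp only [fderiv_testFn hκ hχ, flat_apply, inSlab, testFn, hzero]
      ring
  · intro i κ hκ q χ hχ hc hs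
    have h1 := hgrad _ (isTest_testFn hκ hχ hc q) (tsupport_testFn_subset κ hs q)
      (EuclideanSpace.single i 1) 0
    have h2 := SlabIntegral.of_locSlab (hκ.dKer (dirX i)) hχ.continuous hc sW q
    have h3 := (SlabIntegral.of_locSlab hκ hχ.continuous hc (sX i) q).const_mul (-1)
    have h4 : ∫ p in upper n, W p * fderiv ℝ (testFn κ χ q) p (EuclideanSpace.single i 1, 0, 0) =
        -∫ w, dKer (dirX i) κ (q - w.1) * χ w.2 * inSlab W' w.1 w.2 ∂(slabMeasure n) := by
      rw [← integral_neg, integral_slab]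
      refine integral_congr_ae ?_
      filter_upwards [eW] with p e1
      simp only [inSlab, flat_apply, e1, fderiv_testFn hκ hχ, dKer, dirX]
      ring
    have h5 : ∫ p in upper n, (inner ℝ (Gx p) (EuclideanSpace.single i 1) + Gy p * 0) *
        testFn κ χ q p =
        -∫ w, -1 * (κ (q - w.1) * χ w.2 * inSlab (X' i) w.1 w.2) ∂(slabMeasure n) := by
      rw [← integral_neg, integral_slab]
      refine integral_congr_ae ?_
      filter_upwards [eX i] with p e1
      simp only [inSlab, flat_apply, e1, testFn, EuclideanSpace.inner_single_right]
      simp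
      ring
    have h6 := (h2.add h3).integral_eq
    rw [integral_add h2.integrable h3.integrable] at h6
    rw [h4, h5] at h1
    refine Eq.trans ?_ (h6.symm.trans (by linarith))
    exact integral_congr_ae (Filter.Eventually.of_forall fun y => by simp only; ring)
  · intro κ hκ q χ hχ hc
    have hχ' : Continuous (deriv χ) := hχ.continuous_deriv (by simp)
    have h1 := heq _ (isTest_testFn hκ hχ hc q)
    rw [integral_congr_ae (eb.mono fun z hz => by simp only [hz] :
      (fun z => V z * b z * testFn κ χ q (onThin z)) =ᵐ[volume]
        fun z => V z * b' z * testFn κ χ q (onThin z)), smear_thin κ χ fun z => V z * b' z] at h1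
    have h2 := ((SlabIntegral.of_locSlab hκ hχ' hc.deriv swY q).add
      ((SlabIntegral.sum Finset.univ fun i => SlabIntegral.of_locSlab (hκ.dKer (dirX i))
        hχ.continuous hc (swX i) q).const_mul (-1))).add
      ((SlabIntegral.of_locSlab (hκ.dKer (dirT n)) hχ.continuous hc swW q).const_mul (-1))
    have h3 := SlabIntegral.of_locSlab hκ hχ.continuous hc sg q
    have h4 : ∫ p in upper n, p.2.1 ^ a * (fderiv ℝ (testFn κ χ q) p (Gx p, Gy p, 0) +
        W p * fderiv ℝ (testFn κ χ q) p (0, 0, 1)) =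
        ∫ w, (κ (q - w.1) * deriv χ w.2 * (w.2 ^ a * inSlab Y' w.1 w.2) +
          -1 * ∑ i, dKer (dirX i) κ (q - w.1) * χ w.2 * (w.2 ^ a * inSlab (X' i) w.1 w.2) +
          -1 * (dKer (dirT n) κ (q - w.1) * χ w.2 * (w.2 ^ a * inSlab W' w.1 w.2)))
          ∂(slabMeasure n) := by
      rw [integral_slab]
      refine integral_congr_ae ?_
      filter_upwards [eW, eY, ae_all_iff.2 eX] with p e1 e2 e3
      rw [← e1, ← e2, fderiv_testFn hκ hχ, fderiv_testFn hκ hχ, dirX_apply_sum, Finset.sum_mul,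
        mul_add, mul_sub, Finset.mul_sum]
      simp only [dKer, ← e3, dirT, inSlab, flat_apply, Prod.mk.eta]
      have e4 : ∑ i, p.2.1 ^ a * (X' i p * fderiv ℝ κ (q - (p.1, p.2.2)) (dirX i) * χ p.2.1) =
          ∑ i, fderiv ℝ κ (q - (p.1, p.2.2)) (dirX i) * χ p.2.1 * (p.2.1 ^ a * X' i p) :=
        Finset.sum_congr rfl fun i _ => by ring
      rw [e4]
      ring
    have h5 : ∫ p in upper n, g p * testFn κ χ q p =
        ∫ w, κ (q - w.1) * χ w.2 * inSlab g' w.1 w.2 ∂(slabMeasure n) := by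
      rw [integral_slab]
      refine integral_congr_ae ?_
      filter_upwards [eg] with p e1
      simp only [inSlab, flat_apply, e1, testFn]
      ring
    have h6 := (h2.add h3).integral_eq
    rw [integral_add h2.integrable h3.integrable, ← h4, ← h5, h1] at h6
    rw [h6]
    refine integral_congr_ae (Filter.Eventually.of_forall fun y => ?_)
    simp only [smear_rpow_mul, ← Finset.mul_sum]
    ring
  · intro z y hne
    by_contra hp
    exact hne (indicator_of_notMem hp _)
  · exact measurePreserving_flat.quasiMeasurePreserving.ae eW
  · exact measurePreserving_flat.quasiMeasurePreserving.ae eg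

end
end ParabolicExtension

/-! ### Mollifiers and commutators with the potential -/

namespace ParabolicExtension

noncomputable section

variable {n : ℕ}

/-- The bump functions at scale `1 / (k + 1)`. -/
def bump (n k : ℕ) : ContDiffBump (0 : ThinPt n) where
  rIn := 1 / (k + 1)
  rOut := 2 / (k + 1)
  rIn_pos := by positivity
  rIn_lt_rOut := by gcongr; norm_num

/-- The mollifiers. -/
def moll (n k : ℕ) : ThinPt n → ℝ := (bump n k).normed volume

theorem isKernel_moll (k : ℕ) : IsKernel (moll n k) :=
  ⟨(bump n k).contDiff_normed, (bump n k).hasCompactSupport_normed⟩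

theorem moll_nonneg (k : ℕ) (z : ThinPt n) : 0 ≤ moll n k z := (bump n k).nonneg_normed z

theorem integral_moll (k : ℕ) : ∫ z, moll n k z = 1 := (bump n k).integral_normed

theorem norm_lt_of_moll_ne_zero {k : ℕ} {z : ThinPt n} (h : moll n k z ≠ 0) :
    ‖z‖ < 2 / (k + 1) := by
  have : z ∈ Function.support ((bump n k).normed volume) := h
  rw [(bump n k).support_normed_eq] at this
  simpa [bump] using this

theorem norm_le_of_fderiv_moll_ne_zero {k : ℕ} {z : ThinPt n} (h : fderiv ℝ (moll n k) z ≠ 0) :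
    ‖z‖ ≤ 2 / (k + 1) := by
  have h1 : z ∈ tsupport ((bump n k).normed volume) := by
    by_contra h2
    exact h (image_eq_zero_of_notMem_tsupport fun h3 => h2 (tsupport_fderiv_subset ℝ h3))
  rw [(bump n k).tsupport_normed_eq] at h1
  simpa [bump] using h1

theorem bump_eq (k : ℕ) (z : ThinPt n) : bump n k z = bump n 0 ((k + 1 : ℝ) • z) := by
  have h : ((2 : ℝ) / (k + 1)) / (1 / (k + 1)) = 2 / ((0 : ℕ) + 1) / (1 / ((0 : ℕ) + 1)) := by
    field_simp
  rw [ContDiffBump.apply, ContDiffBump.apply]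
  simp only [bump, h]
  simp

/-- The first moment of the gradient of a kernel. -/
def gradMoment (κ : ThinPt n → ℝ) (z : ThinPt n) : ℝ := ‖fderiv ℝ κ z‖ * ‖z‖

theorem gradMoment_nonneg (κ : ThinPt n → ℝ) (z : ThinPt n) : 0 ≤ gradMoment κ z := by
  unfold gradMoment; positivity

theorem IsKernel.continuous_gradMoment {κ : ThinPt n → ℝ} (h : IsKernel κ) :
    Continuous (gradMoment κ) :=
  (h.smooth.continuous_fderiv (by simp)).norm.mul continuous_norm

theorem IsKernel.hasCompactSupport_gradMoment {κ : ThinPt n → ℝ} (h : IsKernel κ) :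
    HasCompactSupport (gradMoment κ) :=
  (h.compact.fderiv (𝕜 := ℝ)).norm.mul_right

/-- Scale invariance: with `m = k + 1` the gradient gains a factor `m` and the moment `‖z‖` loses
it, while the normalisation compensates the change of volume. Commutators with one derivative are
therefore bounded uniformly in the scale. -/
theorem integral_gradMoment_moll (k : ℕ) :
    ∫ z, gradMoment (moll n k) z = ∫ z, gradMoment (moll n 0) z := by
  have e0 : moll n k = fun z => (∫ x, bump n k x)⁻¹ * bump n k z := by
    funext z; rw [moll, ContDiffBump.normed_def]; ring
  set m : ℝ := k + 1
  have hm : 0 < m := by positivity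
  set r := |(m ^ Module.finrank ℝ (ThinPt n))⁻¹|
  have hr : r ≠ 0 := by simp only [r, abs_ne_zero]; positivity
  have e1 : ∫ x, bump n k x = r * ∫ x, bump n 0 x := by
    simp only [bump_eq k]
    exact Measure.integral_comp_smul volume (fun x => bump n 0 x) m
  have e2 : moll n k = fun z => r⁻¹ * moll n 0 (m • z) := by
    funext z
    rw [e0, e1]
    simp only [bump_eq k, moll, ContDiffBump.normed_def]
    have := (bump n 0).integral_pos (μ := volume)
    field_simp
    rfl
  have d0 : Differentiable ℝ (moll n 0) := (isKernel_moll 0).smooth.differentiable (by simp)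
  have e3 : ∀ z, gradMoment (moll n k) z = r⁻¹ * gradMoment (moll n 0) (m • z) := by
    intro z
    have h1 : fderiv ℝ (moll n k) z = r⁻¹ • m • fderiv ℝ (moll n 0) (m • z) := by
      have h2 : DifferentiableAt ℝ (fun z => moll n 0 (m • z)) z :=
        (d0 (m • z)).comp z ((differentiable_id.const_smul m) z)
      rw [e2, fderiv_const_mul h2, fderiv_comp_smul]
    have hr0 : 0 < r⁻¹ := inv_pos.2 (abs_pos.2 (by positivity))
    rw [gradMoment, gradMoment, h1, norm_smul, norm_smul, norm_smul, Real.norm_of_nonneg hr0.le,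
      Real.norm_of_nonneg hm.le]
    ring
  simp only [e3]
  rw [integral_const_mul, Measure.integral_comp_smul volume (fun x => gradMoment (moll n 0) x) m,
    smul_eq_mul, ← mul_assoc, inv_mul_cancel₀ hr, one_mul]

/-- The kernel dominating the commutator of a mollifier with a potential. -/
def domKer (n k : ℕ) (z : ThinPt n) : ℝ := 18 * moll n k z + 4 * gradMoment (moll n k) z

theorem domKer_nonneg (k : ℕ) (z : ThinPt n) : 0 ≤ domKer n k z := by
  have := moll_nonneg k z
  have := gradMoment_nonneg (moll n k) z
  unfold domKer; positivity

theorem continuous_domKer (k : ℕ) : Continuous (domKer n k) :=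
  (continuous_const.mul (isKernel_moll k).continuous).add
    (continuous_const.mul (isKernel_moll k).continuous_gradMoment)

theorem hasCompactSupport_domKer (k : ℕ) : HasCompactSupport (domKer n k) :=
  ((isKernel_moll k).compact.mul_left (f := fun _ => (18 : ℝ))).add
    ((isKernel_moll k).hasCompactSupport_gradMoment.mul_left (f := fun _ => (4 : ℝ)))

/-- The total mass of `domKer`. -/
def domMass (n : ℕ) : ℝ := 18 + 4 * ∫ z, gradMoment (moll n 0) z

theorem domMass_nonneg : 0 ≤ domMass n := by
  have : 0 ≤ ∫ z, gradMoment (moll n 0) z := integral_nonneg fun z => gradMoment_nonneg _ z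
  unfold domMass; positivity

theorem integral_domKer (k : ℕ) : ∫ z, domKer n k z = domMass n := by
  have h1 : Integrable (moll n k) := (bump n k).integrable_normed
  have h2 : Integrable (gradMoment (moll n k)) :=
    (isKernel_moll k).continuous_gradMoment.integrable_of_hasCompactSupport
      (isKernel_moll k).hasCompactSupport_gradMoment
  unfold domKer domMass
  rw [integral_add (h1.const_mul 18) (h2.const_mul 4), integral_const_mul, integral_const_mul,
    integral_moll, integral_gradMoment_moll]
  simp

theorem norm_le_of_domKer_ne_zero {k : ℕ} {z : ThinPt n} (h : domKer n k z ≠ 0) :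
    ‖z‖ ≤ 2 / (k + 1) := by
  by_cases h1 : moll n k z = 0
  · refine norm_le_of_fderiv_moll_ne_zero fun h2 => h ?_
    simp [domKer, gradMoment, h1, h2]
  · exact (norm_lt_of_moll_ne_zero h1).le

theorem locallyIntegrable_abs {b : ThinPt n → ℝ} (hb : LocallyIntegrable b) :
    LocallyIntegrable (fun z => |b z|) := fun z =>
  let ⟨s, hs, h⟩ := hb z
  ⟨s, hs, h.abs⟩

theorem integrable_smear_of_continuous {κ : ThinPt n → ℝ} (hκ : Continuous κ)
    (hc : HasCompactSupport κ) {A : ThinPt n → ℝ} (hA : LocallyIntegrable A) (q : ThinPt n) :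
    Integrable (fun z => κ (q - z) * A z) := by
  have := hc.convolutionExists_right (ContinuousLinearMap.mul ℝ ℝ) hA hκ q
  simpa [ConvolutionExistsAt, mul_comm] using this

theorem tendsto_smear_moll {A : ThinPt n → ℝ} (hA : LocallyIntegrable A) :
    ∀ᵐ q, Filter.Tendsto (fun k => smear (moll n k) A q) Filter.atTop (nhds (A q)) := by
  have h1 : Filter.Tendsto (fun k => (bump n k).rOut) Filter.atTop (nhds 0) := by
    have := (tendsto_one_div_add_atTop_nhds_zero_nat (𝕜 := ℝ)).const_mul 2
    simpa [bump, div_eq_mul_inv] using this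
  have h2 : ∀ᶠ k in Filter.atTop, (bump n k).rOut ≤ 2 * (bump n k).rIn :=
    Filter.Eventually.of_forall fun k => le_of_eq (by simp [bump]; ring)
  filter_upwards [ContDiffBump.ae_convolution_tendsto_right_of_locallyIntegrable h1 h2 hA] with q hq
  simp only [convolution_lsmul_swap, smul_eq_mul] at hq
  exact hq

namespace Potential

variable (U : Potential n)

/-- The factor `2` is due to the maximum norm on the product: the spatial and the temporal increment
are each bounded by `‖q - z‖`. -/
theorem abs_sub_le (q z : ThinPt n) : |U.V z - U.V q| ≤ 2 * U.N * ‖q - z‖ := by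
  have h1 : ∀ x, ‖fderiv ℝ U.V x‖ ≤ 2 * U.N := fun x => by
    refine ContinuousLinearMap.opNorm_le_bound _ (by have := U.N_nonneg; positivity) fun v => ?_
    have e : v = (v.1, 0) + v.2 • ((0, 1) : ThinPt n) := by ext <;> simp
    have e2 : fderiv ℝ U.V x v = fderiv ℝ U.V x (v.1, 0) + v.2 * fderiv ℝ U.V x (0, 1) := by
      conv_lhs => rw [e]
      rw [map_add, map_smul, smul_eq_mul]
    rw [e2]
    have hN := U.N_nonneg
    have f1 := norm_fst_le v
    have f2 := norm_snd_le v
    calc ‖fderiv ℝ U.V x (v.1, 0) + v.2 * fderiv ℝ U.V x (0, 1)‖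
        ≤ |fderiv ℝ U.V x (v.1, 0)| + |v.2| * |fderiv ℝ U.V x (0, 1)| := by
          refine (norm_add_le _ _).trans (le_of_eq ?_)
          rw [norm_mul]; rfl
      _ ≤ U.N * ‖v.1‖ + ‖v.2‖ * U.N := by
          have := U.spatial_le x v.1
          have := U.time_le x
          rw [Real.norm_eq_abs v.2]
          gcongr
      _ ≤ U.N * ‖v‖ + ‖v‖ * U.N := by gcongr
      _ = _ := by ring
  have h2 := Convex.norm_image_sub_le_of_norm_fderiv_le (𝕜 := ℝ) (s := univ) (C := 2 * U.N)
    (fun x _ => U.contDiff.differentiable one_ne_zero x) (fun x _ => h1 x) convex_univ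
    (mem_univ q) (mem_univ z)
  rwa [norm_sub_rev z q] at h2

theorem locallyIntegrable_mul {b : ThinPt n → ℝ} (hb : LocallyIntegrable b) :
    LocallyIntegrable (fun z => U.V z * b z) := by
  rw [locallyIntegrable_iff]
  intro k hk
  exact (hb.integrableOn_isCompact hk).continuousOn_mul U.contDiff.continuous.continuousOn hk

/-- The commutator of smearing with multiplication by the potential. -/
theorem abs_commutator_le {κ k' : ThinPt n → ℝ} (hκ : Continuous κ) (hc : HasCompactSupport κ)
    (hk : Continuous k') (hkc : HasCompactSupport k') {b : ThinPt n → ℝ}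
    (hb : LocallyIntegrable b) {M : ℝ}
    (hM : ∀ z, |κ z| * ‖z‖ ≤ M * k' z) (q : ThinPt n) :
    |smear κ (fun z => U.V z * b z) q - U.V q * smear κ b q| ≤
      2 * U.N * M * smear k' (fun z => |b z|) q := by
  have i1 := integrable_smear_of_continuous hκ hc (U.locallyIntegrable_mul hb) q
  have i2 := integrable_smear_of_continuous hκ hc hb q
  have i3 := integrable_smear_of_continuous hk hkc (locallyIntegrable_abs hb) q
  have hN := U.N_nonneg
  unfold smear
  rw [← integral_const_mul, ← integral_sub i1 (i2.const_mul _), ← integral_const_mul]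
  refine abs_integral_le_integral_abs.trans (integral_mono (i1.sub (i2.const_mul _)).abs
    (i3.const_mul _) fun z => ?_)
  calc |κ (q - z) * (U.V z * b z) - U.V q * (κ (q - z) * b z)|
      = |κ (q - z)| * |U.V z - U.V q| * |b z| := by rw [← abs_mul, ← abs_mul]; ring_nf
    _ ≤ |κ (q - z)| * (2 * U.N * ‖q - z‖) * |b z| := by
        have := U.abs_sub_le q z
        gcongr
    _ = 2 * U.N * (|κ (q - z)| * ‖q - z‖) * |b z| := by ring
    _ ≤ 2 * U.N * (M * k' (q - z)) * |b z| := by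
        have := hM (q - z)
        gcongr
    _ = _ := by ring

end Potential

theorem abs_smear_le {κ : ThinPt n → ℝ} (hκ0 : ∀ z, 0 ≤ κ z) (b : ThinPt n → ℝ) (q : ThinPt n) :
    |smear κ b q| ≤ smear κ (fun z => |b z|) q := by
  refine abs_integral_le_integral_abs.trans (le_of_eq ?_)
  refine integral_congr_ae (Filter.Eventually.of_forall fun z => ?_)
  simp only [abs_mul, abs_of_nonneg (hκ0 _)]

namespace SlabSolution

variable {C : CarlemanParams n} {S : SlabSolution n C.a}

/-- Friedrichs' commutator estimate. The error itself gains the scale `2/(k+1)`, which compensates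
the factor `α` once `α ≤ k + 1` and contributes `16` copies of the mollifier. Each of the two
differentiated errors contributes `2` copies of `gradMoment` and, through the derivative of `V`, one
copy of the mollifier. This explains the coefficients `18` and `4` in `domKer`. -/
theorem commDensity_le (U : Potential n) (hc : S.c = fun z => U.V z * S.b z) {k : ℕ}
    (h : Concentrated S C.c (moll n k)) (hk : C.α ≤ k + 1) (q : ThinPt n) :
    (S.profile C.a_lt_one (isKernel_moll k) h).commDensity U q ≤
      C.wK.fn (radSq q 0) * |smear (moll n k) S.b q| *
        (U.N * smear (domKer n k) (fun z => |S.b z|) q) := by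
  set p := S.profile C.a_lt_one (isKernel_moll k) h
  have hκ := isKernel_moll (n := n) k
  have hu : p.u q 0 = smear (moll n k) S.b q := value_zero _ _ q
  have hP : p.P q 0 = smear (moll n k) (fun z => U.V z * S.b z) q := by
    rw [← hc]; exact conormal_zero _ _ q
  have hd : ∀ e, S.conormal (dKer e (moll n k)) (dKer e (kerL (moll n k))) q 0 =
      smear (dKer e (moll n k)) (fun z => U.V z * S.b z) q := fun e => by
    rw [← hc]; exact conormal_zero _ _ q
  have hdv : ∀ e, S.value (dKer e (moll n k)) (dKer e (kerL (moll n k))) q 0 =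
      smear (dKer e (moll n k)) S.b q := fun e => value_zero _ _ q
  by_cases hq : ‖q.1‖ ≤ 1
  swap
  · have h1 : p.u q 0 = 0 := by
      refine (profile_supportedIn hκ h q 0 le_rfl (Or.inr ?_)).1
      simp only [radSq]; nlinarith
    rw [Profile.commDensity, ← hu, h1]
    simp
  have hK := C.wK_nonneg (radSq q 0)
  have hN := U.N_nonneg
  have ib := S.loc_b
  have hM0 : 0 ≤ smear (moll n k) (fun z => |S.b z|) q :=
    integral_nonneg fun z => mul_nonneg (moll_nonneg k _) (abs_nonneg _)
  have hG0 : 0 ≤ smear (gradMoment (moll n k)) (fun z => |S.b z|) q :=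
    integral_nonneg fun z => mul_nonneg (gradMoment_nonneg _ _) (abs_nonneg _)
  have hsum : smear (domKer n k) (fun z => |S.b z|) q =
      18 * smear (moll n k) (fun z => |S.b z|) q +
        4 * smear (gradMoment (moll n k)) (fun z => |S.b z|) q := by
    simp only [smear, domKer, ← integral_const_mul]
    rw [← integral_add]
    · exact integral_congr_ae (Filter.Eventually.of_forall fun z => by ring)
    · exact (integrable_smear_of_continuous hκ.continuous hκ.compact (locallyIntegrable_abs ib) q).const_mul _
    · exact (integrable_smear_of_continuous hκ.continuous_gradMoment
        hκ.hasCompactSupport_gradMoment (locallyIntegrable_abs ib) q).const_mul _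
  have b1 : 4 * C.α * |p.err U q 0| ≤ 16 * U.N * smear (moll n k) (fun z => |S.b z|) q := by
    have h1 := U.abs_commutator_le (M := 2 / (k + 1)) hκ.continuous hκ.compact hκ.continuous
      hκ.compact ib (fun z => by
        rw [abs_of_nonneg (moll_nonneg k z), mul_comm]
        by_cases hz : moll n k z = 0
        · simp [hz]
        · exact mul_le_mul_of_nonneg_right (norm_lt_of_moll_ne_zero hz).le (moll_nonneg k z)) q
    -- Here the mollification scale is compared with `1/α`; without it the commutator would carry a
    -- factor `α`.
    have h2 : C.α * (2 / (k + 1)) ≤ 2 := by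
      rw [mul_div_assoc', div_le_iff₀ (by positivity)]; linarith
    simp only [Profile.err, hu, hP]
    have hα := C.α_pos
    calc _ ≤ 4 * C.α * (2 * U.N * (2 / (k + 1)) * smear (moll n k) (fun z => |S.b z|) q) := by
          gcongr
      _ = 8 * U.N * (C.α * (2 / (k + 1))) * smear (moll n k) (fun z => |S.b z|) q := by ring
      _ ≤ 8 * U.N * 2 * smear (moll n k) (fun z => |S.b z|) q := by gcongr
      _ = _ := by ring
  have hder : ∀ e : ThinPt n, ‖e‖ ≤ 1 → |smear (dKer e (moll n k)) (fun z => U.V z * S.b z) q -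
      U.V q * smear (dKer e (moll n k)) S.b q| ≤
        2 * U.N * smear (gradMoment (moll n k)) (fun z => |S.b z|) q := fun e he => by
    have h1 := U.abs_commutator_le (M := 1) (hκ.dKer e).continuous (hκ.dKer e).compact
      hκ.continuous_gradMoment hκ.hasCompactSupport_gradMoment ib (fun z => by
        rw [one_mul, gradMoment]
        refine mul_le_mul_of_nonneg_right ?_ (norm_nonneg z)
        exact ((fderiv ℝ (moll n k) z).le_opNorm e).trans
          (mul_le_of_le_one_right (norm_nonneg _) he)) q
    rwa [mul_one] at h1
  have hsm := abs_smear_le (moll_nonneg (n := n) k) S.b q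
  have b2 : |∑ i, q.1 i * p.errX U i q 0| ≤
      2 * U.N * smear (gradMoment (moll n k)) (fun z => |S.b z|) q +
        U.N * smear (moll n k) (fun z => |S.b z|) q := by
    have hlin : ∀ {A : ThinPt n → ℝ}, LocallyIntegrable A →
        ∑ i, q.1 i * smear (dKer (dirX i) (moll n k)) A q =
          smear (dKer (q.1, 0) (moll n k)) A q := fun {A} hA => by
      simp only [smear, ← integral_const_mul]
      rw [← integral_finsetSum _ fun i _ => ((hκ.dKer (dirX i)).integrable_smear hA q).const_mul _]
      refine integral_congr_ae (Filter.Eventually.of_forall fun z => ?_)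
      simp only [dKer]
      rw [dirX_apply_sum, Finset.sum_mul]
      exact Finset.sum_congr rfl fun i _ => by ring
    have e1 : ∑ i, q.1 i * p.errX U i q 0 =
        (smear (dKer (q.1, 0) (moll n k)) (fun z => U.V z * S.b z) q -
          U.V q * smear (dKer (q.1, 0) (moll n k)) S.b q) -
          fderiv ℝ U.V q (q.1, 0) * smear (moll n k) S.b q := by
      rw [← hlin ib, ← hlin (U.locallyIntegrable_mul ib), ← U.sum_coord q q.1, Finset.mul_sum,
        Finset.sum_mul, ← Finset.sum_sub_distrib, ← Finset.sum_sub_distrib]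
      refine Finset.sum_congr rfl fun i _ => ?_
      simp only [Profile.errX, hu]
      rw [show p.Pi i q 0 = _ from hd (dirX i), show p.ui i q 0 = _ from hdv (dirX i)]
      ring
    have he : ‖((q.1, 0) : ThinPt n)‖ ≤ 1 := by simpa [Prod.norm_def] using hq
    have hV : |fderiv ℝ U.V q (q.1, 0)| ≤ U.N :=
      (U.spatial_le q q.1).trans (mul_le_of_le_one_right hN hq)
    rw [e1]
    refine (abs_sub _ _).trans (add_le_add (hder _ he) ?_)
    rw [abs_mul]
    exact mul_le_mul hV hsm (abs_nonneg _) hN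
  have b3 : |p.errT U q 0| ≤
      2 * U.N * smear (gradMoment (moll n k)) (fun z => |S.b z|) q +
        U.N * smear (moll n k) (fun z => |S.b z|) q := by
    have e1 : p.errT U q 0 =
        (smear (dKer (dirT n) (moll n k)) (fun z => U.V z * S.b z) q -
          U.V q * smear (dKer (dirT n) (moll n k)) S.b q) -
          fderiv ℝ U.V q (dirT n) * smear (moll n k) S.b q := by
      simp only [Profile.errT, hu]
      rw [show p.Pt q 0 = _ from hd (dirT n), show p.ut q 0 = _ from hdv (dirT n)]
      ring
    have he : ‖dirT n‖ ≤ 1 := by simp [dirT, Prod.norm_def]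
    rw [e1]
    refine (abs_sub _ _).trans (add_le_add (hder _ he) ?_)
    rw [abs_mul]
    exact mul_le_mul (U.time_le q) hsm (abs_nonneg _) hN
  rw [Profile.commDensity, hu, hsum]
  refine mul_le_mul_of_nonneg_left ?_ (by positivity)
  linarith

end SlabSolution

end
end ParabolicExtension

/-! ### Jensen's inequality for convolutions with slowly varying weights -/

namespace ParabolicExtension

noncomputable section

variable {n : ℕ}

theorem sq_lintegral_le {X : Type*} [MeasurableSpace X] (μ : Measure X) {f : X → ℝ≥0∞}
    (hf : AEMeasurable f μ) : (∫⁻ x, f x ∂μ) ^ 2 ≤ μ univ * ∫⁻ x, f x ^ 2 ∂μ := by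
  have h := ENNReal.lintegral_mul_le_Lp_mul_Lq μ Real.HolderConjugate.two_two hf
    (aemeasurable_const (b := (1 : ℝ≥0∞)))
  simp only [Pi.mul_apply, mul_one, ENNReal.one_rpow, lintegral_one] at h
  have h2 : ∀ t : ℝ≥0∞, (t ^ ((1 : ℝ) / 2)) ^ 2 = t := fun t => by
    rw [← ENNReal.rpow_natCast, ← ENNReal.rpow_mul]; simp
  calc (∫⁻ x, f x ∂μ) ^ 2
      ≤ ((∫⁻ x, f x ^ (2 : ℝ) ∂μ) ^ ((1 : ℝ) / 2) * μ univ ^ ((1 : ℝ) / 2)) ^ 2 := by gcongr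
    _ = _ := by
      rw [mul_pow, h2, h2, mul_comm]
      simp

/-- Jensen's inequality for convolutions, with slowly varying weights. -/
theorem lintegral_mul_sq_convolution_le {k F w w' : ThinPt n → ℝ≥0∞} {m : ℝ≥0∞}
    (hk : Measurable k) (hF : Measurable F) (hw : Measurable w)
    (hm : ∫⁻ z, k z = m) (hm' : m ≠ ⊤)
    (h : ∀ᵐ z, F z ≠ 0 → ∀ q, k (q - z) ≠ 0 → w q ≤ 2 * w' z) :
    ∫⁻ q, w q * (∫⁻ z, k (q - z) * F z) ^ 2 ≤ 2 * m ^ 2 * ∫⁻ z, w' z * F z ^ 2 := by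
  have hkq : ∀ q, Measurable fun z => k (q - z) := fun q => by fun_prop
  -- Cauchy–Schwarz for the measure `k (q - z) dz`, whose total mass is `m`; the second factor `m`
  -- appears after exchanging the integrals.
  have h1 : ∀ q, w q * (∫⁻ z, k (q - z) * F z) ^ 2 ≤
      ∫⁻ z, m * (w q * (k (q - z) * F z ^ 2)) := fun q => by
    have := sq_lintegral_le (volume.withDensity fun z => k (q - z)) hF.aemeasurable
    rw [lintegral_withDensity_eq_lintegral_mul _ (hkq q) hF,
      lintegral_withDensity_eq_lintegral_mul _ (hkq q) (hF.pow_const 2),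
      withDensity_apply _ MeasurableSet.univ, Measure.restrict_univ,
      lintegral_sub_left_eq_self k q, hm] at this
    simp only [Pi.mul_apply] at this
    rw [lintegral_const_mul _ (by fun_prop), lintegral_const_mul _ (by fun_prop)]
    calc _ ≤ w q * (m * ∫⁻ z, k (q - z) * F z ^ 2) := by gcongr
      _ = _ := by ring
  calc ∫⁻ q, w q * (∫⁻ z, k (q - z) * F z) ^ 2
      ≤ ∫⁻ q, ∫⁻ z, m * (w q * (k (q - z) * F z ^ 2)) := lintegral_mono h1
    _ = ∫⁻ z, ∫⁻ q, m * (w q * (k (q - z) * F z ^ 2)) :=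
        lintegral_lintegral_swap (by fun_prop)
    _ ≤ ∫⁻ z, 2 * m ^ 2 * (w' z * F z ^ 2) := by
        refine lintegral_mono_ae ?_
        filter_upwards [h] with z hz
        by_cases hF0 : F z = 0
        · simp [hF0]
        calc ∫⁻ q, m * (w q * (k (q - z) * F z ^ 2))
            ≤ ∫⁻ q, m * (2 * w' z * F z ^ 2) * k (q - z) := by
              refine lintegral_mono fun q => ?_
              by_cases hk0 : k (q - z) = 0
              · simp [hk0]
              calc m * (w q * (k (q - z) * F z ^ 2))
                  ≤ m * (2 * w' z * (k (q - z) * F z ^ 2)) := by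
                    have := hz hF0 q hk0
                    gcongr
                _ = _ := by ring
          _ = m * (2 * w' z * F z ^ 2) * m := by
              rw [lintegral_const_mul _ (by fun_prop), lintegral_sub_right_eq_self k z, hm]
          _ = _ := by ring
    _ ≤ _ := (lintegral_const_mul' _ _ ?_).le
  exact ENNReal.mul_ne_top (by simp) (ENNReal.pow_ne_top hm')

/-- Weighted Jensen inequality for the convolution with a nonnegative kernel. -/
theorem lintegral_mul_sq_smear_le {κ A : ThinPt n → ℝ} (hκ : Continuous κ)
    (hc : HasCompactSupport κ) (h0 : ∀ z, 0 ≤ κ z) {m : ℝ} (hm : ∫ z, κ z = m)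
    (hA : Measurable A) {w w' : ThinPt n → ℝ≥0∞} (hw : Measurable w)
    (h : ∀ᵐ z, A z ≠ 0 → ∀ q, κ (q - z) ≠ 0 → w q ≤ 2 * w' z) :
    ∫⁻ q, w q * ‖smear κ A q‖ₑ ^ 2 ≤
      2 * ENNReal.ofReal m ^ 2 * ∫⁻ z, w' z * ‖A z‖ₑ ^ 2 := by
  have hm' : ∫⁻ z, ‖κ z‖ₑ = ENNReal.ofReal m := by
    rw [← hm, ofReal_integral_eq_lintegral_ofReal (hκ.integrable_of_hasCompactSupport hc)
      (Filter.Eventually.of_forall h0)]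
    exact lintegral_congr fun z => by rw [Real.enorm_of_nonneg (h0 z)]
  have h1 := lintegral_mul_sq_convolution_le (k := fun z => ‖κ z‖ₑ) (F := fun z => ‖A z‖ₑ)
    hκ.measurable.enorm hA.enorm hw hm' ENNReal.ofReal_ne_top (by
      filter_upwards [h] with z hz hz0 q hq
      exact hz (by simpa using hz0) q (by simpa using hq))
  refine le_trans (lintegral_mono fun q => ?_) h1
  gcongr
  refine (enorm_integral_le_lintegral_enorm _).trans (le_of_eq ?_)
  exact lintegral_congr fun z => enorm_mul _ _

theorem ofReal_mul_sq {w : ℝ} (hw : 0 ≤ w) (x : ℝ) :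
    ENNReal.ofReal (w * x ^ 2) = ENNReal.ofReal w * ‖x‖ₑ ^ 2 := by
  rw [ENNReal.ofReal_mul hw, ← sq_abs, ENNReal.ofReal_pow (abs_nonneg x), Real.enorm_eq_ofReal_abs]

/-- Positive continuous radial weights vary slowly away from the origin. -/
theorem exists_radial_le {φ : ℝ → ℝ} (hφ : ContinuousOn φ (Ioi 0)) (hpos : ∀ s, 0 < s → 0 < φ s)
    {c : ℝ} (hc : 0 < c) : ∃ δ > 0, ∀ q ∈ Metric.closedBall (0 : ThinPt n) 4, ∀ y ∈ Icc (0 : ℝ) 2,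
      c ≤ radSq q y → ∀ z, ‖q - z‖ < δ → φ (radSq q y) ≤ 2 * φ (radSq z y) := by
  set 𝒦 : Set (ThinPt n × ℝ) :=
    (Metric.closedBall 0 4 ×ˢ Icc 0 2) ∩ {p | c ≤ radSq p.1 p.2}
  have hK : IsCompact 𝒦 := ((isCompact_closedBall _ _).prod isCompact_Icc).inter_right
    (isClosed_le continuous_const continuous_radSq)
  -- At zero shift the inequality is strict because `φ < 2 φ`, so it persists for small shifts,
  -- uniformly on the compact set.
  have h := hK.eventually_forall_of_forall_eventually (x₀ := (0 : ThinPt n))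
    (P := fun h p => φ (radSq p.1 p.2) ≤ 2 * φ (radSq (p.1 - h) p.2)) fun p hp => by
      have hs : 0 < radSq p.1 p.2 := lt_of_lt_of_le hc hp.2
      have hφc : ContinuousAt φ (radSq p.1 p.2) := hφ.continuousAt (Ioi_mem_nhds hs)
      have r1 : Filter.Tendsto (fun z : ThinPt n × ThinPt n × ℝ => radSq z.2.1 z.2.2)
          (nhds (0, p)) (nhds (radSq p.1 p.2)) :=
        (continuous_radSq.comp continuous_snd).tendsto' _ _ rfl
      have r2 : Filter.Tendsto (fun z : ThinPt n × ThinPt n × ℝ => radSq (z.2.1 - z.1) z.2.2)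
          (nhds (0, p)) (nhds (radSq p.1 p.2)) :=
        (continuous_radSq.comp (f := fun z : ThinPt n × ThinPt n × ℝ => (z.2.1 - z.1, z.2.2))
          (by fun_prop)).tendsto' _ _ (by simp)
      have t1 := hφc.tendsto.comp r1
      have t2 := (hφc.tendsto.comp r2).const_mul 2
      have := t1.eventually_lt t2 (by have := hpos _ hs; linarith)
      exact this.mono fun z hz => hz.le
  rw [Metric.eventually_nhds_iff] at h
  obtain ⟨δ, hδ, hh⟩ := h
  refine ⟨δ, hδ, fun q hq y hy hr z hz => ?_⟩
  have := hh (y := q - z) (by simpa using hz) (q, y) ⟨⟨hq, hy⟩, hr⟩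
  simpa using this

theorem continuousOn_carlemanFn (α ε : ℝ) : ContinuousOn (carlemanFn α ε) (Ioi 0) :=
  fun _ hs => (hasDerivAt_carlemanFn (D := 0) hs).continuousAt.continuousWithinAt

theorem CarlemanParams.wK_le (C : CarlemanParams n) {s : ℝ} (hs : 0 ≤ s) :
    C.wK.fn s ≤ carlemanFn C.α C.ε s := by
  rw [wK, RadialWeight.extend_fn_apply]
  exact mul_le_of_le_one_left (carlemanFn_nonneg hs) (window_le_one _ _)

theorem CarlemanParams.wK_eq_zero (C : CarlemanParams n) {s : ℝ} (hs : s ≤ C.c / 2) :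
    C.wK.fn s = 0 := by
  rw [wK, RadialWeight.extend_fn_apply, window, cutoff_eq_zero C.c_pos hs]; simp

theorem CarlemanParams.wK_eq (C : CarlemanParams n) {s : ℝ} (h : C.c ≤ s) (h1 : s ≤ 1) :
    C.wK.fn s = carlemanFn C.α C.ε s := RadialWeight.extend_fn h h1

end
end ParabolicExtension

/-! ### The boundary commutator is controlled by the trace mass -/

namespace ParabolicExtension

noncomputable section

namespace SlabSolution

variable {n : ℕ} {C : CarlemanParams n} {S : SlabSolution n C.a}

/-- The trace of the mollified solution vanishes on the far set, and it converges almost everywhere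
to `b`. Thus the support of the trace is inherited from that of the solution. -/
theorem ae_b_eq_zero {k₀ : ℕ} (h : ∀ k, k₀ ≤ k → Concentrated S C.c (moll n k)) :
    ∀ᵐ z, (z, (0 : ℝ)) ∈ farSet n C.c → S.b z = 0 := by
  filter_upwards [tendsto_smear_moll S.loc_b] with z hz hfar
  refine tendsto_nhds_unique hz (tendsto_const_nhds.congr' ?_)
  filter_upwards [Filter.eventually_ge_atTop k₀] with k hk
  have := (h k hk).value_eq_zero C.a_lt_one (isKernel_moll k) le_rfl hfar
  rw [value_zero] at this
  exact this.symm

/-- The thin weight. -/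
def thinWeight (C : CarlemanParams n) : ThinPt n → ℝ≥0∞ :=
  (Metric.closedBall 0 4).indicator fun q => ENNReal.ofReal (C.wK.fn (radSq q 0))

theorem measurable_thinWeight : Measurable (thinWeight C) := by
  refine Measurable.indicator ?_ measurableSet_closedBall
  exact (C.wK.continuous_fn.comp (continuous_radSq.comp
    (f := fun q : ThinPt n => (q, (0 : ℝ))) (by fun_prop))).measurable.ennreal_ofReal

theorem lintegral_thinWeight (A : ThinPt n → ℝ) :
    ∫⁻ q, thinWeight C q * ‖A q‖ₑ ^ 2 =
      ∫⁻ q in Metric.closedBall 0 4, ENNReal.ofReal (C.wK.fn (radSq q 0) * A q ^ 2) := by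
  rw [← lintegral_indicator measurableSet_closedBall]
  refine lintegral_congr fun q => ?_
  by_cases hq : q ∈ Metric.closedBall (0 : ThinPt n) 4
  · rw [thinWeight, indicator_of_mem hq, indicator_of_mem hq, ofReal_mul_sq (C.wK_nonneg _)]
  · rw [thinWeight, indicator_of_notMem hq, indicator_of_notMem hq, zero_mul]

/-- The truncated weight is bounded and `b` is square integrable. Finiteness is needed to keep a
definite fraction of the trace mass in the next limit. -/
theorem lintegral_thin_ne_top : ∫⁻ q, thinWeight C q * ‖S.b q‖ₑ ^ 2 ≠ ⊤ := by
  have hcont : Continuous fun q : ThinPt n => C.wK.fn (radSq q 0) :=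
    C.wK.continuous_fn.comp (continuous_radSq.comp
      (f := fun q : ThinPt n => (q, (0 : ℝ))) (by fun_prop))
  obtain ⟨B, hB⟩ := (isCompact_closedBall (0 : ThinPt n) 4).exists_bound_of_continuousOn
    hcont.continuousOn
  rw [lintegral_thinWeight]
  have h1 : IntegrableOn (fun q => B * S.b q ^ 2) (Metric.closedBall 0 4) :=
    (S.sq_b.integrable_sq.const_mul B).integrableOn
  refine ne_top_of_le_ne_top h1.lintegral_lt_top.ne (lintegral_mono_ae ?_)
  filter_upwards [ae_restrict_mem measurableSet_closedBall] with q hq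
  refine ENNReal.ofReal_le_ofReal (mul_le_mul_of_nonneg_right ?_ (sq_nonneg _))
  exact (le_abs_self _).trans (hB q hq)

theorem ofReal_traceMass {k : ℕ} (h : Concentrated S C.c (moll n k)) :
    ENNReal.ofReal (S.profile C.a_lt_one (isKernel_moll k) h).traceMass =
      ∫⁻ q, thinWeight C q * ‖smear (moll n k) S.b q‖ₑ ^ 2 := by
  rw [lintegral_thinWeight, Profile.traceMass, ofReal_integral_eq_lintegral_ofReal]
  · refine lintegral_congr fun q => ?_
    rw [show (S.profile C.a_lt_one (isKernel_moll k) h).u q 0 = _ from value_zero _ _ q]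
  · exact BoxBounded.integrableOn_zero (Y := 2) (by norm_num)
      ((BoxBounded.radial C.wK.continuous_fn).mul ((Profile.bdd_u _).pow 2))
  · exact Filter.Eventually.of_forall fun q => mul_nonneg (C.wK_nonneg _) (sq_nonneg _)

/-- By Fatou's lemma the limit inferior of the mollified masses is at least the mass of `b`, hence
exceeds half of it when this is finite and positive. It lets commutator bounds in terms of `b` be
restated in terms of the mollified trace. -/
theorem eventually_lintegral_thin_le :
    ∀ᶠ k in Filter.atTop, ∫⁻ q, thinWeight C q * ‖S.b q‖ₑ ^ 2 ≤
      2 * ∫⁻ q, thinWeight C q * ‖smear (moll n k) S.b q‖ₑ ^ 2 := by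
  set T := ∫⁻ q, thinWeight C q * ‖S.b q‖ₑ ^ 2
  have hT : T ≠ ⊤ := lintegral_thin_ne_top
  rcases eq_or_ne T 0 with h0 | h0
  · exact Filter.Eventually.of_forall fun k => by rw [h0]; exact zero_le
  have hm : ∀ k, Measurable fun q => thinWeight C q * ‖smear (moll n k) S.b q‖ₑ ^ 2 := fun k =>
    measurable_thinWeight.mul
      (((isKernel_moll k).continuous_smear S.loc_b).measurable.enorm.pow_const 2)
  have h1 : T ≤ Filter.liminf (fun k => ∫⁻ q, thinWeight C q * ‖smear (moll n k) S.b q‖ₑ ^ 2)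
      Filter.atTop := by
    refine le_trans (le_of_eq ?_) (lintegral_liminf_le hm)
    refine lintegral_congr_ae ?_
    filter_upwards [tendsto_smear_moll S.loc_b] with q hq
    refine (Filter.Tendsto.liminf_eq ?_).symm
    refine ENNReal.Tendsto.const_mul ?_ (Or.inr ?_)
    · exact ((ENNReal.continuous_pow 2).tendsto _).comp ((continuous_enorm.tendsto _).comp hq)
    · unfold thinWeight
      by_cases hq4 : q ∈ Metric.closedBall (0 : ThinPt n) 4
      · rw [indicator_of_mem hq4]; exact ENNReal.ofReal_ne_top
      · rw [indicator_of_notMem hq4]; simp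
  have h2 : T / 2 < Filter.liminf
      (fun k => ∫⁻ q, thinWeight C q * ‖smear (moll n k) S.b q‖ₑ ^ 2) Filter.atTop :=
    (ENNReal.half_lt_self h0 hT).trans_le h1
  filter_upwards [Filter.eventually_lt_of_lt_liminf h2] with k hk
  rw [← ENNReal.div_le_iff' (by simp) (by simp)]
  exact hk.le

theorem tendsto_scale {δ : ℝ} (hδ : 0 < δ) : ∀ᶠ k : ℕ in Filter.atTop, 2 / ((k : ℝ) + 1) < δ := by
  have := (tendsto_one_div_add_atTop_nhds_zero_nat (𝕜 := ℝ)).const_mul 2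
  rw [mul_zero] at this
  filter_upwards [this.eventually_lt_const hδ] with k hk
  simpa [div_eq_mul_inv] using hk

/-- The truncated weight is not itself slowly varying, but it is dominated by the Carleman weight
and agrees with it on the support of `b`. Below `c/2` it vanishes, so slow variation is only needed
away from the origin. -/
theorem eventually_lintegral_dom_le {k₀ : ℕ}
    (h : ∀ k, k₀ ≤ k → Concentrated S C.c (moll n k)) :
    ∀ᶠ k in Filter.atTop,
      ∫⁻ q, thinWeight C q * ‖smear (domKer n k) (fun z => |S.b z|) q‖ₑ ^ 2 ≤
        2 * ENNReal.ofReal (domMass n) ^ 2 * ∫⁻ q, thinWeight C q * ‖S.b q‖ₑ ^ 2 := by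
  obtain ⟨δ, hδ, hcmp⟩ := exists_radial_le (n := n) (continuousOn_carlemanFn C.α C.ε)
    (fun s hs => carlemanFn_pos hs) (half_pos C.c_pos)
  filter_upwards [tendsto_scale hδ] with k hk
  have h1 := lintegral_mul_sq_smear_le (continuous_domKer (n := n) k) (hasCompactSupport_domKer k)
    (domKer_nonneg k) (integral_domKer k) S.meas_b.abs (measurable_thinWeight (C := C))
    (w' := thinWeight C) (by
      filter_upwards [ae_b_eq_zero h] with z hz hbz q hq
      have hz0 : (z, (0 : ℝ)) ∉ farSet n C.c := fun hf => hbz (by simp [hz hf])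
      simp only [farSet, mem_ofPred_eq, not_or, not_lt] at hz0
      have hz4 : z ∈ Metric.closedBall (0 : ThinPt n) 4 := by
        rw [mem_closedBall_zero_iff]; linarith [hz0.2.2]
      by_cases hq4 : q ∈ Metric.closedBall (0 : ThinPt n) 4
      swap
      · rw [thinWeight, indicator_of_notMem hq4]; exact zero_le
      rw [thinWeight, indicator_of_mem hq4, indicator_of_mem hz4, ← ENNReal.ofReal_ofNat,
        ← ENNReal.ofReal_mul (by norm_num)]
      refine ENNReal.ofReal_le_ofReal ?_
      rw [C.wK_eq hz0.1 hz0.2.1]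
      have hs0 : 0 ≤ radSq q 0 := by unfold radSq; positivity
      rcases le_or_gt (C.c / 2) (radSq q 0) with hr | hr
      · refine (C.wK_le hs0).trans (hcmp q hq4 0 ⟨le_rfl, by norm_num⟩ hr z ?_)
        exact (norm_le_of_domKer_ne_zero hq).trans_lt hk
      · rw [C.wK_eq_zero hr.le]
        have := carlemanFn_pos (α := C.α) (ε := C.ε) (C.c_pos.trans_le hz0.1)
        positivity)
  simpa using h1

/-- The commutator bound for the mollified solutions. -/
theorem eventually_commDensity_le (U : Potential n) (hc : S.c = fun z => U.V z * S.b z) {k₀ : ℕ}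
    (h : ∀ k, k₀ ≤ k → Concentrated S C.c (moll n k)) :
    ∀ᶠ k in Filter.atTop, ∀ hk : Concentrated S C.c (moll n k),
      ∫ q in Metric.closedBall 0 4,
          (S.profile C.a_lt_one (isKernel_moll k) hk).commDensity U q ≤
        (1 + 4 * domMass n ^ 2) / 2 * U.N *
          (S.profile C.a_lt_one (isKernel_moll k) hk).traceMass := by
  obtain ⟨k₁, hk₁⟩ := exists_nat_ge C.α
  filter_upwards [eventually_lintegral_dom_le h, eventually_lintegral_thin_le (S := S),
    Filter.eventually_ge_atTop k₁] with k e1 e2 e3 hk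
  set p := S.profile C.a_lt_one (isKernel_moll k) hk
  set D := smear (domKer n k) (fun z => |S.b z|)
  have hN := U.N_nonneg
  have hDc : Continuous D := by
    simp only [D]
    rw [smear_eq_convolution]
    exact (hasCompactSupport_domKer k).continuous_convolution_right _
      (locallyIntegrable_abs S.loc_b) (continuous_domKer k)
  have hKc : Continuous fun q : ThinPt n => C.wK.fn (radSq q 0) :=
    C.wK.continuous_fn.comp (continuous_radSq.comp
      (f := fun q : ThinPt n => (q, (0 : ℝ))) (by fun_prop))
  have hbc := (isKernel_moll k).continuous_smear S.loc_b
  have hi : ∀ {F : ThinPt n → ℝ}, Continuous F →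
      IntegrableOn F (Metric.closedBall 0 4) := fun hF =>
    hF.continuousOn.integrableOn_compact (isCompact_closedBall _ _)
  have iD : IntegrableOn (fun q => C.wK.fn (radSq q 0) * D q ^ 2) (Metric.closedBall 0 4) :=
    hi (hKc.mul (hDc.pow 2))
  have iB : IntegrableOn (fun q => C.wK.fn (radSq q 0) * smear (moll n k) S.b q ^ 2)
      (Metric.closedBall 0 4) := hi (hKc.mul (hbc.pow 2))
  have hT : p.traceMass = ∫ q in Metric.closedBall 0 4,
      C.wK.fn (radSq q 0) * smear (moll n k) S.b q ^ 2 := by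
    rw [Profile.traceMass]
    refine integral_congr_ae (Filter.Eventually.of_forall fun q => ?_)
    simp only
    rw [show p.u q 0 = _ from value_zero _ _ q]
  have hT0 : 0 ≤ p.traceMass := Profile.traceMass_nonneg
  -- The constant `4` combines the factor `2` of the Jensen inequality with the factor `2` lost in
  -- passing from `b` to its mollification.
  have hX : ∫ q in Metric.closedBall 0 4, C.wK.fn (radSq q 0) * D q ^ 2 ≤
      4 * domMass n ^ 2 * p.traceMass := by
    have hm := domMass_nonneg (n := n)
    rw [← ENNReal.ofReal_le_ofReal_iff (by positivity), ofReal_integral_eq_lintegral_ofReal iD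
      (Filter.Eventually.of_forall fun q => mul_nonneg (C.wK_nonneg _) (sq_nonneg _)),
      ← lintegral_thinWeight]
    refine e1.trans ((mul_le_mul_right e2 _).trans (le_of_eq ?_))
    rw [← ofReal_traceMass hk, ENNReal.ofReal_mul (by positivity),
      ENNReal.ofReal_mul (by positivity), ENNReal.ofReal_pow hm, ENNReal.ofReal_ofNat]
    ring
  have hpt : ∀ q, p.commDensity U q ≤ U.N / 2 * (C.wK.fn (radSq q 0) *
      smear (moll n k) S.b q ^ 2) + U.N / 2 * (C.wK.fn (radSq q 0) * D q ^ 2) := fun q => by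
    have hα : C.α ≤ k + 1 := by
      have : (k₁ : ℝ) ≤ k := by exact_mod_cast e3
      linarith
    refine (commDensity_le U hc hk hα q).trans ?_
    have hK := C.wK_nonneg (radSq q 0)
    have hsq := sq_nonneg (|smear (moll n k) S.b q| - D q)
    have h3 : |smear (moll n k) S.b q| * D q ≤
        1 / 2 * smear (moll n k) S.b q ^ 2 + 1 / 2 * D q ^ 2 := by
      rw [← sq_abs (smear (moll n k) S.b q)]; linarith
    calc C.wK.fn (radSq q 0) * |smear (moll n k) S.b q| * (U.N * D q)
        = U.N * C.wK.fn (radSq q 0) * (|smear (moll n k) S.b q| * D q) := by ring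
      _ ≤ U.N * C.wK.fn (radSq q 0) *
          (1 / 2 * smear (moll n k) S.b q ^ 2 + 1 / 2 * D q ^ 2) := by gcongr
      _ = _ := by ring
  calc ∫ q in Metric.closedBall 0 4, p.commDensity U q
      ≤ ∫ q in Metric.closedBall 0 4, (U.N / 2 * (C.wK.fn (radSq q 0) *
          smear (moll n k) S.b q ^ 2) + U.N / 2 * (C.wK.fn (radSq q 0) * D q ^ 2)) :=
        integral_mono (p.integrableOn_commDensity U)
          ((iB.const_mul _).add (iD.const_mul _)) hpt
    _ = U.N / 2 * p.traceMass +
        U.N / 2 * ∫ q in Metric.closedBall 0 4, C.wK.fn (radSq q 0) * D q ^ 2 := by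
        rw [integral_add (iB.const_mul _) (iD.const_mul _), integral_const_mul,
          integral_const_mul, hT]
    _ ≤ U.N / 2 * p.traceMass + U.N / 2 * (4 * domMass n ^ 2 * p.traceMass) := by gcongr
    _ = _ := by ring

end SlabSolution

end
end ParabolicExtension

/-! ### The Carleman inequality for weak solutions in separated coordinates -/

namespace ParabolicExtension

noncomputable section

theorem measurable_carlemanFn (α ε : ℝ) : Measurable (carlemanFn α ε) := by
  unfold carlemanFn; fun_prop

theorem ae_eq_of_forall_ae_eq {n : ℕ} {F G : ThinPt n × ℝ → ℝ} (hF : Measurable F)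
    (hG : Measurable G)
    (h : ∀ q, ∀ᵐ y ∂(volume.restrict (Ioi (0 : ℝ))), F (q, y) = G (q, y)) :
    F =ᵐ[slabMeasure n] G := by
  have hs : MeasurableSet {w | F w = G w} := measurableSet_eq_fun hF hG
  exact (Measure.ae_prod_iff_ae_ae hs).2 (Filter.Eventually.of_forall h)

theorem ae_slabMeasure_pos {n : ℕ} : ∀ᵐ w ∂(slabMeasure n), 0 < w.2 := by
  rw [slabMeasure, Measure.ae_prod_iff_ae_ae (measurableSet_lt measurable_const measurable_snd)]
  exact Filter.Eventually.of_forall fun _ => ae_restrict_mem measurableSet_Ioi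

namespace SlabSolution

variable {n : ℕ} {C : CarlemanParams n} {S : SlabSolution n C.a}

/-- The weighted mass of the source on the half space. -/
def sourceMass (S : SlabSolution n C.a) : ℝ≥0∞ :=
  ∫⁻ w, ENNReal.ofReal (w.2 ^ (-C.a) * (carlemanFn C.α C.ε (radSq w.1 w.2) * radSq w.1 w.2 *
    S.g w.1 w.2 ^ 2)) ∂(slabMeasure n)

theorem measurable_sourceMass : Measurable fun w : ThinPt n × ℝ =>
    ENNReal.ofReal (w.2 ^ (-C.a) * (carlemanFn C.α C.ε (radSq w.1 w.2) * radSq w.1 w.2 *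
      S.g w.1 w.2 ^ 2)) := by
  have h1 := S.loc_g.1
  have h2 := continuous_radSq (n := n).measurable
  have h3 := (measurable_carlemanFn C.α C.ε).comp h2
  have h4 : Measurable fun w : ThinPt n × ℝ => w.2 ^ (-C.a) := by fun_prop
  exact (h4.mul ((h3.mul h2).mul (h1.pow_const 2))).ennreal_ofReal

theorem measurable_profile_source {κ : ThinPt n → ℝ} (hκ : IsKernel κ)
    (h : Concentrated S C.c κ) :
    Measurable fun w : ThinPt n × ℝ => (S.profile C.a_lt_one hκ h).source w.1 w.2 := by
  have h1 := measurable_smear hκ.continuous.measurable S.loc_g.1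
  have h2 := measurable_smear hκ.kerL.continuous.measurable S.loc_W.1
  have h3 := (S.profile C.a_lt_one hκ h).bdd_lap.1
  have h4 := (S.profile C.a_lt_one hκ h).bdd_ut.1
  have h5 : Measurable fun z : ThinPt n × ℝ => z.2 ^ C.a := by fun_prop
  exact ((h1.sub (h5.mul h2)).add (h5.mul h3)).add (h5.mul h4)

/-- The mollification acts on each height separately, so the weighted Jensen inequality is applied
slice by slice; the factor `y^(-a)` is constant on a slice. -/
theorem eventually_lintegral_source_le (S : SlabSolution n C.a) :
    ∀ᶠ k in Filter.atTop, ∀ hk : Concentrated S C.c (moll n k),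
      ∫⁻ w, ENNReal.ofReal
          ((S.profile C.a_lt_one (isKernel_moll k) hk).sourceDensity w.1 w.2) ∂(boxMeasure n 4 2) ≤
        2 * S.sourceMass := by
  obtain ⟨δ, hδ, hcmp⟩ := exists_radial_le (n := n) (φ := fun s => carlemanFn C.α C.ε s * s)
    ((continuousOn_carlemanFn C.α C.ε).mul continuousOn_id)
    (fun s hs => mul_pos (carlemanFn_pos hs) hs) (half_pos C.c_pos)
  filter_upwards [tendsto_scale hδ] with k hk hc
  have hrad : ∀ (q : ThinPt n) (y : ℝ), 0 ≤ radSq q y := fun q y => by unfold radSq; positivity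
  have hsm : Measurable fun w : ThinPt n × ℝ => smear (moll n k) (fun z => S.g z w.2) w.1 :=
    measurable_smear (isKernel_moll k).continuous.measurable S.loc_g.1
  have hwt : Measurable fun w : ThinPt n × ℝ => C.wK.fn (radSq w.1 w.2) * radSq w.1 w.2 :=
    ((C.wK.continuous_fn.comp (continuous_radSq (n := n))).mul continuous_radSq).measurable
  have hy : Measurable fun w : ThinPt n × ℝ => w.2 ^ (-C.a) := by fun_prop
  have e1 : ∀ᵐ w ∂(boxMeasure n 4 2), ENNReal.ofReal
      ((S.profile C.a_lt_one (isKernel_moll k) hc).sourceDensity w.1 w.2) =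
      ENNReal.ofReal (w.2 ^ (-C.a) * (C.wK.fn (radSq w.1 w.2) * radSq w.1 w.2 *
        smear (moll n k) (fun z => S.g z w.2) w.1 ^ 2)) := by
    have := ae_eq_of_forall_ae_eq (measurable_profile_source (isKernel_moll k) hc) hsm
      fun q => ae_profile_source (isKernel_moll k) hc q
    filter_upwards [(Measure.absolutelyContinuous_of_le (boxMeasure_le 4 2)).ae_le this] with w hw
    rw [Profile.sourceDensity]
    simp only [hw]
  have hm : Measurable fun w : ThinPt n × ℝ => ENNReal.ofReal (w.2 ^ (-C.a) *
      (C.wK.fn (radSq w.1 w.2) * radSq w.1 w.2 *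
        smear (moll n k) (fun z => S.g z w.2) w.1 ^ 2)) := (hy.mul (hwt.mul (hsm.pow_const 2))).ennreal_ofReal
  have hslice : ∀ y ∈ Ioc (0 : ℝ) 2, ∫⁻ q in Metric.closedBall (0 : ThinPt n) 4,
      ENNReal.ofReal (y ^ (-C.a) * (C.wK.fn (radSq q y) * radSq q y *
        smear (moll n k) (fun z => S.g z y) q ^ 2)) ≤
      2 * ∫⁻ z, ENNReal.ofReal (y ^ (-C.a) * (carlemanFn C.α C.ε (radSq z y) * radSq z y *
        S.g z y ^ 2)) := fun y hy0 => by
    have hya : 0 ≤ y ^ (-C.a) := Real.rpow_nonneg hy0.1.le _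
    set w : ThinPt n → ℝ≥0∞ := (Metric.closedBall 0 4).indicator fun q =>
      ENNReal.ofReal (y ^ (-C.a) * (C.wK.fn (radSq q y) * radSq q y)) with hw
    have hwm : Measurable w := by
      refine Measurable.indicator ?_ measurableSet_closedBall
      exact ((hwt.comp (measurable_id.prodMk measurable_const)).const_mul _).ennreal_ofReal
    have h1 := lintegral_mul_sq_smear_le (isKernel_moll k).continuous (isKernel_moll k).compact
      (moll_nonneg k) (integral_moll k)
      (A := fun z => S.g z y) (S.loc_g.1.comp (measurable_id.prodMk measurable_const)) hwm
      (w' := fun z => ENNReal.ofReal (y ^ (-C.a) *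
        (carlemanFn C.α C.ε (radSq z y) * radSq z y))) (by
        refine Filter.Eventually.of_forall fun z _ q hq => ?_
        by_cases hq4 : q ∈ Metric.closedBall (0 : ThinPt n) 4
        swap
        · rw [hw, indicator_of_notMem hq4]; exact zero_le
        rw [hw, indicator_of_mem hq4, ← ENNReal.ofReal_ofNat, ← ENNReal.ofReal_mul (by norm_num)]
        refine ENNReal.ofReal_le_ofReal ?_
        rw [mul_left_comm 2]
        refine mul_le_mul_of_nonneg_left ?_ hya
        rcases le_or_gt (C.c / 2) (radSq q y) with hr | hr
        · refine (mul_le_mul_of_nonneg_right (C.wK_le (hrad q y)) (hrad q y)).trans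
            (hcmp q hq4 y ⟨hy0.1.le, hy0.2⟩ hr z ((norm_lt_of_moll_ne_zero hq).trans hk))
        · rw [C.wK_eq_zero hr.le, zero_mul]
          have := CarlemanParams.carlemanFn_nonneg (α := C.α) (ε := C.ε) (hrad z y)
          have := hrad z y
          positivity)
    rw [← lintegral_indicator measurableSet_closedBall]
    refine (le_of_eq (lintegral_congr fun q => ?_)).trans (h1.trans (le_of_eq ?_))
    · by_cases hq : q ∈ Metric.closedBall (0 : ThinPt n) 4
      · rw [hw, indicator_of_mem hq, indicator_of_mem hq, ← ofReal_mul_sq, mul_assoc (y ^ (-C.a))]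
        exact mul_nonneg hya (mul_nonneg (C.wK_nonneg _) (hrad q y))
      · rw [hw, indicator_of_notMem hq, indicator_of_notMem hq, zero_mul]
    · rw [ENNReal.ofReal_one, one_pow, mul_one]
      congr 1
      refine lintegral_congr fun z => ?_
      rw [← ofReal_mul_sq, mul_assoc (y ^ (-C.a))]
      exact mul_nonneg hya (mul_nonneg (CarlemanParams.carlemanFn_nonneg (hrad z y)) (hrad z y))
  rw [lintegral_congr_ae e1, boxMeasure, lintegral_prod_symm' _ hm, sourceMass, slabMeasure,
    lintegral_prod_symm' _ measurable_sourceMass, ← lintegral_const_mul' _ _ (by simp)]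
  refine (setLIntegral_mono' measurableSet_Ioc fun y hy0 => hslice y hy0).trans ?_
  exact lintegral_mono_set Ioc_subset_Ioi_self

/-- Lebesgue differentiation on almost every slice, followed by Fubini for null sets; the
convergence set is measurable. -/
theorem ae_tendsto_smear_moll {H : ThinPt n → ℝ → ℝ} (hH : LocSlab H) :
    ∀ᵐ w ∂(slabMeasure n),
      Filter.Tendsto (fun k => smear (moll n k) (fun z => H z w.2) w.1) Filter.atTop
        (nhds (H w.1 w.2)) := by
  have hs : MeasurableSet {w : ThinPt n × ℝ | Filter.Tendsto
      (fun k => smear (moll n k) (fun z => H z w.2) w.1) Filter.atTop (nhds (H w.1 w.2))} :=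
    measurableSet_tendsto_fun
      (fun k => measurable_smear (isKernel_moll k).continuous.measurable hH.1) hH.1
  rw [slabMeasure, Measure.ae_prod_iff_ae_ae hs, Measure.ae_ae_comm hs]
  filter_upwards [hH.ae_locallyIntegrable] with y hy
  exact tendsto_smear_moll hy

/-- The Carleman inequality in the coordinates `((x, t), y)`. -/
theorem carleman_le (S : SlabSolution n C.a) (U : Potential n)
    (hc : S.c = fun z => U.V z * S.b z) {k₀ : ℕ}
    (h : ∀ k, k₀ ≤ k → Concentrated S C.c (moll n k))
    (hW : ∀ z y, S.W z y ≠ 0 → ‖z‖ ≤ 4 ∧ y ≤ 2) {l : ℝ} (hN : U.N ≤ l * C.α ^ (1 - C.a))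
    (hl : (2 + (1 + 4 * domMass n ^ 2) / 2) * Profile.traceConst C.a * l ≤ C.ε ^ 2 / 112) :
    ENNReal.ofReal (C.α ^ 3) * ∫⁻ w, ENNReal.ofReal (w.2 ^ C.a * (C.wu.fn (radSq w.1 w.2) *
        S.W w.1 w.2 ^ 2)) ∂(slabMeasure n) ≤
      ENNReal.ofReal (8 / C.ε ^ 2) * S.sourceMass := by
  have hε := C.ε_pos
  have hα := C.α_pos
  -- An infinite right-hand side is trivial; otherwise the mollified source densities are
  -- integrable, as the inequality for profiles requires.
  rcases eq_or_ne S.sourceMass ⊤ with htop | htop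
  · rw [htop, ENNReal.mul_top]
    · exact le_top
    · simpa using by positivity
  set F : ℕ → ThinPt n × ℝ → ℝ≥0∞ := fun k w => ENNReal.ofReal (w.2 ^ C.a *
    (C.wu.fn (radSq w.1 w.2) * smear (moll n k) (fun z => S.W z w.2) w.1 ^ 2)) with hF
  have hsm : ∀ k, Measurable fun w : ThinPt n × ℝ => smear (moll n k) (fun z => S.W z w.2) w.1 :=
    fun k => measurable_smear (isKernel_moll k).continuous.measurable S.loc_W.1
  have hFm : ∀ k, Measurable (F k) := fun k => by
    have h1 : Measurable fun w : ThinPt n × ℝ => C.wu.fn (radSq w.1 w.2) :=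
      (C.wu.continuous_fn.comp (continuous_radSq (n := n))).measurable
    have h2 : Measurable fun w : ThinPt n × ℝ => w.2 ^ C.a := by fun_prop
    exact (h2.mul (h1.mul ((hsm k).pow_const 2))).ennreal_ofReal
  have hk : ∀ᶠ k in Filter.atTop, ENNReal.ofReal (C.α ^ 3) * ∫⁻ w, F k w ∂(boxMeasure n 4 2) ≤
      ENNReal.ofReal (8 / C.ε ^ 2) * S.sourceMass := by
    filter_upwards [eventually_lintegral_source_le S, eventually_commDensity_le U hc h,
      Filter.eventually_ge_atTop k₀] with k e1 e2 e3
    have hcon := h k e3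
    specialize e1 hcon
    specialize e2 hcon
    set p := S.profile C.a_lt_one (isKernel_moll k) hcon with hp
    have hnn : 0 ≤ᵐ[boxMeasure n 4 2] fun w : ThinPt n × ℝ => p.sourceDensity w.1 w.2 := by
      filter_upwards [ae_boxMeasure] with w hw
      have : 0 ≤ radSq w.1 w.2 := by unfold radSq; positivity
      exact mul_nonneg (Real.rpow_nonneg hw.2.1.le _)
        (mul_nonneg (mul_nonneg (C.wK_nonneg _) this) (sq_nonneg _))
    have hint : Integrable (fun w : ThinPt n × ℝ => p.sourceDensity w.1 w.2)
        (boxMeasure n 4 2) := by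
      refine ⟨p.aestronglyMeasurable_sourceDensity, ?_⟩
      rw [hasFiniteIntegral_iff_ofReal hnn]
      exact e1.trans_lt (ENNReal.mul_lt_top (by simp) htop.lt_top)
    have key := (profile_supportedIn (isKernel_moll k) hcon).carleman_le (by norm_num) hint U
      (by positivity) e2 hN hl
    have hmnn : 0 ≤ᵐ[boxMeasure n 4 2] fun w : ThinPt n × ℝ => p.massDensity w.1 w.2 := by
      filter_upwards [ae_boxMeasure] with w hw
      exact p.massDensity_nonneg _ hw.2.1.le
    have hFk : ∫⁻ w, F k w ∂(boxMeasure n 4 2) =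
        ENNReal.ofReal (∫ w, p.massDensity w.1 w.2 ∂(boxMeasure n 4 2)) := by
      rw [ofReal_integral_eq_lintegral_ofReal p.integrable_massDensity hmnn]
      refine lintegral_congr_ae ?_
      have := ae_eq_of_forall_ae_eq (hsm k) p.bdd_u.1
        fun q => S.ae_smear_W C.a_lt_one (isKernel_moll k) q
      filter_upwards [(Measure.absolutelyContinuous_of_le (boxMeasure_le 4 2)).ae_le this]
        with w hw
      simp only [hF, Profile.massDensity, hw]
    rw [hFk, ← ENNReal.ofReal_mul (by positivity)]
    refine (ENNReal.ofReal_le_ofReal key).trans ?_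
    rw [ENNReal.ofReal_mul (by positivity), ofReal_integral_eq_lintegral_ofReal hint hnn]
    refine (mul_le_mul_right e1 _).trans (le_of_eq ?_)
    rw [← mul_assoc, ← ENNReal.ofReal_ofNat 2, ← ENNReal.ofReal_mul (by positivity)]
    congr 2; ring
  have hbox : ∫⁻ w, ENNReal.ofReal (w.2 ^ C.a * (C.wu.fn (radSq w.1 w.2) *
        S.W w.1 w.2 ^ 2)) ∂(slabMeasure n) =
      ∫⁻ w, ENNReal.ofReal (w.2 ^ C.a * (C.wu.fn (radSq w.1 w.2) *
        S.W w.1 w.2 ^ 2)) ∂(boxMeasure n 4 2) := by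
    have hs : MeasurableSet (Metric.closedBall (0 : ThinPt n) 4 ×ˢ Ioc (0 : ℝ) 2) :=
      measurableSet_closedBall.prod measurableSet_Ioc
    rw [boxMeasure_eq, ← lintegral_indicator hs]
    refine lintegral_congr_ae ?_
    filter_upwards [ae_slabMeasure_pos] with w hw
    by_cases hmem : w ∈ Metric.closedBall (0 : ThinPt n) 4 ×ˢ Ioc (0 : ℝ) 2
    · rw [indicator_of_mem hmem]
    · rw [indicator_of_notMem hmem]
      have : S.W w.1 w.2 = 0 := by
        by_contra hne
        obtain ⟨h1, h2⟩ := hW _ _ hne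
        exact hmem ⟨by simpa using h1, hw, h2⟩
      simp [this]
  rw [hbox, ← lintegral_const_mul' _ _ ENNReal.ofReal_ne_top]
  -- Fatou's lemma along the mollified solutions, which converge almost everywhere. The bound in
  -- `hk` is uniform, with `8 = 4 · 2` from the profile inequality and the Jensen factor.
  refine le_trans (lintegral_mono_ae ?_) ((lintegral_liminf_le (u := Filter.atTop)
    fun k => (hFm k).const_mul (ENNReal.ofReal (C.α ^ 3))).trans ?_)
  · filter_upwards [(Measure.absolutelyContinuous_of_le (boxMeasure_le 4 2)).ae_le
      (ae_tendsto_smear_moll S.loc_W)] with w hw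
    refine (Filter.Tendsto.liminf_eq ?_).ge
    refine ENNReal.Tendsto.const_mul ?_ (Or.inr ENNReal.ofReal_ne_top)
    exact (ENNReal.continuous_ofReal.tendsto _).comp
      (((hw.pow 2).const_mul _).const_mul _)
  · refine Filter.liminf_le_of_frequently_le' ?_
    refine Filter.Eventually.frequently ?_
    filter_upwards [hk] with k hk
    rwa [lintegral_const_mul' _ _ ENNReal.ofReal_ne_top]

end SlabSolution

end
end ParabolicExtension

/-! ### The norm of the potential, the support condition and the theorem -/

namespace ParabolicExtension

noncomputable section

variable {n : ℕ}

theorem enorm_le_c1Norm (V : ThinPt n → ℝ) (q : ThinPt n) : ‖V q‖ₑ ≤ c1Norm V :=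
  (le_iSup (fun q => ‖V q‖ₑ) q).trans (le_self_add.trans le_self_add)

theorem enorm_fderiv_le_c1Norm (V : ThinPt n → ℝ) (q : ThinPt n) :
    ‖fderiv ℝ (fun x => V (x, q.2)) q.1‖ₑ ≤ c1Norm V :=
  (le_iSup (fun q : ThinPt n => ‖fderiv ℝ (fun x => V (x, q.2)) q.1‖ₑ) q).trans
    (le_add_self.trans le_self_add)

theorem enorm_deriv_le_c1Norm (V : ThinPt n → ℝ) (q : ThinPt n) :
    ‖deriv (fun t => V (q.1, t)) q.2‖ₑ ≤ c1Norm V :=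
  (le_iSup (fun q : ThinPt n => ‖deriv (fun t => V (q.1, t)) q.2‖ₑ) q).trans le_add_self

theorem norm_le_toReal {E : Type*} [NormedAddCommGroup E] {x : E} {b : ℝ≥0∞} (hb : b ≠ ⊤)
    (h : ‖x‖ₑ ≤ b) : ‖x‖ ≤ b.toReal := by
  rw [← toReal_enorm]; exact ENNReal.toReal_mono hb h

/-- A potential of class `C¹` with finite norm. -/
def Potential.ofContDiff (V : ThinPt n → ℝ) (hV : ContDiff ℝ 1 V) (h : c1Norm V ≠ ⊤) :
    Potential n where
  V := V
  N := (c1Norm V).toReal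
  contDiff := hV
  abs_le q := norm_le_toReal h (enorm_le_c1Norm V q)
  spatial_le q x := by
    have hd : HasFDerivAt V (fderiv ℝ V (q.1, q.2)) (q.1, q.2) :=
      (hV.differentiable (by simp) _).hasFDerivAt
    have h1 := (hd.comp (f := fun x => (x, q.2)) q.1 (hasFDerivAt_prodMk_left q.1 q.2)).fderiv
    have h2 := (fderiv ℝ (fun x => V (x, q.2)) q.1).le_opNorm x
    rw [show (fun x => V (x, q.2)) = V ∘ fun x => (x, q.2) from rfl, h1] at h2
    refine h2.trans (mul_le_mul_of_nonneg_right ?_ (norm_nonneg _))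
    rw [← h1]
    exact norm_le_toReal h (enorm_fderiv_le_c1Norm V q)
  time_le q := by
    have hd : HasFDerivAt V (fderiv ℝ V (q.1, q.2)) (q.1, q.2) :=
      (hV.differentiable (by simp) _).hasFDerivAt
    have h1 := (hd.comp (f := fun t => (q.1, t)) q.2 (hasFDerivAt_prodMk_right q.1 q.2)).hasDerivAt.deriv
    have h2 := norm_le_toReal h (enorm_deriv_le_c1Norm V q)
    rw [show (fun t => V (q.1, t)) = V ∘ fun t => (q.1, t) from rfl, h1] at h2
    simpa using h2

theorem rad_flat (w : ThinPt n × ℝ) : rad (flat n w) = Real.sqrt (radSq w.1 w.2) := rfl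

theorem sqrt_rpow_mul_exp {s : ℝ} (hs : 0 < s) (α ε : ℝ) :
    Real.sqrt s ^ (-2 * α) * Real.exp (2 * α * Real.sqrt s ^ ε) = carlemanFn α ε s * s := by
  have h : ∀ x : ℝ, Real.sqrt s ^ x = s ^ (x / 2) := fun x => by
    rw [Real.sqrt_eq_rpow, ← Real.rpow_mul hs.le]; congr 1; ring
  have e : s ^ (-2 * α / 2) = s ^ (-α - 1) * s := by
    rw [← Real.rpow_add_one hs.ne']; congr 1; ring
  rw [carlemanFn, h, h, e]
  ring

theorem sqrt_rpow_mul_exp_eq_div {s : ℝ} (hs : 0 < s) (α ε : ℝ) :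
    Real.sqrt s ^ (-2 * α - 4 + ε) * Real.exp (2 * α * Real.sqrt s ^ ε) =
      carlemanFn α ε s / s * s ^ (ε / 2) := by
  have h : ∀ x : ℝ, Real.sqrt s ^ x = s ^ (x / 2) := fun x => by
    rw [Real.sqrt_eq_rpow, ← Real.rpow_mul hs.le]; congr 1; ring
  have e : s ^ ((-2 * α - 4 + ε) / 2) = s ^ (-α - 1) / s * s ^ (ε / 2) := by
    rw [← Real.rpow_sub_one hs.ne', ← Real.rpow_add hs]; congr 1; ring
  rw [carlemanFn, h, h, e]
  ring

theorem lintegral_upper (Φ : Pt n → ℝ≥0∞) :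
    ∫⁻ p in upper n, Φ p = ∫⁻ w, Φ (flat n w) ∂(slabMeasure n) :=
  (measurePreserving_flat.lintegral_comp_emb (flat n).measurableEmbedding Φ).symm

/-- Compact subsets of the punctured half ball are uniformly away from the origin, and kernels of
small support keep them so. -/
theorem exists_concentrated {a : ℝ} {S : SlabSolution n a} {R : ℝ} (hR1 : R < 1)
    {K : Set (Pt n)} (hK : IsCompact K)
    (hKR : K ⊆ {p | 0 ≤ p.2.1 ∧ 0 < rad p ∧ rad p ≤ R ∧ 0 < p.2.2 ∧ p.2.2 < 1})
    (hS : ∀ z y, S.W z y ≠ 0 → (z.1, y, z.2) ∈ K) :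
    ∃ c, 0 < c ∧ (∃ k₀, ∀ k, k₀ ≤ k → S.Concentrated c (moll n k)) ∧
      ∀ z y, S.W z y ≠ 0 → c ≤ radSq z y ∧ radSq z y ≤ 1 ∧ ‖z‖ ≤ 4 ∧ y ≤ 2 := by
  set K' : Set (ThinPt n × ℝ) := (flat n).symm '' K with hK'
  have hcont : Continuous (flat n).symm :=
    (continuous_fst.prodMk (continuous_snd.comp continuous_snd)).prodMk
      (continuous_fst.comp continuous_snd)
  have hKc : IsCompact K' := hK.image hcont
  have hmem : ∀ w ∈ K', 0 < radSq w.1 w.2 ∧ radSq w.1 w.2 < 1 ∧ ‖w.1‖ < 2 := by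
    rintro _ ⟨p, hp, rfl⟩
    obtain ⟨h1, h2, h3, h4, h5⟩ := hKR hp
    have hr : rad p < 1 := h3.trans_lt hR1
    have hs : rad p = Real.sqrt (radSq (p.1, p.2.2) p.2.1) := rfl
    have hs0 : 0 < radSq (p.1, p.2.2) p.2.1 := by rw [hs] at h2; exact Real.sqrt_pos.1 h2
    have hs1 : radSq (p.1, p.2.2) p.2.1 < 1 := by
      rw [hs, Real.sqrt_lt' one_pos] at hr; simpa using hr
    refine ⟨hs0, hs1, ?_⟩
    have hx : ‖p.1‖ < 2 := by
      simp only [radSq] at hs1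
      nlinarith [sq_nonneg p.2.1, norm_nonneg p.1]
    have ht : ‖p.2.2‖ < 2 := by rw [Real.norm_eq_abs, abs_of_pos h4]; linarith
    exact max_lt hx ht
  obtain ⟨c', hc', hc⟩ := hKc.exists_forall_le' continuous_radSq.continuousOn
    fun w hw => (hmem w hw).1
  have hSK : ∀ z y, S.W z y ≠ 0 → (z, y) ∈ K' := fun z y h => ⟨_, hS z y h, rfl⟩
  -- Halving the minimum of `|X|²` on the compact set leaves a margin, so a small thickening of the
  -- support still avoids the far set.
  refine ⟨c' / 2, by positivity, ?_, fun z y h => ?_⟩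
  · set O : Set (ThinPt n × ℝ) := {w | c' / 2 < radSq w.1 w.2} ∩
      ({w | radSq w.1 w.2 < 1} ∩ {w | ‖w.1‖ < 2}) with hO
    have hopen : IsOpen O := (isOpen_lt continuous_const continuous_radSq).inter
      ((isOpen_lt continuous_radSq continuous_const).inter
        (isOpen_lt continuous_fst.norm continuous_const))
    obtain ⟨δ, hδ, hthick⟩ := hKc.exists_thickening_subset_open hopen fun w hw =>
      ⟨(half_lt_self hc').trans_le (hc w hw), (hmem w hw).2⟩
    obtain ⟨k₀, hk₀⟩ := Filter.eventually_atTop.1 (SlabSolution.tendsto_scale hδ)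
    refine ⟨k₀, fun k hk p hp z hz => ?_⟩
    by_contra hne
    have hd : p ∈ O := hthick <| Metric.mem_thickening_iff.2 ⟨(z, p.2), hSK _ _ hz, by
      have := (norm_lt_of_moll_ne_zero hne).trans (hk₀ k hk)
      simpa [Prod.dist_eq (x := p), dist_eq_norm] using this⟩
    rcases hp with h | h | h
    · exact lt_asymm h hd.1
    · exact lt_asymm h hd.2.1
    · exact lt_asymm h hd.2.2
  · have h1 := hmem _ (hSK z y h)
    have h2 := hc _ (hSK z y h)
    refine ⟨by simp only at h2; linarith, h1.2.1.le, by linarith [h1.2.2], ?_⟩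
    have h3 : radSq z y < 1 := h1.2.1
    simp only [radSq] at h3
    nlinarith [sq_nonneg ‖z.1‖]

/-- With `σ = 2s` the largeness condition on `α` becomes the smallness of the potential relative to
`α^(2s)`, which is what the absorption uses. -/
theorem le_mul_rpow_of_lt {N l σ α A : ℝ} (hN : 0 ≤ N) (hl : 0 < l) (hσ : 0 < σ)
    (hA : l ^ (-(1 / σ)) ≤ A) (h : A * (1 + N ^ (1 / σ)) < α) : N ≤ l * α ^ σ := by
  have hl0 : 0 < l ^ (-(1 / σ)) := Real.rpow_pos_of_pos hl _
  have hN0 : 0 ≤ N ^ (1 / σ) := Real.rpow_nonneg hN _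
  have h1 : l ^ (-(1 / σ)) * N ^ (1 / σ) ≤ α := by
    have := mul_le_mul_of_nonneg_right hA hN0
    nlinarith [hl0.trans_le hA]
  have h2 := Real.rpow_le_rpow (by positivity) h1 hσ.le
  rw [Real.mul_rpow hl0.le hN0, ← Real.rpow_mul hl.le, ← Real.rpow_mul hN,
    one_div_mul_cancel hσ.ne', Real.rpow_one, neg_mul, one_div_mul_cancel hσ.ne',
    Real.rpow_neg_one] at h2
  rwa [inv_mul_le_iff₀ hl] at h2

end
end ParabolicExtension

theorem lemma3p1 (n : ℕ) (hn : 1 ≤ n) (s : ℝ) (hs0 : 0 < s) (hs1 : s < 1) (a ε : ℝ)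
    (ha : a = 1 - 2 * s) (hε : ε = (1 - a) / 4) :
    ∃ C : ℝ, 0 < C ∧ ∃ R₀ : ℝ, 0 < R₀ ∧
      ∀ R : ℝ, 0 < R → R < R₀ →
      ∀ V : ParabolicExtension.ThinPt n → ℝ,
        ContDiff ℝ 1 V → ParabolicExtension.c1Norm V ≠ ⊤ →
      ∀ W g : ParabolicExtension.Pt n → ℝ,
        ParabolicExtension.IsWeakSolution a V g W →
        ParabolicExtension.SupportedInHalfBall R W →
      ∀ α : ℝ, C * (1 + (ParabolicExtension.c1Norm V).toReal ^ (1 / (2 * s))) < α →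
        ENNReal.ofReal (α ^ 3) *
            ∫⁻ p in ParabolicExtension.upper n,
              ENNReal.ofReal
                (ParabolicExtension.rad p ^ (-2 * α - 4 + ε) *
                  Real.exp (2 * α * ParabolicExtension.rad p ^ ε) * W p ^ 2 * p.2.1 ^ a) ≤
          ENNReal.ofReal C *
            ∫⁻ p in ParabolicExtension.upper n,
              ENNReal.ofReal
                (ParabolicExtension.rad p ^ (-2 * α) *
                  Real.exp (2 * α * ParabolicExtension.rad p ^ ε) * g p ^ 2 * p.2.1 ^ (-a)) := by
  have ha' : -1 < a := by linarith
  have ha1 : a < 1 := by linarith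
  have hε0 : 0 < ε := by linarith
  have hT : 0 < ParabolicExtension.Profile.traceConst a := by
    have h1 : 0 < 1 + a := by linarith
    have h2 : 0 < 1 - a := by linarith
    unfold ParabolicExtension.Profile.traceConst
    positivity
  set M : ℝ := (2 + (1 + 4 * ParabolicExtension.domMass n ^ 2) / 2) *
    ParabolicExtension.Profile.traceConst a with hM
  have hM0 : 0 < M := by positivity
  -- The largest ratio of `‖V‖` to `α^(2s)` for which the boundary and commutator terms can be
  -- absorbed.
  set l : ℝ := ε ^ 2 / 112 / M with hl
  have hl0 : 0 < l := by positivity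
  have hlM : M * l ≤ ε ^ 2 / 112 := by rw [hl, mul_div_cancel₀ _ hM0.ne']
  have hlp : 0 < l ^ (-(1 / (2 * s))) := Real.rpow_pos_of_pos hl0 _
  -- The summand `n + 4` ensures `α ≥ n + 1 + a + 2`, as `a < 1`; `8/ε²` is the constant of the
  -- inequality; the last summand gives `‖V‖ ≤ l α^(2s)`. The radius `1` keeps `|X|^ε ≤ 1` on the
  -- support, and neither constant depends on the lower bound `c` for `|X|²`.
  refine ⟨n + 4 + 8 / ε ^ 2 + l ^ (-(1 / (2 * s))), by positivity, 1, one_pos, ?_⟩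
  intro R _ hR1 V hV hVf W g hW hsupp α hα
  obtain ⟨K, hK, hKR, hWK⟩ := hsupp
  obtain ⟨S, hSK, hSc, hSW, hSg⟩ :=
    ParabolicExtension.exists_slabSolution ha' ha1 hV.continuous hW hK hWK
  obtain ⟨c, hc, ⟨k₀, hcon⟩, hS⟩ := ParabolicExtension.exists_concentrated hR1 hK hKR hSK
  set N : ℝ := (ParabolicExtension.c1Norm V).toReal with hN
  have hN0 : 0 ≤ N := ENNReal.toReal_nonneg
  have hNp : 0 ≤ N ^ (1 / (2 * s)) := Real.rpow_nonneg hN0 _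
  have h8 : 0 < 8 / ε ^ 2 := by positivity
  have hn0 : (0 : ℝ) ≤ n := n.cast_nonneg
  have hαn : n + 1 + a + 2 ≤ α := by
    have : (n + 4 + 8 / ε ^ 2 + l ^ (-(1 / (2 * s)))) * 1 ≤
      (n + 4 + 8 / ε ^ 2 + l ^ (-(1 / (2 * s)))) * (1 + N ^ (1 / (2 * s))) := by
      gcongr; linarith
    linarith
  have hNl : N ≤ l * α ^ (1 - a) := by
    rw [show 1 - a = 2 * s by linarith]
    exact ParabolicExtension.le_mul_rpow_of_lt hN0 hl0 (by positivity) (by linarith) hα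
  let P : ParabolicExtension.CarlemanParams n :=
    ⟨a, ε, α, c, by linarith, hε0, by linarith, hαn, hc⟩
  have key := ParabolicExtension.SlabSolution.carleman_le (C := P) S
    (ParabolicExtension.Potential.ofContDiff V hV hVf) hSc hcon
    (fun z y h => (hS z y h).2.2) hNl hlM
  rw [ParabolicExtension.lintegral_upper, ParabolicExtension.lintegral_upper]
  have eL : ∀ᵐ w ∂(ParabolicExtension.slabMeasure n), ENNReal.ofReal
      (ParabolicExtension.rad (ParabolicExtension.flat n w) ^ (-2 * α - 4 + ε) *
        Real.exp (2 * α * ParabolicExtension.rad (ParabolicExtension.flat n w) ^ ε) *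
        W (ParabolicExtension.flat n w) ^ 2 * (ParabolicExtension.flat n w).2.1 ^ a) =
      ENNReal.ofReal (w.2 ^ P.a * (P.wu.fn (ParabolicExtension.radSq w.1 w.2) *
        S.W w.1 w.2 ^ 2)) := by
    filter_upwards [hSW] with w hw
    rw [← hw]
    -- Where the solution is nonzero, `c ≤ |X|² ≤ 1`, so the truncated weight is the true one.
    by_cases h0 : S.W w.1 w.2 = 0
    · simp [h0]
    obtain ⟨h1, h2, -⟩ := hS _ _ h0
    rw [ParabolicExtension.rad_flat,
      ParabolicExtension.sqrt_rpow_mul_exp_eq_div (hc.trans_le h1),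
      show P.wu.fn (ParabolicExtension.radSq w.1 w.2) = _ from
        ParabolicExtension.RadialWeight.extend_fn h1 h2, mul_comm]
    rfl
  have eR : ∀ᵐ w ∂(ParabolicExtension.slabMeasure n), ENNReal.ofReal
      (ParabolicExtension.rad (ParabolicExtension.flat n w) ^ (-2 * α) *
        Real.exp (2 * α * ParabolicExtension.rad (ParabolicExtension.flat n w) ^ ε) *
        g (ParabolicExtension.flat n w) ^ 2 * (ParabolicExtension.flat n w).2.1 ^ (-a)) =
      ENNReal.ofReal (w.2 ^ (-P.a) * (ParabolicExtension.carlemanFn P.α P.ε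
        (ParabolicExtension.radSq w.1 w.2) * ParabolicExtension.radSq w.1 w.2 *
        S.g w.1 w.2 ^ 2)) := by
    filter_upwards [hSg, ParabolicExtension.ae_slabMeasure_pos] with w hw hy
    have hs : 0 < ParabolicExtension.radSq w.1 w.2 := by
      unfold ParabolicExtension.radSq; positivity
    rw [← hw, ParabolicExtension.rad_flat, ParabolicExtension.sqrt_rpow_mul_exp hs, mul_comm]
    rfl
  rw [MeasureTheory.lintegral_congr_ae eL, MeasureTheory.lintegral_congr_ae eR]
  refine key.trans ?_
  exact mul_le_mul_left (ENNReal.ofReal_le_ofReal (by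
    change 8 / ε ^ 2 ≤ _
    linarith)) _
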